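/- **Theorem 1.** Let $f:\mathbb R^d\to\mathbb R$ ($d\ge 1$) be differentiable, bounded below by $f^*\in\mathbb R$, and $L$-smooth with $L>0$: $|f(y)-f(x)-\langle\nabla f(x),y-x\rangle|\le\frac L2\|x-y\|^2$ for all $x,y$ (equivalently, $\nabla f$ is $L$-Lipschitz). Let a gradient oracle return at each $x\in\mathbb R^d$ a random vector $g(x)$, drawn afresh at every call, with $\mathbb E[g(x)]=\nabla f(x)$ and, for every coordinate $i$, almost surely $(g(x)_i-\nabla f(x)_i)^2\le\sigma_{0,i}^2+\sigma_{1,i}^2\,\nabla f(x)_i^2$, where $\sigma_0,\sigma_1\in[0,\infty)^d$. Let $T\ge 1$, $C_0,\varepsilon_0>0$, $0\le\beta_1<\beta_2<1$, $\eta=C_0\sqrt{1-\beta_2}$, $\epsilon=\varepsilon_0\sqrt{1-\beta_2}$, and let $x_1,\dots,x_T$ be generated by Adam: $x_1\in\mathbb R^d$ is given, $m_0=v_0=0$, and for $s\ge1$, with $g_s=g(x_s)$ and for each coordinate $i$, $$m_{s,i}=\beta_1m_{s-1,i}+(1-\beta_1)g_{s,i},\qquad v_{s,i}=\beta_2v_{s-1,i}+(1-\beta_2)g_{s,i}^2,\qquad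 x_{s+1,i}=x_{s,i}-\frac{\eta_s}{\sqrt{v_{s,i}}+\epsilon_s}\,m_{s,i},$$ where $\eta_s=\eta\sqrt{1-\beta_2^s}/(1-\beta_1^s)$ and $\epsilon_s=\epsilon\sqrt{1-\beta_2^s}$. Then for every $\delta\in(0,1)$, with probability at least $1-\delta$, $$\frac1T\sum_{s=1}^T\|\nabla f(x_s)\|^2\le C\cdot\frac{G}{TC_0}\left(\varepsilon_0+\sqrt{\frac{\|\sigma_0\|^2+(1+\|\sigma_1\|_\infty^2)G}{1-\beta_2}}\right).$$ Here $C>0$ depends only on $L$ and, with $\Sigma_{\max}=\max\{1,\sqrt{(1+\beta_2)/\beta_2}-1\}$, $\ell=\log(\mathcal F(T)/\beta_2^T)$ and $\ell'=\log(dT/\delta)$, $$\mathcal F(T)=1+\frac{2}{\epsilon^2}\left[\left(\|\sigma_0\|_\infty^2+2(1+\|\sigma_1\|_\infty^2)\|\nabla f(x_1)\|^2\right)T+\frac{2(1+\|\sigma_1\|_\infty^2)dL^2C_0^2}{1-\beta_1/\beta_2}T^3\right],$$ $$\begin{aligned}G={}&8L(f(x_1)-f^*)+\frac{256L^2C_0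^2\beta_1^2d^2}{(1-\beta_1)^3(1-\beta_1/\beta_2)}+\frac{4L^2C_0^2\beta_1^2d}{(1-\beta_1)^2(1-\beta_1/\beta_2)}+\frac{48LC_0\|\sigma_0\|_\infty}{1-\beta_1}d\,\ell'\\&+\frac{8LC_0\beta_1^2}{(1-\beta_1)^2(1-\beta_1/\beta_2)}\left[\frac{4\|\sigma_0\|_\infty}{\beta_2}+\frac{\varepsilon_0+\sqrt2\|\sigma_0\|_\infty}{\sqrt{\beta_2}}+\frac{LC_0}{2}(1+4\Sigma_{\max}^2)\right]d\,\ell\\&+8\left(\frac{3L^2C_0^2}{(1-\beta_1)^2}+\frac{8L\|\sigma_0\|_\infty C_0}{1-\beta_1}\right)d\,\ell+\frac{2304L^2C_0^2\|\sigma_1\|_\infty^2}{(1-\beta_1)^2}d^2\ell'^2\\&+256\left[\frac{16L^2C_0^2\|\sigma_1\|_\infty^2}{(1-\beta_1)^2}+\frac{9L^2C_0^2\beta_1^4(1+\|\sigma_1\|_\infty^2)}{\beta_2^2(1-\beta_1)^4(1-\beta_1/\beta_2)^2}\right]d^2\ell^2.\end{aligned}$$ Moreover $\mathcal F(T)\le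 C\,\mathcal F_0(T)$ and $G\le C\,G_0$, with the same $C$, where $$\mathcal F_0(T)=1+\frac{\|\sigma_0\|_\infty^2T+(1+\|\sigma_1\|_\infty^2)\left(\|\nabla f(x_1)\|^2T+\frac{dC_0^2}{1-\beta_1/\beta_2}T^3\right)}{\varepsilon_0^2(1-\beta_2)},\qquad \Lambda=\log\frac{\mathcal F_0(T)+dT}{\delta\beta_2^T},$$ $$G_0=f(x_1)-f^*+\frac{C_0(C_0+\varepsilon_0+\|\sigma_0\|_\infty)}{\beta_2(1-\beta_1)^2(1-\beta_1/\beta_2)}\,d\,\Lambda+\frac{C_0^2(1+\|\sigma_1\|_\infty^2)}{\beta_2^2(1-\beta_1)^4(1-\beta_1/\beta_2)^2}\,d^2\Lambda^2.$$ -/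

import Mathlib

open MeasureTheory ProbabilityTheory
open scoped Gradient

noncomputable section

namespace Adam

/-- The Euclidean space `ℝ^d`, with its `l₂` norm. -/
abbrev E (d : ℕ) : Type := EuclideanSpace ℝ (Fin d)

/-- `f` is `L`-smooth: it is differentiable and differs from its first order expansion at any
point by at most `L / 2` times the squared distance
(equivalently, the gradient is `L`-Lipschitz). -/
structure IsLSmooth {d : ℕ} (f : E d → ℝ) (L : ℝ) : Prop where
  differentiable : Differentiable ℝ f
  abs_le : ∀ x y : E d, |f y - f x - inner ℝ (∇ f x) (y - x)| ≤ L / 2 * ‖x - y‖ ^ 2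

/-! ### The algorithm

The oracle answers are a sequence `g 1, g 2, …`; the value `g 0` is never used. -/

/-- First moment: `m 0 = 0`, `m s = β₁ m (s-1) + (1 - β₁) g s`, coordinate by coordinate. -/
def moment₁ {d : ℕ} (β₁ : ℝ) (g : ℕ → E d) : ℕ → Fin d → ℝ
  | 0, _ => 0
  | s + 1, i => β₁ * moment₁ β₁ g s i + (1 - β₁) * g (s + 1) i

/-- Second moment: `v 0 = 0`, `v s = β₂ v (s-1) + (1 - β₂) (g s)²`, coordinate by coordinate. -/
def moment₂ {d : ℕ} (β₂ : ℝ) (g : ℕ → E d) : ℕ → Fin d → ℝ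
  | 0, _ => 0
  | s + 1, i => β₂ * moment₂ β₂ g s i + (1 - β₂) * (g (s + 1) i) ^ 2

/-- The step size `η_s = η √(1 - β₂^s) / (1 - β₁^s)`, holding both bias corrections. -/
def stepSize (β₁ β₂ η : ℝ) (s : ℕ) : ℝ :=
  η * √(1 - β₂ ^ s) / (1 - β₁ ^ s)

/-- `ε_s = ε √(1 - β₂^s)`. -/
def stepEps (β₂ ε : ℝ) (s : ℕ) : ℝ :=
  ε * √(1 - β₂ ^ s)

/-- The iterates of Adam started at `x₁`, as a function of the oracle answers: `iterate … s` is
`x_s`, for `s ≥ 1`. By convention `x_0 = x_1`. -/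
def iterate {d : ℕ} (β₁ β₂ η ε : ℝ) (x₁ : E d) (g : ℕ → E d) : ℕ → E d
  | 0 => x₁
  | 1 => x₁
  | s + 2 => WithLp.toLp 2 fun i =>
      iterate β₁ β₂ η ε x₁ g (s + 1) i -
        stepSize β₁ β₂ η (s + 1) / (√(moment₂ β₂ g (s + 1) i) + stepEps β₂ ε (s + 1)) *
          moment₁ β₁ g (s + 1) i

/-! ### The stochastic gradient oracle

The oracle is a Markov kernel: `κ x` is the law of the random vector `g(x)` returned at `x`. -/

/-- The oracle is unbiased: `g(x)` is integrable with mean `∇ f x`, for every `x`. -/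
def IsUnbiased {d : ℕ} (κ : Kernel (E d) (E d)) (f : E d → ℝ) : Prop :=
  ∀ x : E d, Integrable (fun y : E d => y) (κ x) ∧ ∫ y, y ∂(κ x) = ∇ f x

/-- Coordinate-wise affine variance noise: for every `x` and `i`, almost surely
`(g(x)_i - ∇f(x)_i)² ≤ σ₀ᵢ² + σ₁ᵢ² ∇f(x)_i²`. -/
def HasAffineNoise {d : ℕ} (κ : Kernel (E d) (E d)) (f : E d → ℝ) (σ₀ σ₁ : Fin d → ℝ) : Prop :=
  ∀ (x : E d) (i : Fin d), ∀ᵐ y ∂(κ x),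
    (y i - ∇ f x i) ^ 2 ≤ σ₀ i ^ 2 + σ₁ i ^ 2 * (∇ f x i) ^ 2

/-- `g 1, …, g T` are the answers of the oracle `κ` in a run of `T` steps of Adam started
at `x₁`: for a filtration `ℱ` (`ℱ s` is the information available after step `s`), the answer
`g s` is `ℱ s`-measurable and, conditionally on `ℱ (s-1)`, it is drawn from `κ x_s`. -/
structure IsRun {d : ℕ} {Ω : Type*} [mΩ : MeasurableSpace Ω] (P : Measure Ω)
    (κ : Kernel (E d) (E d)) (β₁ β₂ η ε : ℝ) (x₁ : E d) (T : ℕ) (ℱ : Filtration ℕ mΩ)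
    (g : ℕ → Ω → E d) : Prop where
  measurable : ∀ s < T, Measurable[ℱ (s + 1)] (g (s + 1))
  cond_law : ∀ s < T, ∀ A : Set (E d), MeasurableSet A →
    P[(g (s + 1) ⁻¹' A).indicator (fun _ => (1 : ℝ)) | ℱ s] =ᵐ[P]
      fun ω => (κ (iterate β₁ β₂ η ε x₁ (fun k => g k ω) (s + 1))).real A

/-! ### The quantities in the bound

For `σ : Fin d → ℝ`, Mathlib's `‖σ‖` is the sup norm `‖σ‖_∞`. The argument `grad₁` stands for
`‖∇f(x_1)‖` and `Δ₁` for `f(x_1) - f^*`. -/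

/-- `𝓕(T)`, explicitly. -/
def logArg {d : ℕ} (L C₀ ε₀ β₁ β₂ : ℝ) (σ₀ σ₁ : Fin d → ℝ) (grad₁ : ℝ) (T : ℕ) : ℝ :=
  1 + 2 / (ε₀ * √(1 - β₂)) ^ 2 *
    ((‖σ₀‖ ^ 2 + 2 * (1 + ‖σ₁‖ ^ 2) * grad₁ ^ 2) * T +
      2 * (1 + ‖σ₁‖ ^ 2) * d * L ^ 2 * C₀ ^ 2 / (1 - β₁ / β₂) * (T : ℝ) ^ 3)

/-- The order of `𝓕(T)`. -/
def logArgOrder {d : ℕ} (C₀ ε₀ β₁ β₂ : ℝ) (σ₀ σ₁ : Fin d → ℝ) (grad₁ : ℝ) (T : ℕ) : ℝ :=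
  1 + (‖σ₀‖ ^ 2 * T + (1 + ‖σ₁‖ ^ 2) *
      (grad₁ ^ 2 * T + d * C₀ ^ 2 / (1 - β₁ / β₂) * (T : ℝ) ^ 3)) / (ε₀ ^ 2 * (1 - β₂))

/-- `Σ_max = max {1, √((1 + β₂) / β₂) - 1}`. -/
def sigmaMax (β₂ : ℝ) : ℝ := max 1 (√((1 + β₂) / β₂) - 1)

/-- `G`, explicitly. -/
def gradBound {d : ℕ} (L C₀ ε₀ β₁ β₂ : ℝ) (σ₀ σ₁ : Fin d → ℝ) (grad₁ Δ₁ δ : ℝ) (T : ℕ) : ℝ :=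
  let ℓ := Real.log (logArg L C₀ ε₀ β₁ β₂ σ₀ σ₁ grad₁ T / β₂ ^ T)
  let ℓ' := Real.log (d * T / δ)
  8 * L * Δ₁
  + 256 * L ^ 2 * C₀ ^ 2 * β₁ ^ 2 * d ^ 2 / ((1 - β₁) ^ 3 * (1 - β₁ / β₂))
  + 4 * L ^ 2 * C₀ ^ 2 * β₁ ^ 2 * d / ((1 - β₁) ^ 2 * (1 - β₁ / β₂))
  + 48 * L * C₀ * ‖σ₀‖ / (1 - β₁) * d * ℓ'
  + 8 * L * C₀ * β₁ ^ 2 / ((1 - β₁) ^ 2 * (1 - β₁ / β₂)) *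
      (4 * ‖σ₀‖ / β₂ + (ε₀ + √2 * ‖σ₀‖) / √β₂ + L * C₀ / 2 * (1 + 4 * sigmaMax β₂ ^ 2)) * d * ℓ
  + 8 * (3 * L ^ 2 * C₀ ^ 2 / (1 - β₁) ^ 2 + 8 * L * ‖σ₀‖ * C₀ / (1 - β₁)) * d * ℓ
  + 2304 * L ^ 2 * C₀ ^ 2 * ‖σ₁‖ ^ 2 / (1 - β₁) ^ 2 * d ^ 2 * ℓ' ^ 2
  + 256 * (16 * L ^ 2 * C₀ ^ 2 * ‖σ₁‖ ^ 2 / (1 - β₁) ^ 2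
      + 9 * L ^ 2 * C₀ ^ 2 * β₁ ^ 4 * (1 + ‖σ₁‖ ^ 2)
          / (β₂ ^ 2 * (1 - β₁) ^ 4 * (1 - β₁ / β₂) ^ 2)) * d ^ 2 * ℓ ^ 2

/-- The order of `G`. -/
def gradBoundOrder {d : ℕ} (C₀ ε₀ β₁ β₂ : ℝ) (σ₀ σ₁ : Fin d → ℝ) (grad₁ Δ₁ δ : ℝ)
    (T : ℕ) : ℝ :=
  let ℓ := Real.log ((logArgOrder C₀ ε₀ β₁ β₂ σ₀ σ₁ grad₁ T + d * T) / (δ * β₂ ^ T))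
  Δ₁
  + C₀ * (C₀ + ε₀ + ‖σ₀‖) / (β₂ * (1 - β₁) ^ 2 * (1 - β₁ / β₂)) * (d * ℓ)
  + C₀ ^ 2 * (1 + ‖σ₁‖ ^ 2) / (β₂ ^ 2 * (1 - β₁) ^ 4 * (1 - β₁ / β₂) ^ 2) * (d ^ 2 * ℓ ^ 2)

end Adam

end

/-! There are two difficulties: the learning rate depends on the current stochastic gradient, and
the noise grows with the gradient, on which no bound is assumed.

With ρ = β₁/(1-β₁), the points y_k = x_{k+1} + ρ(x_{k+1} - x_k) move along the fresh answer alone,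
up to a momentum term that carries only the variation of the learning rate (`extra_succ`). The
descent inequality is applied along y_k. In the main term the denominator √v_{k+1} + ε_{k+1} is
replaced by a proxy a_i that depends on the past only. This produces a true decrease D_k = Σ_i
η_{k+1} γ_i²/a_i, where γ is the gradient, a martingale difference, and errors proportional to
normalized squares of gradients and momenta or to the variation of the step size
(`gradient_term_le`, `momentum_term_le`, `descent_step`). The normalized squares sum to a logarithm
(`sum_sq_div_le_log`), whose argument needs only the crude polynomial bound on gradients that
follows from steps of bounded length.

While the gradients stay below H, Hoeffding's lemma makes the martingale difference conditionally
sub-Gaussian with variance proxy at most B D_k, where B is `noiseBudget`. An exponential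
supermartingale, switched off once a gradient exceeds H, then bounds the martingale by a quarter of
the total decrease plus 2B log(1/δ), with probability at least 1-δ (`lintegral_exp_succ_le`,
`measure_lt_sum_exponent_le`, `sum_mart_le`).

A bootstrap closes the argument. The errors are affine in H up to terms independent of the
randomness, so Young's inequality puts them below H²/4 + G (`four_mul_totalError_le`), which is
3H²/4 when H² = 2G. Since squared gradients are controlled by f - f^*, no gradient can be the first
to exceed H (`sum_norm_grad_sq_le`). The total decrease up to time T is therefore at most H²/L, and
D_k dominates a multiple of the squared gradient (`norm_grad_sq_le_decrease`), which gives the rate.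
-/

namespace Adam

/-! ### Exponential averages and their normalized sums. -/

variable {d : ℕ} {β β₁ β₂ : ℝ} {g : ℕ → E d} {i : Fin d}

lemma moment₁_zero : moment₁ β g 0 i = 0 := rfl

lemma moment₂_zero : moment₂ β g 0 i = 0 := rfl

lemma moment₁_succ (k : ℕ) :
    moment₁ β g (k + 1) i = β * moment₁ β g k i + (1 - β) * g (k + 1) i := rfl

lemma moment₂_succ (k : ℕ) :
    moment₂ β g (k + 1) i = β * moment₂ β g k i + (1 - β) * g (k + 1) i ^ 2 := rfl

lemma moment₂_nonneg (h0 : 0 ≤ β) (h1 : β ≤ 1) (k : ℕ) : 0 ≤ moment₂ β g k i := by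
  induction k with
  | zero => exact le_rfl
  | succ k ih =>
    rw [moment₂_succ]
    have := sub_nonneg.2 h1
    positivity

lemma moment₂_le (h0 : 0 ≤ β) (h1 : β ≤ 1) {R : ℝ} {n : ℕ}
    (hg : ∀ k < n, g (k + 1) i ^ 2 ≤ R) : moment₂ β g n i ≤ (1 - β ^ n) * R := by
  induction n with
  | zero => simp [moment₂_zero]
  | succ n ih =>
    rw [moment₂_succ]
    have h2 := ih fun k hk => hg k (by omega)
    have h3 := hg n (by omega)
    have h4 := mul_le_mul_of_nonneg_left h2 h0
    have h5 := mul_le_mul_of_nonneg_left h3 (sub_nonneg.2 h1)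
    rw [pow_succ β n]
    linarith

lemma mul_moment₂_le_succ (h1 : β ≤ 1) (k : ℕ) :
    β * moment₂ β g k i ≤ moment₂ β g (k + 1) i := by
  rw [moment₂_succ]
  have := mul_nonneg (sub_nonneg.2 h1) (sq_nonneg (g (k + 1) i))
  linarith

/-- Cauchy–Schwarz for weights of total mass 1 - β^k. Keeping this factor, instead of bounding it by
1, later absorbs the bias correction of the step size. -/
lemma moment₁_sq_le (h0 : 0 ≤ β) (h1 : β ≤ 1) (k : ℕ) :
    moment₁ β g k i ^ 2 ≤ (1 - β ^ k) * moment₂ β g k i := by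
  induction k with
  | zero => simp [moment₁_zero, moment₂_zero]
  | succ k ih =>
    have hJ : 0 ≤ moment₂ β g k i := moment₂_nonneg h0 h1 k
    have hp : 0 ≤ 1 - β ^ k := sub_nonneg.2 (pow_le_one₀ h0 h1)
    rw [moment₁_succ, moment₂_succ, pow_succ β k]
    set M := moment₁ β g k i
    set J := moment₂ β g k i
    set p := 1 - β ^ k with hpdef
    set u := g (k + 1) i
    have e : 1 - β ^ k * β = β * p + (1 - β) := by rw [hpdef]; ring
    have key : 2 * M * u ≤ p * u ^ 2 + J := by
      refine le_of_abs_le (abs_le_of_sq_le_sq ?_ (by positivity))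
      have := mul_le_mul_of_nonneg_right ih (sq_nonneg u)
      nlinarith [sq_nonneg (p * u ^ 2 - J)]
    rw [e]
    have k1 := mul_le_mul_of_nonneg_left key (mul_nonneg h0 (sub_nonneg.2 h1))
    have k2 := mul_le_mul_of_nonneg_left ih (sq_nonneg β)
    linarith

/-- Unrolled, both sides carry the factor (1-β₁)(1-β₂) and differ only in the weights β₁^(k-j) and
β₂^(k-j). This compares momentum averages with v. -/
lemma moment₂_le_moment₂ (h0 : 0 ≤ β₁) (h12 : β₁ ≤ β₂) (h1 : β₂ ≤ 1) (k : ℕ) :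
    (1 - β₂) * moment₂ β₁ g k i ≤ (1 - β₁) * moment₂ β₂ g k i := by
  induction k with
  | zero => simp [moment₂_zero]
  | succ k ih =>
    rw [moment₂_succ, moment₂_succ]
    have hV : 0 ≤ moment₂ β₂ g k i := moment₂_nonneg (h0.trans h12) h1 k
    have k1 := mul_le_mul_of_nonneg_left ih h0
    have k2 := mul_le_mul_of_nonneg_right h12 (mul_nonneg (sub_nonneg.2 (h12.trans h1)) hV)
    linarith

/-- The logarithmic bound on the sum of normalized squared gradients. -/
lemma sum_sq_div_le_log (h0 : 0 < β) (h1 : β ≤ 1) {c : ℝ} (hc : 0 < c) (n : ℕ) :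
    ∑ k ∈ Finset.range n, (1 - β) * g (k + 1) i ^ 2 / (c + moment₂ β g (k + 1) i) ≤
      Real.log ((1 + moment₂ β g n i / c) / β ^ n) := by
  induction n with
  | zero => simp [moment₂_zero]
  | succ n ih =>
    rw [Finset.sum_range_succ]
    have hV : 0 ≤ moment₂ β g n i := moment₂_nonneg h0.le h1 n
    have hV' : 0 ≤ moment₂ β g (n + 1) i := moment₂_nonneg h0.le h1 _
    have hs := moment₂_succ (β := β) (g := g) (i := i) n
    set V := moment₂ β g n i
    set V' := moment₂ β g (n + 1) i
    have hA : 0 < c + V' := by positivity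
    have hB : 0 < c + β * V := by positivity
    -- The numerator is (c + V') - (c + βV), so this is 1 - 1/x ≤ log x. Replacing c + βV by the
    -- smaller β(c + V) makes the logarithms telescope, at the price of a factor 1/β per step: hence
    -- β^n.
    have step : (1 - β) * g (n + 1) i ^ 2 / (c + V') ≤ Real.log ((c + V') / (c + β * V)) := by
      have h := Real.one_sub_inv_le_log_of_pos (div_pos hA hB)
      refine le_trans (le_of_eq ?_) h
      rw [inv_div, one_sub_div hA.ne']
      congr 1
      linarith
    have e2 : Real.log ((c + V') / (c + β * V)) ≤ Real.log ((c + V') / (β * (c + V))) := by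
      apply Real.log_le_log (by positivity)
      apply div_le_div_of_nonneg_left hA.le (by positivity)
      nlinarith
    have e3 : Real.log ((1 + V / c) / β ^ n) + Real.log ((c + V') / (β * (c + V))) =
        Real.log ((1 + V' / c) / β ^ (n + 1)) := by
      rw [← Real.log_mul (by positivity) (by positivity)]
      congr 1
      rw [pow_succ]
      field_simp
    linarith

lemma sum_le_of_geometric {r e : ℕ → ℝ} {ρ : ℝ} (h0 : r 0 = 0)
    (h : ∀ k, r (k + 1) ≤ ρ * r k + e k) (n : ℕ) :
    (1 - ρ) * ∑ k ∈ Finset.range n, r (k + 1) + ρ * r n ≤ ∑ k ∈ Finset.range n, e k := by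
  induction n with
  | zero => simp [h0]
  | succ n ih =>
    rw [Finset.sum_range_succ, Finset.sum_range_succ]
    linarith [h n]

/-- In one step the numerator keeps a factor β₁ of its past while the denominator shrinks at most by
β₂, so the quotient obeys a recurrence of ratio β₁/β₂ < 1. -/
lemma sum_moment₂_div_le (h0 : 0 ≤ β₁) (h12 : β₁ < β₂) (h1 : β₂ ≤ 1) {c : ℝ} (hc : 0 < c)
    (n : ℕ) :
    ∑ k ∈ Finset.range n, (1 - β₂) * moment₂ β₁ g (k + 1) i / (c + moment₂ β₂ g (k + 1) i) ≤
      (1 - β₁) / (1 - β₁ / β₂) *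
        ∑ k ∈ Finset.range n, (1 - β₂) * g (k + 1) i ^ 2 / (c + moment₂ β₂ g (k + 1) i) := by
  have hβ₂ : 0 < β₂ := h0.trans_lt h12
  have hρ : 0 < 1 - β₁ / β₂ := sub_pos.2 ((div_lt_one hβ₂).2 h12)
  have hV : ∀ k, 0 ≤ moment₂ β₂ g k i := moment₂_nonneg hβ₂.le h1
  have hJ : ∀ k, 0 ≤ moment₂ β₁ g k i := moment₂_nonneg h0 (h12.le.trans h1)
  have key := sum_le_of_geometric (ρ := β₁ / β₂)
    (r := fun k => (1 - β₂) * moment₂ β₁ g k i / (c + moment₂ β₂ g k i))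
    (e := fun k => (1 - β₁) *
      ((1 - β₂) * g (k + 1) i ^ 2 / (c + moment₂ β₂ g (k + 1) i)))
    (by simp [moment₂_zero]) (fun k => by
      have hA : 0 < c + moment₂ β₂ g (k + 1) i := by linarith [hV (k + 1)]
      have hB : 0 < c + moment₂ β₂ g k i := by linarith [hV k]
      have hAB : β₂ * (c + moment₂ β₂ g k i) ≤ c + moment₂ β₂ g (k + 1) i := by
        have := mul_moment₂_le_succ (g := g) (i := i) h1 k
        nlinarith
      have h2 : (1 - β₂) * (β₁ * moment₂ β₁ g k i) / (c + moment₂ β₂ g (k + 1) i) ≤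
          (1 - β₂) * (β₁ * moment₂ β₁ g k i) / (β₂ * (c + moment₂ β₂ g k i)) :=
        div_le_div_of_nonneg_left
          (mul_nonneg (sub_nonneg.2 h1) (mul_nonneg h0 (hJ k))) (by positivity) hAB
      calc _ = (1 - β₂) * (β₁ * moment₂ β₁ g k i) / (c + moment₂ β₂ g (k + 1) i) +
            (1 - β₁) * ((1 - β₂) * g (k + 1) i ^ 2 / (c + moment₂ β₂ g (k + 1) i)) := by
              rw [moment₂_succ (β := β₁)]; ring
        _ ≤ _ := by
          refine add_le_add_left (h2.trans (le_of_eq ?_)) _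
          field_simp) n
  rw [← Finset.mul_sum] at key
  have hr : 0 ≤ β₁ / β₂ * ((1 - β₂) * moment₂ β₁ g n i / (c + moment₂ β₂ g n i)) :=
    mul_nonneg (by positivity) (div_nonneg (mul_nonneg (sub_nonneg.2 h1) (hJ n))
      (by linarith [hV n]))
  rw [div_mul_eq_mul_div, le_div_iff₀ hρ]
  linarith

/-! ### Step sizes -/

lemma one_sub_pow_pos (h0 : 0 ≤ β) (h1 : β < 1) (k : ℕ) : 0 < 1 - β ^ (k + 1) :=
  sub_pos.2 (pow_lt_one₀ h0 h1 k.succ_ne_zero)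

lemma one_sub_le_one_sub_pow (h0 : 0 ≤ β) (h1 : β < 1) (k : ℕ) : 1 - β ≤ 1 - β ^ (k + 1) :=
  sub_le_sub_left (pow_le_of_le_one h0 h1.le k.succ_ne_zero) _

lemma stepSize_nonneg (h0 : 0 ≤ β₁) (h1 : β₁ < 1) {η : ℝ} (hη : 0 ≤ η) (k : ℕ) :
    0 ≤ stepSize β₁ β₂ η k :=
  div_nonneg (by positivity) (sub_nonneg.2 (pow_le_one₀ h0 h1.le))

lemma stepSize_le (h0 : 0 ≤ β₁) (h1 : β₁ < 1) (h2 : 0 ≤ β₂) {η : ℝ} (hη : 0 ≤ η) (k : ℕ) :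
    stepSize β₁ β₂ η (k + 1) ≤ η / (1 - β₁) := by
  have h3 : √(1 - β₂ ^ (k + 1)) ≤ 1 := Real.sqrt_le_one.2 (by linarith [pow_nonneg h2 (k + 1)])
  exact div_le_div₀ hη (mul_le_of_le_one_right hη h3) (sub_pos.2 h1)
    (one_sub_le_one_sub_pow h0 h1 k)

lemma le_stepSize (h0 : 0 ≤ β₁) (h1 : β₁ < 1) {η : ℝ} (hη : 0 ≤ η) (k : ℕ) :
    η * √(1 - β₂ ^ (k + 1)) ≤ stepSize β₁ β₂ η (k + 1) :=
  le_div_self (by positivity) (one_sub_pow_pos h0 h1 k) (by linarith [pow_nonneg h0 (k + 1)])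

lemma sqrt_one_sub_pow_le_succ (h0 : 0 ≤ β) (h1 : β ≤ 1) (k : ℕ) :
    √(1 - β ^ k) ≤ √(1 - β ^ (k + 1)) :=
  Real.sqrt_le_sqrt (sub_le_sub_left (pow_le_pow_of_le_one h0 h1 k.le_succ) _)

/-- The total variation of the step size. -/
lemma sum_abs_stepSize_sub_le (h0 : 0 ≤ β₁) (h1 : β₁ < 1) (h2 : 0 ≤ β₂) (h3 : β₂ ≤ 1)
    {η : ℝ} (hη : 0 ≤ η) (n : ℕ) :
    ∑ k ∈ Finset.range n, |stepSize β₁ β₂ η (k + 2) - stepSize β₁ β₂ η (k + 1)| ≤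
      2 * η / (1 - β₁) := by
  have hb : 0 < 1 - β₁ := sub_pos.2 h1
  -- The step size is a product r·p with p = √(1-β₂^k) increasing to at most 1 and r = η/(1-β₁^k)
  -- decreasing from R = η/(1-β₁). Its variation is dominated by the increments of the increasing
  -- sequence R p - r, which telescope.
  have hstep : ∀ k, |stepSize β₁ β₂ η (k + 2) - stepSize β₁ β₂ η (k + 1)| ≤
      (η / (1 - β₁) * √(1 - β₂ ^ (k + 1 + 1)) - η / (1 - β₁ ^ (k + 1 + 1))) -
      (η / (1 - β₁) * √(1 - β₂ ^ (k + 1)) - η / (1 - β₁ ^ (k + 1))) := by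
    intro k
    set p := √(1 - β₂ ^ (k + 1)) with hp
    set p' := √(1 - β₂ ^ (k + 1 + 1)) with hp'
    have hpp : p ≤ p' := sqrt_one_sub_pow_le_succ h2 h3 _
    have hp1 : p ≤ 1 := Real.sqrt_le_one.2 (by linarith [pow_nonneg h2 (k + 1)])
    have hp0 : 0 ≤ p := Real.sqrt_nonneg _
    have hr := one_sub_pow_pos h0 h1 k
    have hr' := one_sub_pow_pos h0 h1 (k + 1)
    have hrr : η / (1 - β₁ ^ (k + 1 + 1)) ≤ η / (1 - β₁ ^ (k + 1)) :=
      div_le_div_of_nonneg_left hη hr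
        (sub_le_sub_left (pow_le_pow_of_le_one h0 h1.le (k + 1).le_succ) _)
    have hrb : η / (1 - β₁ ^ (k + 1 + 1)) ≤ η / (1 - β₁) :=
      div_le_div_of_nonneg_left hη hb (one_sub_le_one_sub_pow h0 h1 _)
    have e1 : stepSize β₁ β₂ η (k + 2) = η / (1 - β₁ ^ (k + 1 + 1)) * p' := by
      simp only [stepSize, hp']; ring_nf
    have e2 : stepSize β₁ β₂ η (k + 1) = η / (1 - β₁ ^ (k + 1)) * p := by
      simp only [stepSize, hp]; ring
    rw [e1, e2]
    set r := η / (1 - β₁ ^ (k + 1))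
    set r' := η / (1 - β₁ ^ (k + 1 + 1))
    set R := η / (1 - β₁)
    have hr0 : 0 ≤ r' := by positivity
    rw [abs_le]
    constructor <;> nlinarith [mul_nonneg (sub_nonneg.2 hpp) (sub_nonneg.2 hrb),
      mul_nonneg hp0 (sub_nonneg.2 hrr), mul_nonneg (sub_nonneg.2 hp1) (sub_nonneg.2 hrr),
      mul_nonneg (sub_nonneg.2 hpp) hr0, mul_nonneg (sub_nonneg.2 hpp) (hr0.trans hrb)]
  have htel := Finset.sum_range_sub
    (fun k => η / (1 - β₁) * √(1 - β₂ ^ (k + 1)) - η / (1 - β₁ ^ (k + 1))) n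
  refine (Finset.sum_le_sum fun k _ => hstep k).trans (htel.le.trans ?_)
  have h4 : η / (1 - β₁) * √(1 - β₂ ^ (n + 1)) ≤ η / (1 - β₁) :=
    mul_le_of_le_one_right (by positivity)
      (Real.sqrt_le_one.2 (by linarith [pow_nonneg h2 (n + 1)]))
  have h5 : 0 ≤ η / (1 - β₁ ^ (n + 1)) := div_nonneg hη (one_sub_pow_pos h0 h1 n).le
  have h6 : 0 ≤ η / (1 - β₁) * √(1 - β₂ ^ (0 + 1)) := by positivity
  have h7 : η / (1 - β₁ ^ (0 + 1)) = η / (1 - β₁) := by simp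
  have h8 : 2 * η / (1 - β₁) = η / (1 - β₁) + η / (1 - β₁) := by ring
  linarith

/-! ### Scalar inequalities -/

/-- √(A + s²) is the Euclidean norm of (√A, s), hence 1-Lipschitz in s. -/
lemma abs_sqrt_sub_sqrt_le {A : ℝ} (hA : 0 ≤ A) (s t : ℝ) :
    |√(A + s ^ 2) - √(A + t ^ 2)| ≤ |s - t| := by
  refine abs_le_of_sq_le_sq ?_ (abs_nonneg _)
  rw [sq_abs]
  have h1 := Real.sq_sqrt (by positivity : 0 ≤ A + s ^ 2)
  have h2 := Real.sq_sqrt (by positivity : 0 ≤ A + t ^ 2)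
  have h3 : A + s * t ≤ √(A + s ^ 2) * √(A + t ^ 2) := by
    rw [← Real.sqrt_mul (by positivity)]
    apply Real.le_sqrt_of_sq_le
    nlinarith [mul_nonneg hA (sq_nonneg (s - t))]
  nlinarith

lemma abs_sqrt_sub_sqrt_le_sqrt {a b c : ℝ} (ha : 0 ≤ a) (hb : 0 ≤ b) (h : |a - b| ≤ c) :
    |√a - √b| ≤ √c := by
  apply Real.le_sqrt_of_sq_le
  rw [sq_abs]
  have h1 := Real.sq_sqrt ha
  have h2 := Real.sq_sqrt hb
  have h3 := Real.sqrt_nonneg a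
  have h4 := Real.sqrt_nonneg b
  obtain ⟨h5, h6⟩ := abs_le.1 h
  rcases le_total (√a) (√b) with h7 | h7 <;> nlinarith

/-- The adaptive denominator is close to its predictable proxy. -/
lemma abs_sqrt_sub_proxy_le {A u γ N : ℝ} (hA : 0 ≤ A) (hβ : β ≤ 1) (hN : 0 ≤ N)
    (h : |u - γ| ≤ N) :
    |√(A + (1 - β) * u ^ 2) - √(A + (1 - β) * (γ ^ 2 + N ^ 2))| ≤ 2 * √(1 - β) * N := by
  have hb : 0 ≤ 1 - β := sub_nonneg.2 hβ
  have e1 : (1 - β) * u ^ 2 = (√(1 - β) * |u|) ^ 2 := by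
    rw [mul_pow, Real.sq_sqrt hb, sq_abs]
  have e2 : (1 - β) * (γ ^ 2 + N ^ 2) = (√(1 - β) * √(γ ^ 2 + N ^ 2)) ^ 2 := by
    rw [mul_pow, Real.sq_sqrt hb, Real.sq_sqrt (by positivity)]
  rw [e1, e2]
  refine (abs_sqrt_sub_sqrt_le hA _ _).trans ?_
  rw [← mul_sub, abs_mul, abs_of_nonneg (Real.sqrt_nonneg _), mul_comm 2, mul_assoc]
  refine mul_le_mul_of_nonneg_left ?_ (Real.sqrt_nonneg _)
  have h1 : |γ| ≤ √(γ ^ 2 + N ^ 2) := Real.abs_le_sqrt (by nlinarith)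
  have h2 : √(γ ^ 2 + N ^ 2) ≤ |γ| + N := by
    apply Real.sqrt_le_iff.2 ⟨by positivity, ?_⟩
    nlinarith [sq_abs γ, mul_nonneg (abs_nonneg γ) hN]
  have h3 := (abs_abs_sub_abs_le u γ).trans h
  rw [abs_le] at h3 ⊢
  constructor <;> linarith [h3.1, h3.2]

lemma mul_le_quarter_add {x y a : ℝ} (ha : 0 < a) : x * y ≤ x ^ 2 / (4 * a) + a * y ^ 2 := by
  have h : x ^ 2 / (4 * a) + a * y ^ 2 - x * y = (x - 2 * a * y) ^ 2 / (4 * a) := by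
    field_simp
    ring
  have : 0 ≤ (x - 2 * a * y) ^ 2 / (4 * a) := by positivity
  linarith

end Adam

/-! ### Smooth functions: Lipschitz gradient, gradient domination, descent. -/

namespace Adam

variable {d : ℕ} {f : E d → ℝ} {L : ℝ}

lemma IsLSmooth.le_add (h : IsLSmooth f L) (x y : E d) :
    f y ≤ f x + inner ℝ (∇ f x) (y - x) + L / 2 * ‖x - y‖ ^ 2 := by
  linarith [(_root_.abs_le.1 (h.abs_le x y)).2]

/-- The value of f at (x+y)/2 + w is bounded above by the expansion at x and below by the expansion
at y. Centring at the midpoint is what gives the sharp Lipschitz constant L below. -/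
lemma IsLSmooth.inner_sub_le (h : IsLSmooth f L) (x y w : E d) :
    inner ℝ (∇ f y - ∇ f x) w ≤ f x - f y + 1 / 2 * inner ℝ (∇ f x + ∇ f y) (y - x) +
      L / 4 * ‖y - x‖ ^ 2 + L * ‖w‖ ^ 2 := by
  have h1 := (_root_.abs_le.1 (h.abs_le x ((1 / 2 : ℝ) • (x + y) + w))).2
  have h2 := (_root_.abs_le.1 (h.abs_le y ((1 / 2 : ℝ) • (x + y) + w))).1
  have e1 : (1 / 2 : ℝ) • (x + y) + w - x = (1 / 2 : ℝ) • (y - x) + w := by module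
  have e2 : (1 / 2 : ℝ) • (x + y) + w - y = -((1 / 2 : ℝ) • (y - x)) + w := by module
  have n1 : ‖x - ((1 / 2 : ℝ) • (x + y) + w)‖ ^ 2 =
      1 / 4 * ‖y - x‖ ^ 2 + inner ℝ (y - x) w + ‖w‖ ^ 2 := by
    rw [norm_sub_rev, e1, norm_add_sq_real, norm_smul, inner_smul_left]
    norm_num
    ring
  have n2 : ‖y - ((1 / 2 : ℝ) • (x + y) + w)‖ ^ 2 =
      1 / 4 * ‖y - x‖ ^ 2 - inner ℝ (y - x) w + ‖w‖ ^ 2 := by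
    rw [norm_sub_rev, e2, norm_add_sq_real, norm_neg, norm_smul, inner_neg_left, inner_smul_left]
    norm_num
    ring
  rw [n1, e1, inner_add_right, inner_smul_right] at h1
  rw [n2, e2, inner_add_right, inner_neg_right, inner_smul_right] at h2
  rw [inner_sub_left, inner_add_left]
  linarith

/-- The gradient of an `L`-smooth function is `L`-Lipschitz. -/
lemma IsLSmooth.norm_gradient_sub_le (h : IsLSmooth f L) (hL : 0 < L) (x y : E d) :
    ‖∇ f y - ∇ f x‖ ≤ L * ‖y - x‖ := by
  -- Exchanging x and y and reversing w, then adding, cancels the function values and the averaged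
  -- inner products. This w optimizes what remains.
  have h1 := h.inner_sub_le x y ((1 / (2 * L)) • (∇ f y - ∇ f x))
  have h2 := h.inner_sub_le y x (-((1 / (2 * L)) • (∇ f y - ∇ f x)))
  rw [norm_neg, inner_neg_right, ← neg_sub (∇ f y), inner_neg_left, neg_neg, ← neg_sub y x,
    inner_neg_right, norm_neg, add_comm (∇ f y)] at h2
  rw [norm_smul, inner_smul_right, real_inner_self_eq_norm_sq, Real.norm_of_nonneg (by positivity)]
    at h1 h2
  refine abs_le_of_sq_le_sq' ?_ (by positivity) |>.2
  have e : L * (1 / (2 * L) * ‖∇ f y - ∇ f x‖) ^ 2 =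
      1 / 2 * (1 / (2 * L) * ‖∇ f y - ∇ f x‖ ^ 2) := by field_simp
  have e' : (L * ‖y - x‖) ^ 2 - ‖∇ f y - ∇ f x‖ ^ 2 = 2 * L * (L / 2 * ‖y - x‖ ^ 2 -
    1 / (2 * L) * ‖∇ f y - ∇ f x‖ ^ 2) := by field_simp
  have h3 : 0 ≤ 2 * L * (L / 2 * ‖y - x‖ ^ 2 - 1 / (2 * L) * ‖∇ f y - ∇ f x‖ ^ 2) :=
    mul_nonneg (by positivity) (by linarith)
  linarith

lemma IsLSmooth.continuous_gradient (h : IsLSmooth f L) (hL : 0 < L) : Continuous (∇ f) :=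
  (LipschitzWith.of_dist_le_mul (K := ⟨L, hL.le⟩) fun x y => by
    rw [dist_eq_norm, dist_eq_norm]; exact h.norm_gradient_sub_le hL y x).continuous

/-- A gradient step of length 1/L lowers f by at least ‖∇f‖²/(2L), and f cannot go below c. -/
lemma IsLSmooth.norm_gradient_sq_le (h : IsLSmooth f L) (hL : 0 < L) {c : ℝ}
    (hc : ∀ x, c ≤ f x) (x : E d) : ‖∇ f x‖ ^ 2 ≤ 2 * L * (f x - c) := by
  have h1 := (hc _).trans (h.le_add x (x - (1 / L) • ∇ f x))
  rw [sub_sub_cancel, sub_sub_cancel_left, inner_neg_right, inner_smul_right,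
    real_inner_self_eq_norm_sq, norm_smul, Real.norm_of_nonneg (by positivity)] at h1
  have e : 2 * L * (f x - c) - ‖∇ f x‖ ^ 2 = 2 * L * (f x + -(1 / L * ‖∇ f x‖ ^ 2) +
    L / 2 * (1 / L * ‖∇ f x‖) ^ 2 - c) := by field_simp; ring
  have h3 := mul_nonneg (by positivity : 0 ≤ 2 * L) (sub_nonneg.2 h1)
  linarith

/-- One step of descent from a point `y` near `x`, along `u + w`. -/
lemma IsLSmooth.descent (h : IsLSmooth f L) (hL : 0 < L) (x y u w : E d) :
    f (y + (u + w)) ≤ f y + inner ℝ (∇ f x) u + inner ℝ (∇ f x) w + L / 2 * ‖y - x‖ ^ 2 +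
      2 * L * ‖u‖ ^ 2 + 2 * L * ‖w‖ ^ 2 := by
  have h1 := h.le_add y (y + (u + w))
  rw [add_sub_cancel_left, sub_add_cancel_left, norm_neg] at h1
  have h2 : inner ℝ (∇ f y - ∇ f x) (u + w) ≤ L * ‖y - x‖ * ‖u + w‖ :=
    (real_inner_le_norm _ _).trans
      (mul_le_mul_of_nonneg_right (h.norm_gradient_sub_le hL x y) (norm_nonneg _))
  rw [inner_sub_left] at h2
  have h3 : ‖u + w‖ ^ 2 ≤ 2 * ‖u‖ ^ 2 + 2 * ‖w‖ ^ 2 := by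
    have := norm_add_le u w
    nlinarith [sq_nonneg (‖u‖ - ‖w‖), norm_nonneg (u + w), norm_nonneg u, norm_nonneg w]
  rw [inner_add_right (∇ f x)] at h2
  nlinarith [sq_nonneg (‖y - x‖ - ‖u + w‖)]

end Adam

/-! ### Adam's step sizes, denominators and learning rates, coordinate by coordinate. -/

namespace Adam

/-- Admissible hyper-parameters of Adam. -/
structure Hyper where
  β₁ : ℝ
  β₂ : ℝ
  C₀ : ℝ
  ε₀ : ℝ
  β₁_nonneg : 0 ≤ β₁
  β₁_lt : β₁ < β₂
  β₂_lt_one : β₂ < 1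
  C₀_pos : 0 < C₀
  ε₀_pos : 0 < ε₀

namespace Hyper

variable {d : ℕ} (p : Hyper) (g : ℕ → E d) (k : ℕ) (i : Fin d)

lemma β₂_pos : 0 < p.β₂ := p.β₁_nonneg.trans_lt p.β₁_lt

lemma β₁_lt_one : p.β₁ < 1 := p.β₁_lt.trans p.β₂_lt_one

lemma one_sub_β₁_pos : 0 < 1 - p.β₁ := sub_pos.2 p.β₁_lt_one

lemma one_sub_β₂_pos : 0 < 1 - p.β₂ := sub_pos.2 p.β₂_lt_one

lemma one_sub_ratio_pos : 0 < 1 - p.β₁ / p.β₂ := sub_pos.2 ((div_lt_one p.β₂_pos).2 p.β₁_lt)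

/-- The base step size `η`. -/
noncomputable def η : ℝ := p.C₀ * √(1 - p.β₂)

/-- The base regularization `ε`. -/
noncomputable def ε : ℝ := p.ε₀ * √(1 - p.β₂)

/-- `η_k`. -/
noncomputable def step : ℝ := stepSize p.β₁ p.β₂ p.η k

/-- `ε_k`. -/
noncomputable def eps : ℝ := stepEps p.β₂ p.ε k

/-- The first moment. -/
noncomputable def m : ℝ := moment₁ p.β₁ g k i

/-- The second moment. -/
noncomputable def v : ℝ := moment₂ p.β₂ g k i

/-- The adaptive denominator `√v_k + ε_k`. -/
noncomputable def denom : ℝ := √(p.v g k i) + p.eps k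

/-- The effective learning rate of a coordinate. -/
noncomputable def rate : ℝ := p.step k / p.denom g k i

/-- The iterates. -/
noncomputable def iter (x₁ : E d) : E d := iterate p.β₁ p.β₂ p.η p.ε x₁ g k

/-- A lower bound of `ε_k ^ 2`. -/
noncomputable def c : ℝ := p.ε ^ 2 * (1 - p.β₂)

/-- The normalized squared gradient. -/
noncomputable def S : ℝ := (1 - p.β₂) * g k i ^ 2 / (p.c + p.v g k i)

/-- The normalized squared momentum. -/
noncomputable def U : ℝ := (1 - p.β₂) * moment₂ p.β₁ g k i / (p.c + p.v g k i)

lemma η_pos : 0 < p.η := mul_pos p.C₀_pos (Real.sqrt_pos.2 p.one_sub_β₂_pos)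

lemma ε_pos : 0 < p.ε := mul_pos p.ε₀_pos (Real.sqrt_pos.2 p.one_sub_β₂_pos)

lemma η_sq : p.η ^ 2 = p.C₀ ^ 2 * (1 - p.β₂) := by
  rw [η, mul_pow, Real.sq_sqrt p.one_sub_β₂_pos.le]

lemma c_pos : 0 < p.c := mul_pos (pow_pos p.ε_pos 2) p.one_sub_β₂_pos

lemma m_zero : p.m g 0 i = 0 := rfl

lemma v_zero : p.v g 0 i = 0 := rfl

lemma v_succ : p.v g (k + 1) i = p.β₂ * p.v g k i + (1 - p.β₂) * g (k + 1) i ^ 2 := rfl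

lemma v_nonneg : 0 ≤ p.v g k i := moment₂_nonneg p.β₂_pos.le p.β₂_lt_one.le k

lemma step_nonneg : 0 ≤ p.step k := stepSize_nonneg p.β₁_nonneg p.β₁_lt_one p.η_pos.le k

lemma step_le : p.step (k + 1) ≤ p.η / (1 - p.β₁) :=
  stepSize_le p.β₁_nonneg p.β₁_lt_one p.β₂_pos.le p.η_pos.le k

lemma step_mul_sqrt_le : p.step (k + 1) * √(1 - p.β₂) ≤ p.C₀ / (1 - p.β₁) * (1 - p.β₂) := by
  refine (mul_le_mul_of_nonneg_right (p.step_le k) (Real.sqrt_nonneg _)).trans (le_of_eq ?_)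
  rw [η, div_mul_eq_mul_div, mul_assoc, Real.mul_self_sqrt p.one_sub_β₂_pos.le]
  ring

lemma eps_nonneg : 0 ≤ p.eps k := mul_nonneg p.ε_pos.le (Real.sqrt_nonneg _)

lemma eps_le_succ : p.eps k ≤ p.eps (k + 1) :=
  mul_le_mul_of_nonneg_left (sqrt_one_sub_pow_le_succ p.β₂_pos.le p.β₂_lt_one.le k) p.ε_pos.le

lemma eps_succ_pos : 0 < p.eps (k + 1) :=
  mul_pos p.ε_pos (Real.sqrt_pos.2 (one_sub_pow_pos p.β₂_pos.le p.β₂_lt_one k))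

lemma eps_succ_sub_le : p.eps (k + 1) - p.eps k ≤ √(1 - p.β₂) * p.ε₀ := by
  have h0 := p.β₂_pos.le
  have h1 := p.β₂_lt_one.le
  have h2 : √(1 - p.β₂ ^ (k + 1)) - √(1 - p.β₂ ^ k) ≤ 1 := by
    have h3 : √(1 - p.β₂ ^ (k + 1)) ≤ 1 :=
      Real.sqrt_le_one.2 (by linarith [pow_nonneg h0 (k + 1)])
    linarith [Real.sqrt_nonneg (1 - p.β₂ ^ k)]
  calc p.eps (k + 1) - p.eps k = p.ε * (√(1 - p.β₂ ^ (k + 1)) - √(1 - p.β₂ ^ k)) := by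
        simp only [eps, stepEps]; ring
    _ ≤ p.ε * 1 := mul_le_mul_of_nonneg_left h2 p.ε_pos.le
    _ = _ := by rw [ε]; ring

lemma denom_nonneg : 0 ≤ p.denom g k i := add_nonneg (Real.sqrt_nonneg _) (p.eps_nonneg k)

lemma denom_succ_pos : 0 < p.denom g (k + 1) i :=
  add_pos_of_nonneg_of_pos (Real.sqrt_nonneg _) (p.eps_succ_pos k)

lemma rate_nonneg : 0 ≤ p.rate g k i := div_nonneg (p.step_nonneg k) (p.denom_nonneg g k i)

lemma v_le_denom_sq : p.v g k i ≤ p.denom g k i ^ 2 := by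
  have h := Real.sq_sqrt (p.v_nonneg g k i)
  have h2 := mul_nonneg (Real.sqrt_nonneg (p.v g k i)) (p.eps_nonneg k)
  rw [denom]
  nlinarith [sq_nonneg (p.eps k)]

lemma c_add_v_le_denom_sq : p.c + p.v g (k + 1) i ≤ p.denom g (k + 1) i ^ 2 := by
  have h := Real.sq_sqrt (p.v_nonneg g (k + 1) i)
  have h2 := mul_nonneg (Real.sqrt_nonneg (p.v g (k + 1) i)) (p.eps_nonneg (k + 1))
  have h3 : p.c ≤ p.eps (k + 1) ^ 2 := by
    rw [c, eps, stepEps, mul_pow,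
      Real.sq_sqrt (one_sub_pow_pos p.β₂_pos.le p.β₂_lt_one k).le]
    exact mul_le_mul_of_nonneg_left (one_sub_le_one_sub_pow p.β₂_pos.le p.β₂_lt_one k)
      (sq_nonneg _)
  rw [denom]
  nlinarith

lemma c_add_v_pos : 0 < p.c + p.v g k i := add_pos_of_pos_of_nonneg p.c_pos (p.v_nonneg g k i)

lemma S_nonneg : 0 ≤ p.S g k i :=
  div_nonneg (mul_nonneg p.one_sub_β₂_pos.le (sq_nonneg _)) (p.c_add_v_pos g k i).le

lemma U_nonneg : 0 ≤ p.U g k i :=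
  div_nonneg (mul_nonneg p.one_sub_β₂_pos.le (moment₂_nonneg p.β₁_nonneg p.β₁_lt_one.le k))
    (p.c_add_v_pos g k i).le

lemma U_zero : p.U g 0 i = 0 := by simp [U, moment₂_zero]

lemma sqrt_mul_denom_le_succ : √p.β₂ * p.denom g k i ≤ p.denom g (k + 1) i := by
  have h1 : √p.β₂ * √(p.v g k i) ≤ √(p.v g (k + 1) i) := by
    rw [← Real.sqrt_mul p.β₂_pos.le]
    exact Real.sqrt_le_sqrt (mul_moment₂_le_succ p.β₂_lt_one.le k)
  have h2 : √p.β₂ * p.eps k ≤ p.eps (k + 1) :=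
    (mul_le_of_le_one_left (p.eps_nonneg k) (Real.sqrt_le_one.2 p.β₂_lt_one.le)).trans
      (p.eps_le_succ k)
  rw [denom, denom, mul_add]
  linarith

lemma m_sq_le : p.m g k i ^ 2 ≤ (1 - p.β₁ ^ k) * moment₂ p.β₁ g k i :=
  moment₁_sq_le p.β₁_nonneg p.β₁_lt_one.le k

/-- Each coordinate moves by at most `C₀` in a step. -/
lemma sq_rate_mul_m_le : (p.rate g k i * p.m g k i) ^ 2 ≤ p.C₀ ^ 2 := by
  cases k with
  | zero => simp [m_zero]; positivity
  | succ k =>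
    have hb := p.denom_succ_pos g k i
    have hr := one_sub_pow_pos p.β₁_nonneg p.β₁_lt_one k
    have h1 := p.m_sq_le g (k + 1) i
    have h2 : (1 - p.β₂) * moment₂ p.β₁ g (k + 1) i ≤ (1 - p.β₁) * p.v g (k + 1) i :=
      moment₂_le_moment₂ p.β₁_nonneg p.β₁_lt.le p.β₂_lt_one.le _
    have h3 := p.v_le_denom_sq g (k + 1) i
    have h4 : (p.step (k + 1) * (1 - p.β₁ ^ (k + 1))) ^ 2 ≤ p.η ^ 2 := by
      rw [step, stepSize, div_mul_cancel₀ _ hr.ne', mul_pow,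
        Real.sq_sqrt (one_sub_pow_pos p.β₂_pos.le p.β₂_lt_one k).le]
      exact mul_le_of_le_one_right (sq_nonneg _) (by linarith [pow_pos p.β₂_pos (k + 1)])
    rw [η_sq] at h4
    rw [rate, div_mul_eq_mul_div, div_pow, div_le_iff₀ (by positivity)]
    have h5 : p.step (k + 1) ^ 2 * (1 - p.β₁ ^ (k + 1)) ^ 2 * p.m g (k + 1) i ^ 2 ≤
        p.C₀ ^ 2 * (1 - p.β₂) * p.m g (k + 1) i ^ 2 := by
      rw [← mul_pow]
      exact mul_le_mul_of_nonneg_right h4 (sq_nonneg _)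
    -- Both bias corrections are absorbed: one factor 1-β₁^(k+1) comes from `m_sq_le`, the other
    -- from 1-β₁ ≤ 1-β₁^(k+1).
    have h6 : (1 - p.β₂) * p.m g (k + 1) i ^ 2 ≤
        (1 - p.β₁ ^ (k + 1)) ^ 2 * p.denom g (k + 1) i ^ 2 := by
      calc (1 - p.β₂) * p.m g (k + 1) i ^ 2
          ≤ (1 - p.β₂) * ((1 - p.β₁ ^ (k + 1)) * moment₂ p.β₁ g (k + 1) i) :=
            mul_le_mul_of_nonneg_left h1 p.one_sub_β₂_pos.le
        _ = (1 - p.β₁ ^ (k + 1)) * ((1 - p.β₂) * moment₂ p.β₁ g (k + 1) i) := by ring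
        _ ≤ (1 - p.β₁ ^ (k + 1)) * ((1 - p.β₁) * p.v g (k + 1) i) :=
            mul_le_mul_of_nonneg_left h2 hr.le
        _ ≤ (1 - p.β₁ ^ (k + 1)) * ((1 - p.β₁ ^ (k + 1)) * p.denom g (k + 1) i ^ 2) :=
            mul_le_mul_of_nonneg_left (mul_le_mul
              (one_sub_le_one_sub_pow p.β₁_nonneg p.β₁_lt_one k) h3 (p.v_nonneg g _ i) hr.le) hr.le
        _ = _ := by ring
    have h7 := mul_le_mul_of_nonneg_left h6 (sq_nonneg p.C₀)
    have h8 : 0 < (1 - p.β₁ ^ (k + 1)) ^ 2 := by positivity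
    rw [mul_pow]
    refine le_of_mul_le_mul_left ?_ h8
    linarith

lemma sq_m_div_denom_le :
    (1 - p.β₂) * (p.m g k i / p.denom g k i) ^ 2 ≤ (1 - p.β₁ ^ k) * p.U g k i := by
  cases k with
  | zero => simp [m_zero]
  | succ k =>
    have hr := one_sub_pow_pos p.β₁_nonneg p.β₁_lt_one k
    have hJ : 0 ≤ moment₂ p.β₁ g (k + 1) i := moment₂_nonneg p.β₁_nonneg p.β₁_lt_one.le _
    rw [U, div_pow, ← mul_div_assoc, ← mul_div_assoc]
    refine div_le_div₀ (mul_nonneg hr.le (mul_nonneg p.one_sub_β₂_pos.le hJ)) ?_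
      (p.c_add_v_pos g _ i) (p.c_add_v_le_denom_sq g k i)
    have := mul_le_mul_of_nonneg_left (p.m_sq_le g (k + 1) i) p.one_sub_β₂_pos.le
    linarith

lemma sq_m_div_denom_le' : (1 - p.β₂) * (p.m g k i / p.denom g k i) ^ 2 ≤ p.U g k i :=
  (p.sq_m_div_denom_le g k i).trans (mul_le_of_le_one_left (p.U_nonneg g k i)
    (by linarith [pow_nonneg p.β₁_nonneg k]))

/-- A uniform bound, to be paired with the finite total variation of the step sizes. -/
lemma abs_m_div_denom_le :
    |p.m g k i / p.denom g k i| ≤ √((1 - p.β₁) / (1 - p.β₂)) := by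
  apply Real.abs_le_sqrt
  have h0 := p.one_sub_β₁_pos
  have h0' := p.one_sub_β₂_pos
  rw [le_div_iff₀ h0', mul_comm]
  refine (p.sq_m_div_denom_le' g k i).trans ?_
  rw [U, div_le_iff₀ (p.c_add_v_pos g k i)]
  have h2 : (1 - p.β₂) * moment₂ p.β₁ g k i ≤ (1 - p.β₁) * p.v g k i :=
    moment₂_le_moment₂ p.β₁_nonneg p.β₁_lt.le p.β₂_lt_one.le _
  nlinarith [mul_pos h0 p.c_pos]

/-- Only one factor 1-β₁^k is recovered from the momentum here; the remaining bias correction costs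
1/(1-β₁). -/
lemma sq_rate_mul_m_le_U :
    (p.rate g k i * p.m g k i) ^ 2 ≤ p.C₀ ^ 2 / (1 - p.β₁) * p.U g k i := by
  cases k with
  | zero => simp [m_zero, U_zero]
  | succ k =>
    have hr := one_sub_pow_pos p.β₁_nonneg p.β₁_lt_one k
    have h1 := p.one_sub_β₁_pos
    have h2 := p.one_sub_β₂_pos
    have hU := p.U_nonneg g (k + 1) i
    have h4 : p.step (k + 1) ^ 2 ≤ p.C₀ ^ 2 * (1 - p.β₂) / (1 - p.β₁ ^ (k + 1)) ^ 2 := by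
      rw [step, stepSize, div_pow, mul_pow, η_sq,
        Real.sq_sqrt (one_sub_pow_pos p.β₂_pos.le p.β₂_lt_one k).le]
      have h5 : 1 - p.β₂ ^ (k + 1) ≤ 1 := by linarith [pow_pos p.β₂_pos (k + 1)]
      have h6 : 0 ≤ p.C₀ ^ 2 * (1 - p.β₂) := by positivity
      exact div_le_div_of_nonneg_right (mul_le_of_le_one_right h6 h5) (by positivity)
    calc (p.rate g (k + 1) i * p.m g (k + 1) i) ^ 2
        = p.step (k + 1) ^ 2 * (p.m g (k + 1) i / p.denom g (k + 1) i) ^ 2 := by rw [rate]; ring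
      _ ≤ p.C₀ ^ 2 * (1 - p.β₂) / (1 - p.β₁ ^ (k + 1)) ^ 2 *
            (p.m g (k + 1) i / p.denom g (k + 1) i) ^ 2 :=
          mul_le_mul_of_nonneg_right h4 (sq_nonneg _)
      _ = p.C₀ ^ 2 / (1 - p.β₁ ^ (k + 1)) ^ 2 *
            ((1 - p.β₂) * (p.m g (k + 1) i / p.denom g (k + 1) i) ^ 2) := by ring
      _ ≤ p.C₀ ^ 2 / (1 - p.β₁ ^ (k + 1)) ^ 2 * ((1 - p.β₁ ^ (k + 1)) * p.U g (k + 1) i) :=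
          mul_le_mul_of_nonneg_left (p.sq_m_div_denom_le g (k + 1) i) (by positivity)
      _ = p.C₀ ^ 2 / (1 - p.β₁ ^ (k + 1)) * p.U g (k + 1) i := by field_simp
      _ ≤ _ := by
          refine mul_le_mul_of_nonneg_right ?_ hU
          exact div_le_div_of_nonneg_left (sq_nonneg _) h1
            (one_sub_le_one_sub_pow p.β₁_nonneg p.β₁_lt_one k)

lemma sq_g_div_denom_le :
    (1 - p.β₂) * (g (k + 1) i / p.denom g (k + 1) i) ^ 2 ≤ p.S g (k + 1) i := by
  rw [S, div_pow, ← mul_div_assoc]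
  exact div_le_div_of_nonneg_left (mul_nonneg p.one_sub_β₂_pos.le (sq_nonneg _))
    (p.c_add_v_pos g _ i) (p.c_add_v_le_denom_sq g k i)

lemma sq_rate_mul_g_le :
    (p.rate g (k + 1) i * g (k + 1) i) ^ 2 ≤ p.C₀ ^ 2 / (1 - p.β₁) ^ 2 * p.S g (k + 1) i := by
  have h1 := p.one_sub_β₁_pos
  calc (p.rate g (k + 1) i * g (k + 1) i) ^ 2
      = p.step (k + 1) ^ 2 * (g (k + 1) i / p.denom g (k + 1) i) ^ 2 := by rw [rate]; ring
    _ ≤ (p.η / (1 - p.β₁)) ^ 2 * (g (k + 1) i / p.denom g (k + 1) i) ^ 2 :=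
        mul_le_mul_of_nonneg_right (pow_le_pow_left₀ (p.step_nonneg _) (p.step_le k) 2)
          (sq_nonneg _)
    _ = p.C₀ ^ 2 / (1 - p.β₁) ^ 2 *
          ((1 - p.β₂) * (g (k + 1) i / p.denom g (k + 1) i) ^ 2) := by
        rw [div_pow, η_sq]; ring
    _ ≤ _ := mul_le_mul_of_nonneg_left (p.sq_g_div_denom_le g k i) (by positivity)

lemma sum_S_le (n : ℕ) :
    ∑ k ∈ Finset.range n, p.S g (k + 1) i ≤
      Real.log ((1 + p.v g n i / p.c) / p.β₂ ^ n) :=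
  sum_sq_div_le_log p.β₂_pos p.β₂_lt_one.le p.c_pos n

lemma sum_U_succ_le (n : ℕ) :
    ∑ k ∈ Finset.range n, p.U g (k + 1) i ≤
      (1 - p.β₁) / (1 - p.β₁ / p.β₂) * ∑ k ∈ Finset.range n, p.S g (k + 1) i :=
  sum_moment₂_div_le p.β₁_nonneg p.β₁_lt p.β₂_lt_one.le p.c_pos n

lemma sum_U_le (n : ℕ) :
    ∑ k ∈ Finset.range n, p.U g k i ≤
      (1 - p.β₁) / (1 - p.β₁ / p.β₂) * ∑ k ∈ Finset.range n, p.S g (k + 1) i := by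
  refine le_trans ?_ (p.sum_U_succ_le g i n)
  have h := Finset.sum_range_succ (fun k => p.U g k i) n
  rw [Finset.sum_range_succ', U_zero] at h
  linarith [p.U_nonneg g n i]

lemma v_le_sum (n : ℕ) :
    p.v g n i ≤ (1 - p.β₂) * ∑ k ∈ Finset.range n, g (k + 1) i ^ 2 := by
  induction n with
  | zero => simp [v_zero]
  | succ n ih =>
    rw [v_succ, Finset.sum_range_succ, mul_add]
    have := mul_le_of_le_one_left (p.v_nonneg g n i) p.β₂_lt_one.le
    linarith

lemma sum_step_variation_le (n : ℕ) :
    ∑ k ∈ Finset.range n, |p.step (k + 1) - p.step k| * |p.m g k i / p.denom g k i| ≤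
      2 * p.C₀ / √(1 - p.β₁) := by
  have h1 := p.one_sub_β₁_pos
  have h2 := p.one_sub_β₂_pos
  -- The sum is shifted by one: its term k = 0 vanishes because m_0 = 0, so the meaningless `p.step
  -- 0`, a quotient 0/0, plays no role.
  have hb : ∀ k ∈ Finset.range n,
      |p.step (k + 2) - p.step (k + 1)| * |p.m g (k + 1) i / p.denom g (k + 1) i| ≤
      |p.step (k + 2) - p.step (k + 1)| * √((1 - p.β₁) / (1 - p.β₂)) := fun k _ =>
    mul_le_mul_of_nonneg_left (p.abs_m_div_denom_le g (k + 1) i) (abs_nonneg _)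
  have hs := sum_abs_stepSize_sub_le p.β₁_nonneg p.β₁_lt_one p.β₂_pos.le p.β₂_lt_one.le
    p.η_pos.le n
  have h := Finset.sum_le_sum hb
  rw [← Finset.sum_mul] at h
  have h3 := mul_le_mul_of_nonneg_right hs (Real.sqrt_nonneg ((1 - p.β₁) / (1 - p.β₂)))
  have e : 2 * p.η / (1 - p.β₁) * √((1 - p.β₁) / (1 - p.β₂)) = 2 * p.C₀ / √(1 - p.β₁) := by
    have h4 := Real.mul_self_sqrt h1.le
    have h5 : √(1 - p.β₁) ≠ 0 := (Real.sqrt_pos.2 h1).ne'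
    have h6 : √(1 - p.β₂) ≠ 0 := (Real.sqrt_pos.2 h2).ne'
    rw [η, Real.sqrt_div h1.le, div_mul_div_comm, div_eq_div_iff (by positivity) h5]
    linear_combination (2 * p.C₀ * √(1 - p.β₂)) * h4
  rw [e] at h3
  refine le_trans ?_ (h.trans h3)
  have h7 := Finset.sum_range_succ
    (fun k => |p.step (k + 1) - p.step k| * |p.m g k i / p.denom g k i|) n
  rw [Finset.sum_range_succ'] at h7
  simp only [m_zero, zero_div, abs_zero, mul_zero, add_zero] at h7
  have h8 : 0 ≤ |p.step (n + 1) - p.step n| * |p.m g n i / p.denom g n i| := by positivity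
  linarith

/-- The learning rate grows by a bounded factor. -/
lemma abs_rate_sub_mul_m_le :
    |(p.rate g (k + 1) i - p.rate g k i) * p.m g k i| ≤
      sigmaMax p.β₂ * |p.rate g k i * p.m g k i| := by
  cases k with
  | zero => simp [m_zero]
  | succ k =>
    rw [abs_mul, abs_mul, ← mul_assoc]
    refine mul_le_mul_of_nonneg_right ?_ (abs_nonneg _)
    have hβ := p.β₂_pos
    have hb := p.denom_succ_pos g k i
    have hb' := p.denom_succ_pos g (k + 1) i
    have hr := one_sub_pow_pos p.β₁_nonneg p.β₁_lt_one k
    have hr' := one_sub_pow_pos p.β₁_nonneg p.β₁_lt_one (k + 1)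
    have hq := p.rate_nonneg g (k + 1) i
    have hq' := p.rate_nonneg g (k + 1 + 1) i
    -- Since β₂^(k+1) ≤ β₂, 1-β₂^(k+2) ≤ (1+β₂)(1-β₂^(k+1)). As the denominator shrinks at most by
    -- √β₂, consecutive rates have a ratio between 0 and √((1+β₂)/β₂), whence the two branches of
    -- `sigmaMax`.
    have hstep : p.step (k + 1 + 1) ≤ √(1 + p.β₂) * p.step (k + 1) := by
      rw [step, step, stepSize, stepSize, ← mul_div_assoc]
      refine div_le_div₀ (mul_nonneg (Real.sqrt_nonneg _)
        (mul_nonneg p.η_pos.le (Real.sqrt_nonneg _))) ?_ hr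
        (sub_le_sub_left (pow_le_pow_of_le_one p.β₁_nonneg p.β₁_lt_one.le (k + 1).le_succ) _)
      rw [mul_left_comm]
      refine mul_le_mul_of_nonneg_left ?_ p.η_pos.le
      rw [← Real.sqrt_mul (by positivity)]
      apply Real.sqrt_le_sqrt
      have : p.β₂ ^ (k + 1) ≤ p.β₂ := pow_le_of_le_one hβ.le p.β₂_lt_one.le k.succ_ne_zero
      rw [pow_succ p.β₂ (k + 1)]
      nlinarith
    have hrate : p.rate g (k + 1 + 1) i ≤ √((1 + p.β₂) / p.β₂) * p.rate g (k + 1) i := by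
      have h5 : 0 < √p.β₂ := Real.sqrt_pos.2 hβ
      rw [rate, rate, Real.sqrt_div (by positivity), div_mul_div_comm]
      exact div_le_div₀ (mul_nonneg (Real.sqrt_nonneg _) (p.step_nonneg _)) hstep
        (by positivity) (p.sqrt_mul_denom_le_succ g (k + 1) i)
    have h1 : (1 : ℝ) ≤ sigmaMax p.β₂ := le_max_left _ _
    have h2 : √((1 + p.β₂) / p.β₂) - 1 ≤ sigmaMax p.β₂ := le_max_right _ _
    rw [abs_of_nonneg hq, abs_le]
    constructor <;> nlinarith

end Hyper

end Adam

/-! ### The predictable proxy, and the gradient and momentum terms of one coordinate. -/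

namespace Adam

namespace Hyper

variable {d : ℕ} (p : Hyper) (g : ℕ → E d) (k : ℕ) (i : Fin d)

/-- A predictable proxy of `√v_{k+1} + ε_{k+1}`, where `γ` is the partial derivative and `N` the
noise level. -/
noncomputable def proxy (γ N : ℝ) : ℝ :=
  √(p.β₂ * p.v g k i + (1 - p.β₂) * (γ ^ 2 + N ^ 2)) + p.eps (k + 1)

variable {g k i} {γ N R : ℝ}

lemma proxy_pos : 0 < p.proxy g k i γ N :=
  add_pos_of_nonneg_of_pos (Real.sqrt_nonneg _) (p.eps_succ_pos k)

lemma sqrt_mul_noise_le_proxy : √(1 - p.β₂) * N ≤ p.proxy g k i γ N := by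
  have h1 := p.one_sub_β₂_pos
  have h2 := p.β₂_pos
  have h3 := p.v_nonneg g k i
  have h : √(1 - p.β₂) * N ≤ √(p.β₂ * p.v g k i + (1 - p.β₂) * (γ ^ 2 + N ^ 2)) := by
    apply Real.le_sqrt_of_sq_le
    rw [mul_pow, Real.sq_sqrt h1.le]
    have : 0 ≤ p.β₂ * p.v g k i + (1 - p.β₂) * γ ^ 2 := by positivity
    linarith
  have := p.eps_nonneg (k + 1)
  rw [proxy]
  linarith

lemma abs_denom_sub_proxy_le (hN : 0 ≤ N) (h : |g (k + 1) i - γ| ≤ N) :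
    |p.denom g (k + 1) i - p.proxy g k i γ N| ≤ 2 * √(1 - p.β₂) * N := by
  rw [denom, proxy, add_sub_add_right_eq_sub, v_succ]
  exact abs_sqrt_sub_proxy_le (mul_nonneg p.β₂_pos.le (p.v_nonneg g k i)) p.β₂_lt_one.le hN h

/-- The gradient step, decoupled from the stochastic gradient in the denominator. -/
lemma gradient_term_le (hN : 0 ≤ N) (h : |g (k + 1) i - γ| ≤ N) :
    -(p.rate g (k + 1) i * γ * g (k + 1) i) ≤
      -(3 / 4 * (p.step (k + 1) * γ ^ 2 / p.proxy g k i γ N)) -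
        p.step (k + 1) * γ / p.proxy g k i γ N * (g (k + 1) i - γ) +
        4 * N * (p.C₀ / (1 - p.β₁)) * p.S g (k + 1) i := by
  have ha := p.proxy_pos (g := g) (k := k) (i := i) (γ := γ) (N := N)
  have hb := p.denom_succ_pos g k i
  have hη := p.step_nonneg (k + 1)
  have h1 := p.sqrt_mul_noise_le_proxy (g := g) (k := k) (i := i) (γ := γ) (N := N)
  have h2 := p.abs_denom_sub_proxy_le hN h
  have hs := Real.sq_sqrt p.one_sub_β₂_pos.le
  have hs0 := Real.sqrt_nonneg (1 - p.β₂)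
  have h5 := p.sq_g_div_denom_le g k i
  have h6 := p.step_mul_sqrt_le k
  rw [rate]
  set a := p.proxy g k i γ N
  set b := p.denom g (k + 1) i
  set η := p.step (k + 1)
  set u := g (k + 1) i
  set s := √(1 - p.β₂)
  -- Replacing b by the proxy a splits the term into decrease, martingale difference and error.
  -- Young's inequality spends γ²/4 on the error, and (b-a)² ≤ 4s²N² ≤ 4sNa because a ≥ sN, so the
  -- factor 1/a disappears from the rest.
  have e : -(η / b * γ * u) = -(η * γ ^ 2 / a) - η * γ / a * (u - γ) +
      η / a * (γ * (u / b * (b - a))) := by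
    field_simp
    ring
  have h3 : γ * (u / b * (b - a)) ≤ γ ^ 2 / 4 + (u / b) ^ 2 * (4 * (s * N * a)) := by
    have h4 : (b - a) ^ 2 ≤ 4 * (s * N * a) := by
      have : (b - a) ^ 2 ≤ (2 * s * N) ^ 2 := by
        rw [← sq_abs]; exact pow_le_pow_left₀ (abs_nonneg _) h2 2
      nlinarith [mul_le_mul_of_nonneg_left h1 (mul_nonneg hs0 hN)]
    have := mul_le_mul_of_nonneg_left h4 (sq_nonneg (u / b))
    nlinarith [sq_nonneg (γ / 2 - u / b * (b - a))]
  have h4 := mul_le_mul_of_nonneg_left h3 (div_nonneg hη ha.le)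
  have e2 : η / a * (γ ^ 2 / 4 + (u / b) ^ 2 * (4 * (s * N * a))) =
      1 / 4 * (η * γ ^ 2 / a) + 4 * N * (η * s * (u / b) ^ 2) := by
    field_simp
  have h7 : 4 * N * (η * s * (u / b) ^ 2) ≤ 4 * N * (p.C₀ / (1 - p.β₁)) * p.S g (k + 1) i := by
    rw [mul_assoc (4 * N)]
    refine mul_le_mul_of_nonneg_left ?_ (by positivity)
    refine (mul_le_mul_of_nonneg_right h6 (sq_nonneg _)).trans ?_
    rw [mul_assoc]
    exact mul_le_mul_of_nonneg_left h5 (div_nonneg p.C₀_pos.le p.one_sub_β₁_pos.le)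
  rw [e]
  linarith

/-- Both g² and v lie in [0, R²], so v moves by at most (1-β₂)R² and its root by at most √(1-β₂)R.
-/
lemma abs_denom_succ_sub_le (hR : 0 ≤ R) (hg : g (k + 1) i ^ 2 ≤ R ^ 2)
    (hv : p.v g k i ≤ R ^ 2) :
    |p.denom g (k + 1) i - p.denom g k i| ≤ √(1 - p.β₂) * (R + p.ε₀) := by
  have h1 := p.one_sub_β₂_pos
  have h2 : |√(p.v g (k + 1) i) - √(p.v g k i)| ≤ √((1 - p.β₂) * R ^ 2) := by
    apply abs_sqrt_sub_sqrt_le_sqrt (p.v_nonneg g _ i) (p.v_nonneg g _ i)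
    have e : p.v g (k + 1) i - p.v g k i = (1 - p.β₂) * (g (k + 1) i ^ 2 - p.v g k i) := by
      rw [v_succ]; ring
    rw [e, abs_mul, abs_of_pos h1]
    refine mul_le_mul_of_nonneg_left (abs_le.2 ?_) h1.le
    constructor <;> linarith [sq_nonneg (g (k + 1) i), p.v_nonneg g k i]
  rw [Real.sqrt_mul h1.le, Real.sqrt_sq hR] at h2
  have h3 := p.eps_succ_sub_le k
  have h4 := p.eps_le_succ k
  rw [denom, denom]
  rw [abs_le] at h2 ⊢
  constructor <;> linarith

lemma proxy_le (hR : 0 ≤ R) (hγ : γ ^ 2 + N ^ 2 ≤ R ^ 2) :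
    p.proxy g k i γ N ≤ √(1 - p.β₂) * R + p.denom g (k + 1) i := by
  have h1 := p.one_sub_β₂_pos
  have hv := mul_nonneg p.β₂_pos.le (p.v_nonneg g k i)
  have h2 : √(p.β₂ * p.v g k i + (1 - p.β₂) * (γ ^ 2 + N ^ 2)) ≤
      √(1 - p.β₂) * R + √(p.v g (k + 1) i) := by
    have h3 : √(p.β₂ * p.v g k i) ≤ √(p.v g (k + 1) i) :=
      Real.sqrt_le_sqrt (mul_moment₂_le_succ p.β₂_lt_one.le k)
    have h4 : √((1 - p.β₂) * (γ ^ 2 + N ^ 2)) ≤ √(1 - p.β₂) * R := by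
      rw [Real.sqrt_mul h1.le]
      exact mul_le_mul_of_nonneg_left (Real.sqrt_le_iff.2 ⟨hR, hγ⟩) (Real.sqrt_nonneg _)
    refine (Real.sqrt_le_iff.2 ⟨by positivity, ?_⟩).trans (add_le_add h4 h3)
    have h5 := Real.sq_sqrt hv
    have h6 := Real.sq_sqrt (mul_nonneg h1.le (by positivity : 0 ≤ γ ^ 2 + N ^ 2))
    nlinarith [mul_nonneg (Real.sqrt_nonneg ((1 - p.β₂) * (γ ^ 2 + N ^ 2)))
      (Real.sqrt_nonneg (p.β₂ * p.v g k i))]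
  rw [proxy, denom]
  linarith

/-- The size of the momentum correction, in terms of a bound `R` on the gradients. -/
noncomputable def momentumConst (R : ℝ) : ℝ := R / p.β₂ + (R + p.ε₀) / √p.β₂

/-- Let t be the relative change of the denominator; t ≤ 1/√β₂. The proxy is at most √(1-β₂)R + b',
and b't² = |b'-b|t, so each part keeps one small factor √(1-β₂). -/
lemma proxy_mul_sq_le (hR : 0 ≤ R) (hg : g (k + 1) i ^ 2 ≤ R ^ 2)
    (hv : p.v g k i ≤ R ^ 2) (hγ : γ ^ 2 + N ^ 2 ≤ R ^ 2) :
    p.proxy g k i γ N * ((p.denom g (k + 1) i - p.denom g k i) / p.denom g (k + 1) i) ^ 2 ≤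
      √(1 - p.β₂) * p.momentumConst R := by
  have h1 := p.abs_denom_succ_sub_le hR hg hv
  have h2 := p.proxy_le (g := g) (k := k) (i := i) hR hγ
  have h3 := p.sqrt_mul_denom_le_succ g k i
  have hb := p.denom_succ_pos g k i
  have hb0 := p.denom_nonneg g k i
  have hs : 0 < √p.β₂ := Real.sqrt_pos.2 p.β₂_pos
  have hs1 : √p.β₂ ≤ 1 := Real.sqrt_le_one.2 p.β₂_lt_one.le
  have hs2 := Real.sq_sqrt p.β₂_pos.le
  have hε := p.ε₀_pos
  set a := p.proxy g k i γ N
  set b := p.denom g k i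
  set b' := p.denom g (k + 1) i
  set s := √p.β₂
  set q := √(1 - p.β₂)
  have hq : 0 ≤ q := Real.sqrt_nonneg _
  set t := |b' - b| / b' with ht
  have ht0 : 0 ≤ t := by positivity
  have ht1 : t ≤ 1 / s := by
    rw [ht, div_le_div_iff₀ hb hs, one_mul]
    have : |b' - b| ≤ max b' b := by
      rw [abs_le]; constructor <;> linarith [le_max_left b' b, le_max_right b' b]
    refine (mul_le_mul_of_nonneg_right this hs.le).trans ?_
    rw [max_mul_of_nonneg _ _ hs.le]
    exact max_le (mul_le_of_le_one_right hb.le hs1) (by linarith)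
  have e : ((b' - b) / b') ^ 2 = t ^ 2 := by rw [ht, div_pow, div_pow, sq_abs]
  have hbt : b' * t = |b' - b| := by rw [ht]; field_simp
  have e2 : p.momentumConst R = R / s ^ 2 + (R + p.ε₀) / s := by rw [momentumConst, hs2]
  rw [e, e2]
  have h4 : a * t ^ 2 ≤ q * R * t ^ 2 + |b' - b| * t := by
    rw [← hbt]
    nlinarith [mul_le_mul_of_nonneg_right h2 (sq_nonneg t)]
  have h5 : q * R * t ^ 2 ≤ q * R * (1 / s) ^ 2 :=
    mul_le_mul_of_nonneg_left (pow_le_pow_left₀ ht0 ht1 2) (by positivity)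
  have h6 : |b' - b| * t ≤ q * (R + p.ε₀) * (1 / s) :=
    mul_le_mul h1 ht1 ht0 (by positivity)
  refine (h4.trans (add_le_add h5 h6)).trans (le_of_eq ?_)
  field_simp

/-- The step along the momentum, caused by the variation of the learning rate. -/
lemma momentum_term_le {ρ : ℝ} (hρ : 0 ≤ ρ) (hR : 0 ≤ R) (hg : g (k + 1) i ^ 2 ≤ R ^ 2)
    (hv : p.v g k i ≤ R ^ 2) (hγ : γ ^ 2 + N ^ 2 ≤ R ^ 2) :
    -(ρ * γ * ((p.rate g (k + 1) i - p.rate g k i) * p.m g k i)) ≤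
      ρ * |γ| * (|p.step (k + 1) - p.step k| * |p.m g k i / p.denom g k i|) +
      1 / 4 * (p.step (k + 1) * γ ^ 2 / p.proxy g k i γ N) +
      ρ ^ 2 * (p.C₀ / (1 - p.β₁)) * p.momentumConst R * p.U g k i := by
  -- At k = 0 the denominator is 0 and the algebra below fails, but the momentum vanishes.
  cases k with
  | zero =>
    have ha := p.proxy_pos (g := g) (k := 0) (i := i) (γ := γ) (N := N)
    have := p.step_nonneg (0 + 1)
    simp only [m_zero, U_zero, mul_zero, neg_zero, zero_div, abs_zero, zero_add, add_zero]
    positivity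
  | succ k =>
    have h1 := p.proxy_mul_sq_le hR hg hv hγ
    have ha := p.proxy_pos (g := g) (k := k + 1) (i := i) (γ := γ) (N := N)
    have hb := p.denom_succ_pos g k i
    have hb' := p.denom_succ_pos g (k + 1) i
    have hη := p.step_nonneg (k + 1 + 1)
    have h6 := p.step_mul_sqrt_le (k + 1)
    have h7 := p.sq_m_div_denom_le' g (k + 1) i
    have hC : 0 ≤ p.C₀ / (1 - p.β₁) := div_nonneg p.C₀_pos.le p.one_sub_β₁_pos.le
    have hW : 0 ≤ p.momentumConst R := by
      have := p.β₂_pos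
      have := p.ε₀_pos
      rw [momentumConst]
      positivity
    rw [rate, rate]
    set a := p.proxy g (k + 1) i γ N
    set b := p.denom g (k + 1) i
    set b' := p.denom g (k + 1 + 1) i
    set η := p.step (k + 1 + 1)
    set η₀ := p.step (k + 1)
    set m := p.m g (k + 1) i
    set q := √(1 - p.β₂)
    set W := p.momentumConst R
    -- The variation of the rate is split into that of the step size and that of the denominator.
    -- Young's inequality on the latter costs a further quarter of the decrease.
    have e : -(ρ * γ * ((η / b' - η₀ / b) * m)) =
        ρ * (-(γ * ((η - η₀) * (m / b)))) + η * (γ * (ρ * ((b' - b) / b' * (m / b)))) := by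
      field_simp
      ring
    have h2 : -(γ * ((η - η₀) * (m / b))) ≤ |γ| * (|η - η₀| * |m / b|) := by
      rw [← abs_mul, ← abs_mul]
      exact neg_le_abs _
    have h3 := mul_le_mul_of_nonneg_left h2 hρ
    have h4 := mul_le_mul_of_nonneg_left
      (mul_le_quarter_add (x := γ) (y := ρ * ((b' - b) / b' * (m / b))) ha) hη
    have h5 : η * (a * (ρ * ((b' - b) / b' * (m / b))) ^ 2) ≤
        ρ ^ 2 * (p.C₀ / (1 - p.β₁)) * W * p.U g (k + 1) i := by
      calc η * (a * (ρ * ((b' - b) / b' * (m / b))) ^ 2)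
          = ρ ^ 2 * (m / b) ^ 2 * η * (a * ((b' - b) / b') ^ 2) := by ring
        _ ≤ ρ ^ 2 * (m / b) ^ 2 * η * (q * W) := mul_le_mul_of_nonneg_left h1 (by positivity)
        _ = ρ ^ 2 * (m / b) ^ 2 * W * (η * q) := by ring
        _ ≤ ρ ^ 2 * (m / b) ^ 2 * W * (p.C₀ / (1 - p.β₁) * (1 - p.β₂)) :=
            mul_le_mul_of_nonneg_left h6 (by positivity)
        _ = ρ ^ 2 * (p.C₀ / (1 - p.β₁)) * W * ((1 - p.β₂) * (m / b) ^ 2) := by ring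
        _ ≤ _ := mul_le_mul_of_nonneg_left h7 (by positivity)
    have e2 : η * (γ ^ 2 / (4 * a) + a * (ρ * ((b' - b) / b' * (m / b))) ^ 2) =
        1 / 4 * (η * γ ^ 2 / a) + η * (a * (ρ * ((b' - b) / b' * (m / b))) ^ 2) := by
      field_simp
    rw [e]
    linarith

end Hyper

end Adam

/-! ### Noise levels, extrapolated iterates, and descent in one step. -/

namespace Adam

/-- The level of the noise in a coordinate whose partial derivative is `γ`. -/
noncomputable def noise {d : ℕ} (σ₀ σ₁ : Fin d → ℝ) (γ : ℝ) (i : Fin d) : ℝ :=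
  √(σ₀ i ^ 2 + σ₁ i ^ 2 * γ ^ 2)

/-- A bound on the stochastic gradients while the gradients are bounded by `H`. -/
noncomputable def gradRadius {d : ℕ} (σ₀ σ₁ : Fin d → ℝ) (H : ℝ) : ℝ :=
  √(2 * (‖σ₀‖ ^ 2 + (1 + ‖σ₁‖ ^ 2) * H ^ 2))

section Noise

variable {d : ℕ} {σ₀ σ₁ : Fin d → ℝ} {γ H u : ℝ} {i : Fin d}

lemma noise_nonneg : 0 ≤ noise σ₀ σ₁ γ i := Real.sqrt_nonneg _

lemma noise_sq : noise σ₀ σ₁ γ i ^ 2 = σ₀ i ^ 2 + σ₁ i ^ 2 * γ ^ 2 :=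
  Real.sq_sqrt (by positivity)

lemma sq_apply_le_norm_sq (σ : Fin d → ℝ) (i : Fin d) : σ i ^ 2 ≤ ‖σ‖ ^ 2 :=
  sq_le_sq.2 (by rw [abs_norm]; exact norm_le_pi_norm σ i)

lemma noise_sq_le : noise σ₀ σ₁ γ i ^ 2 ≤ ‖σ₀‖ ^ 2 + ‖σ₁‖ ^ 2 * γ ^ 2 := by
  rw [noise_sq]
  exact add_le_add (sq_apply_le_norm_sq σ₀ i)
    (mul_le_mul_of_nonneg_right (sq_apply_le_norm_sq σ₁ i) (sq_nonneg _))

lemma noise_le (h : |γ| ≤ H) : noise σ₀ σ₁ γ i ≤ ‖σ₀‖ + ‖σ₁‖ * H := by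
  have hH : 0 ≤ H := (abs_nonneg _).trans h
  refine abs_le_of_sq_le_sq' ?_ (by positivity) |>.2
  refine noise_sq_le.trans ?_
  have h1 : γ ^ 2 ≤ H ^ 2 := sq_le_sq.2 (by rwa [abs_of_nonneg hH])
  have h2 := mul_le_mul_of_nonneg_left h1 (sq_nonneg ‖σ₁‖)
  have h3 : 0 ≤ ‖σ₀‖ * (‖σ₁‖ * H) := by positivity
  nlinarith

lemma gradRadius_nonneg : 0 ≤ gradRadius σ₀ σ₁ H := Real.sqrt_nonneg _

lemma gradRadius_sq :
    gradRadius σ₀ σ₁ H ^ 2 = 2 * (‖σ₀‖ ^ 2 + (1 + ‖σ₁‖ ^ 2) * H ^ 2) :=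
  Real.sq_sqrt (by positivity)

lemma sq_add_noise_sq_le (h : |γ| ≤ H) :
    γ ^ 2 + noise σ₀ σ₁ γ i ^ 2 ≤ gradRadius σ₀ σ₁ H ^ 2 := by
  have hH : 0 ≤ H := (abs_nonneg _).trans h
  have h1 : γ ^ 2 ≤ H ^ 2 := sq_le_sq.2 (by rwa [abs_of_nonneg hH])
  have h2 := mul_le_mul_of_nonneg_left h1 (sq_nonneg ‖σ₁‖)
  rw [gradRadius_sq]
  nlinarith [noise_sq_le (σ₀ := σ₀) (σ₁ := σ₁) (γ := γ) (i := i), sq_nonneg ‖σ₀‖,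
    mul_nonneg (sq_nonneg ‖σ₁‖) (sq_nonneg H), sq_nonneg H]

lemma sq_le_of_noise (h : (u - γ) ^ 2 ≤ σ₀ i ^ 2 + σ₁ i ^ 2 * γ ^ 2) :
    u ^ 2 ≤ 2 * (‖σ₀‖ ^ 2 + (1 + ‖σ₁‖ ^ 2) * γ ^ 2) := by
  rw [← noise_sq] at h
  have := h.trans noise_sq_le
  nlinarith [sq_nonneg (u - 2 * γ)]

lemma sq_le_gradRadius_sq (h : (u - γ) ^ 2 ≤ σ₀ i ^ 2 + σ₁ i ^ 2 * γ ^ 2) (h' : |γ| ≤ H) :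
    u ^ 2 ≤ gradRadius σ₀ σ₁ H ^ 2 := by
  have hH : 0 ≤ H := (abs_nonneg _).trans h'
  have h1 : γ ^ 2 ≤ H ^ 2 := sq_le_sq.2 (by rwa [abs_of_nonneg hH])
  rw [gradRadius_sq]
  have h2 := mul_le_mul_of_nonneg_left h1 (by positivity : 0 ≤ 1 + ‖σ₁‖ ^ 2)
  linarith [sq_le_of_noise h]

lemma abs_sub_le_noise (h : (u - γ) ^ 2 ≤ σ₀ i ^ 2 + σ₁ i ^ 2 * γ ^ 2) :
    |u - γ| ≤ noise σ₀ σ₁ γ i := Real.abs_le_sqrt h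

end Noise

lemma abs_apply_le_norm {d : ℕ} (x : E d) (i : Fin d) : |x i| ≤ ‖x‖ := by
  rw [← Real.norm_eq_abs]; exact PiLp.norm_apply_le x i

lemma norm_toLp_sq {d : ℕ} (u : Fin d → ℝ) :
    ‖(WithLp.toLp 2 u : E d)‖ ^ 2 = ∑ i, u i ^ 2 := by
  simp [EuclideanSpace.norm_sq_eq]

namespace Hyper

variable {d : ℕ} (p : Hyper) (f : E d → ℝ) (σ₀ σ₁ : Fin d → ℝ) (x₁ : E d) (g : ℕ → E d)

/-- The gradient at the point where the oracle gives its `k + 1`-st answer. -/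
noncomputable def grad (k : ℕ) : E d := ∇ f (p.iter g (k + 1) x₁)

/-- The predictable proxy of the denominator along the run. -/
noncomputable def prox (k : ℕ) (i : Fin d) : ℝ :=
  p.proxy g k i (p.grad f x₁ g k i) (noise σ₀ σ₁ (p.grad f x₁ g k i) i)

/-- The main decrease in a step. -/
noncomputable def decrease (k : ℕ) : ℝ :=
  ∑ i, p.step (k + 1) * p.grad f x₁ g k i ^ 2 / p.prox f σ₀ σ₁ x₁ g k i

/-- The coefficients of the martingale part of a step. -/
noncomputable def coef (k : ℕ) (i : Fin d) : ℝ :=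
  -(p.step (k + 1) * p.grad f x₁ g k i / p.prox f σ₀ σ₁ x₁ g k i)

/-- The martingale part of a step. -/
noncomputable def mart (k : ℕ) : ℝ :=
  ∑ i, p.coef f σ₀ σ₁ x₁ g k i * (g (k + 1) i - p.grad f x₁ g k i)

/-- The weight `β₁ / (1 - β₁)` of the extrapolation. -/
noncomputable def ρ : ℝ := p.β₁ / (1 - p.β₁)

/-- The extrapolated iterates. -/
noncomputable def extra (k : ℕ) : E d :=
  p.iter g (k + 1) x₁ + p.ρ • (p.iter g (k + 1) x₁ - p.iter g k x₁)

lemma ρ_nonneg : 0 ≤ p.ρ := div_nonneg p.β₁_nonneg p.one_sub_β₁_pos.le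

variable {f σ₀ σ₁ x₁ g}

lemma iter_zero : p.iter g 0 x₁ = x₁ := rfl

lemma iter_one : p.iter g 1 x₁ = x₁ := rfl

lemma iter_succ_apply (k : ℕ) (i : Fin d) :
    p.iter g (k + 1) x₁ i = p.iter g k x₁ i - p.rate g k i * p.m g k i := by
  cases k with
  | zero => rw [m_zero, mul_zero, sub_zero]; rfl
  | succ k => rfl

lemma extra_zero : p.extra x₁ g 0 = x₁ := by
  rw [extra, iter_zero, zero_add, iter_one, sub_self, smul_zero, add_zero]

lemma norm_iter_succ_sub_sq (k : ℕ) :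
    ‖p.iter g (k + 1) x₁ - p.iter g k x₁‖ ^ 2 = ∑ i, (p.rate g k i * p.m g k i) ^ 2 := by
  rw [EuclideanSpace.norm_sq_eq]
  refine Finset.sum_congr rfl fun i _ => ?_
  rw [PiLp.sub_apply, iter_succ_apply, sub_sub_cancel_left, norm_neg, Real.norm_eq_abs, sq_abs]

lemma norm_iter_succ_sub_sq_le (k : ℕ) :
    ‖p.iter g (k + 1) x₁ - p.iter g k x₁‖ ^ 2 ≤ d * p.C₀ ^ 2 := by
  rw [norm_iter_succ_sub_sq]
  refine (Finset.sum_le_sum fun i _ => p.sq_rate_mul_m_le g k i).trans ?_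
  simp

lemma norm_iter_succ_sub_sq_le_U (k : ℕ) :
    ‖p.iter g (k + 1) x₁ - p.iter g k x₁‖ ^ 2 ≤ p.C₀ ^ 2 / (1 - p.β₁) * ∑ i, p.U g k i := by
  rw [norm_iter_succ_sub_sq, Finset.mul_sum]
  exact Finset.sum_le_sum fun i _ => p.sq_rate_mul_m_le_U g k i

lemma norm_iter_sub_le (k : ℕ) : ‖p.iter g (k + 1) x₁ - x₁‖ ≤ k * (√d * p.C₀) := by
  induction k with
  | zero => simp [iter_one]
  | succ k ih =>
    have h : ‖p.iter g (k + 1 + 1) x₁ - p.iter g (k + 1) x₁‖ ≤ √d * p.C₀ := by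
      have hC := p.C₀_pos
      refine abs_le_of_sq_le_sq' ?_ (by positivity) |>.2
      rw [mul_pow, Real.sq_sqrt (Nat.cast_nonneg d)]
      exact p.norm_iter_succ_sub_sq_le (k + 1)
    have h2 := norm_sub_le_norm_sub_add_norm_sub (p.iter g (k + 1 + 1) x₁)
      (p.iter g (k + 1) x₁) x₁
    push_cast
    linarith

lemma norm_extra_sub_sq (k : ℕ) :
    ‖p.extra x₁ g k - p.iter g (k + 1) x₁‖ ^ 2 =
      p.ρ ^ 2 * ‖p.iter g (k + 1) x₁ - p.iter g k x₁‖ ^ 2 := by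
  rw [extra, add_sub_cancel_left, norm_smul, Real.norm_of_nonneg p.ρ_nonneg, mul_pow]

/-- The weight is chosen so that (1+ρ)(1-β₁) = 1 and (1+ρ)β₁ = ρ: the fresh gradient appears with
weight one, and the old momentum is multiplied only by the change of the rate. -/
lemma extra_succ (k : ℕ) :
    p.extra x₁ g (k + 1) = p.extra x₁ g k +
      (WithLp.toLp 2 (fun i => -(p.rate g (k + 1) i * g (k + 1) i)) +
       WithLp.toLp 2 (fun i => -(p.ρ * ((p.rate g (k + 1) i - p.rate g k i) * p.m g k i)))) := by
  ext i
  have h1 := p.iter_succ_apply (x₁ := x₁) (g := g) k i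
  have h2 := p.iter_succ_apply (x₁ := x₁) (g := g) (k + 1) i
  have h3 : p.m g (k + 1) i = p.β₁ * p.m g k i + (1 - p.β₁) * g (k + 1) i := rfl
  have h4 := p.one_sub_β₁_pos.ne'
  simp only [extra, PiLp.add_apply, PiLp.smul_apply, PiLp.sub_apply, smul_eq_mul, h2, h1, h3, ρ]
  field_simp
  ring

variable (f σ₀ σ₁ x₁ g)

/-- The oracle answers of the first `n` steps obey the noise bound. -/
def NoiseBound (n : ℕ) : Prop :=
  ∀ k < n, ∀ i, (g (k + 1) i - p.grad f x₁ g k i) ^ 2 ≤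
    σ₀ i ^ 2 + σ₁ i ^ 2 * p.grad f x₁ g k i ^ 2

variable {f σ₀ σ₁ x₁ g} {L H : ℝ} {n : ℕ}

lemma NoiseBound.mono {m : ℕ} (h : p.NoiseBound f σ₀ σ₁ x₁ g n) (hm : m ≤ n) :
    p.NoiseBound f σ₀ σ₁ x₁ g m := fun k hk => h k (hk.trans_le hm)

lemma v_le_gradRadius_sq (h : p.NoiseBound f σ₀ σ₁ x₁ g n)
    (hH : ∀ k < n, ‖p.grad f x₁ g k‖ ≤ H) {k : ℕ} (hk : k ≤ n) (i : Fin d) :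
    p.v g k i ≤ (1 - p.β₂ ^ k) * gradRadius σ₀ σ₁ H ^ 2 :=
  moment₂_le p.β₂_pos.le p.β₂_lt_one.le fun j hj =>
    sq_le_gradRadius_sq (h j (hj.trans_le hk) i)
      ((abs_apply_le_norm _ i).trans (hH j (hj.trans_le hk)))

/-- The decrease of the objective in a step. -/
lemma descent_step (hf : IsLSmooth f L) (hL : 0 < L) (h : p.NoiseBound f σ₀ σ₁ x₁ g n)
    (hH : ∀ k < n, ‖p.grad f x₁ g k‖ ≤ H) {k : ℕ} (hk : k < n) :
    f (p.extra x₁ g (k + 1)) ≤ f (p.extra x₁ g k) - 1 / 2 * p.decrease f σ₀ σ₁ x₁ g k +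
      p.mart f σ₀ σ₁ x₁ g k +
      (4 * (‖σ₀‖ + ‖σ₁‖ * H) * (p.C₀ / (1 - p.β₁)) + 2 * L * (p.C₀ ^ 2 / (1 - p.β₁) ^ 2)) *
        ∑ i, p.S g (k + 1) i +
      (p.ρ ^ 2 * (p.C₀ / (1 - p.β₁)) * p.momentumConst (gradRadius σ₀ σ₁ H) +
        (L / 2 + 2 * L * sigmaMax p.β₂ ^ 2) * p.ρ ^ 2 * (p.C₀ ^ 2 / (1 - p.β₁))) *
        ∑ i, p.U g k i +
      p.ρ * H * ∑ i, |p.step (k + 1) - p.step k| * |p.m g k i / p.denom g k i| := by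
  have hρ := p.ρ_nonneg
  have hd := hf.descent hL (p.iter g (k + 1) x₁) (p.extra x₁ g k)
    (WithLp.toLp 2 (fun i => -(p.rate g (k + 1) i * g (k + 1) i)))
    (WithLp.toLp 2 (fun i => -(p.ρ * ((p.rate g (k + 1) i - p.rate g k i) * p.m g k i))))
  rw [← extra_succ, norm_extra_sub_sq,
    norm_toLp_sq (fun i => -(p.rate g (k + 1) i * g (k + 1) i)),
    norm_toLp_sq (fun i => -(p.ρ * ((p.rate g (k + 1) i - p.rate g k i) * p.m g k i))),
    PiLp.inner_apply, PiLp.inner_apply] at hd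
  simp only [neg_sq] at hd
  have hu : ∑ i, (p.rate g (k + 1) i * g (k + 1) i) ^ 2 ≤
      p.C₀ ^ 2 / (1 - p.β₁) ^ 2 * ∑ i, p.S g (k + 1) i := by
    rw [Finset.mul_sum]
    exact Finset.sum_le_sum fun i _ => p.sq_rate_mul_g_le g k i
  have hx := p.norm_iter_succ_sub_sq_le_U (x₁ := x₁) (g := g) k
  have hw : ∑ i, (p.ρ * ((p.rate g (k + 1) i - p.rate g k i) * p.m g k i)) ^ 2 ≤
      sigmaMax p.β₂ ^ 2 * p.ρ ^ 2 * (p.C₀ ^ 2 / (1 - p.β₁) * ∑ i, p.U g k i) := by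
    refine le_trans ?_ (mul_le_mul_of_nonneg_left hx (by positivity))
    rw [norm_iter_succ_sub_sq, Finset.mul_sum]
    refine Finset.sum_le_sum fun i _ => ?_
    have h1 := pow_le_pow_left₀ (abs_nonneg _) (p.abs_rate_sub_mul_m_le g k i) 2
    rw [sq_abs, mul_pow (sigmaMax _), sq_abs] at h1
    rw [mul_pow p.ρ]
    have := mul_le_mul_of_nonneg_left h1 (sq_nonneg p.ρ)
    linarith
  have hγ : ∀ i, |p.grad f x₁ g k i| ≤ H := fun i => (abs_apply_le_norm _ i).trans (hH k hk)
  have hv : ∀ i, p.v g k i ≤ gradRadius σ₀ σ₁ H ^ 2 := fun i =>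
    (p.v_le_gradRadius_sq h hH hk.le i).trans
      (mul_le_of_le_one_left (sq_nonneg _) (by linarith [pow_pos p.β₂_pos k]))
  have hC : 0 ≤ p.C₀ / (1 - p.β₁) := div_nonneg p.C₀_pos.le p.one_sub_β₁_pos.le
  have hin : ∑ i, inner ℝ ((∇ f (p.iter g (k + 1) x₁)) i) (-(p.rate g (k + 1) i * g (k + 1) i)) +
      ∑ i, inner ℝ ((∇ f (p.iter g (k + 1) x₁)) i)
        (-(p.ρ * ((p.rate g (k + 1) i - p.rate g k i) * p.m g k i))) ≤
      -(1 / 2 * p.decrease f σ₀ σ₁ x₁ g k) + p.mart f σ₀ σ₁ x₁ g k +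
      4 * (‖σ₀‖ + ‖σ₁‖ * H) * (p.C₀ / (1 - p.β₁)) * ∑ i, p.S g (k + 1) i +
      p.ρ * H * ∑ i, |p.step (k + 1) - p.step k| * |p.m g k i / p.denom g k i| +
      p.ρ ^ 2 * (p.C₀ / (1 - p.β₁)) * p.momentumConst (gradRadius σ₀ σ₁ H) *
        ∑ i, p.U g k i := by
    rw [decrease, mart, Finset.mul_sum, Finset.mul_sum, Finset.mul_sum, Finset.mul_sum,
      ← Finset.sum_neg_distrib, ← Finset.sum_add_distrib, ← Finset.sum_add_distrib,
      ← Finset.sum_add_distrib, ← Finset.sum_add_distrib, ← Finset.sum_add_distrib]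
    refine Finset.sum_le_sum fun i _ => ?_
    -- Three quarters of the decrease survive here and the momentum term takes one quarter, which
    -- leaves the factor 1/2.
    have h1 := p.gradient_term_le (g := g) (k := k) (i := i) (γ := p.grad f x₁ g k i)
      noise_nonneg (abs_sub_le_noise (h k hk i))
    have h2 := p.momentum_term_le (ρ := p.ρ) hρ gradRadius_nonneg
      (sq_le_gradRadius_sq (h k hk i) (hγ i)) (hv i)
      (sq_add_noise_sq_le (σ₀ := σ₀) (σ₁ := σ₁) (i := i) (hγ i))
    have h3 : 4 * noise σ₀ σ₁ (p.grad f x₁ g k i) i * (p.C₀ / (1 - p.β₁)) * p.S g (k + 1) i ≤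
        4 * (‖σ₀‖ + ‖σ₁‖ * H) * (p.C₀ / (1 - p.β₁)) * p.S g (k + 1) i := by
      have := p.S_nonneg g (k + 1) i
      have := noise_le (σ₀ := σ₀) (σ₁ := σ₁) (i := i) (hγ i)
      gcongr
    have h4 : p.ρ * |p.grad f x₁ g k i| *
        (|p.step (k + 1) - p.step k| * |p.m g k i / p.denom g k i|) ≤
        p.ρ * H * (|p.step (k + 1) - p.step k| * |p.m g k i / p.denom g k i|) := by
      have := hγ i
      gcongr
    rw [real_inner_eq_re_inner, real_inner_eq_re_inner]
    simp only [RCLike.inner_apply, conj_trivial, RCLike.re_to_real]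
    rw [coef, prox, ← grad]
    linarith
  have hx' := mul_le_mul_of_nonneg_left hx (by positivity : 0 ≤ L / 2 * p.ρ ^ 2)
  have hu' := mul_le_mul_of_nonneg_left hu (by positivity : 0 ≤ 2 * L)
  have hw' := mul_le_mul_of_nonneg_left hw (by positivity : 0 ≤ 2 * L)
  linarith

end Hyper

end Adam

/-! ### Summation of the descent steps. -/

namespace Adam

namespace Hyper

variable {d : ℕ} (p : Hyper) {f : E d → ℝ} {σ₀ σ₁ : Fin d → ℝ} {x₁ : E d} {g : ℕ → E d}
  {L H : ℝ} {n : ℕ}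

/-- The logarithmic factor `ℓ`. -/
noncomputable def logFactor (L : ℝ) (σ₀ σ₁ : Fin d → ℝ) (grad₁ : ℝ) (T : ℕ) : ℝ :=
  Real.log (logArg L p.C₀ p.ε₀ p.β₁ p.β₂ σ₀ σ₁ grad₁ T / p.β₂ ^ T)

/-- The deterministic part of the sum of the errors of the descent steps. -/
noncomputable def totalError (L H A : ℝ) (σ₀ σ₁ : Fin d → ℝ) : ℝ :=
  (4 * (‖σ₀‖ + ‖σ₁‖ * H) * (p.C₀ / (1 - p.β₁)) + 2 * L * (p.C₀ ^ 2 / (1 - p.β₁) ^ 2)) *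
      (d * A) +
    (p.ρ ^ 2 * (p.C₀ / (1 - p.β₁)) * p.momentumConst (gradRadius σ₀ σ₁ H) +
      (L / 2 + 2 * L * sigmaMax p.β₂ ^ 2) * p.ρ ^ 2 * (p.C₀ ^ 2 / (1 - p.β₁))) *
      ((1 - p.β₁) / (1 - p.β₁ / p.β₂) * (d * A)) +
    p.ρ * H * (d * (2 * p.C₀ / √(1 - p.β₁)))

lemma momentumConst_nonneg {R : ℝ} (hR : 0 ≤ R) : 0 ≤ p.momentumConst R := by
  have := p.β₂_pos
  have := p.ε₀_pos
  rw [momentumConst]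
  positivity

/-- The descent steps telescope from y_0 = x₁, which holds by the convention x_0 = x_1. Only a bound
`A` on the normalized squares enters; momenta reduce to it by `sum_U_le`. -/
lemma sum_descent (hf : IsLSmooth f L) (hL : 0 < L) (hH0 : 0 ≤ H)
    (h : p.NoiseBound f σ₀ σ₁ x₁ g n) (hH : ∀ k < n, ‖p.grad f x₁ g k‖ ≤ H) {A : ℝ}
    (hA : ∀ i, ∑ k ∈ Finset.range n, p.S g (k + 1) i ≤ A) :
    f (p.extra x₁ g n) + 1 / 2 * ∑ k ∈ Finset.range n, p.decrease f σ₀ σ₁ x₁ g k ≤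
      f x₁ + ∑ k ∈ Finset.range n, p.mart f σ₀ σ₁ x₁ g k + p.totalError L H A σ₀ σ₁ := by
  have h1 := p.one_sub_β₁_pos
  have h2 := p.one_sub_ratio_pos
  have hC := p.C₀_pos
  have hρ := p.ρ_nonneg
  set a := 4 * (‖σ₀‖ + ‖σ₁‖ * H) * (p.C₀ / (1 - p.β₁)) + 2 * L * (p.C₀ ^ 2 / (1 - p.β₁) ^ 2)
    with ha
  set b := p.ρ ^ 2 * (p.C₀ / (1 - p.β₁)) * p.momentumConst (gradRadius σ₀ σ₁ H) +
    (L / 2 + 2 * L * sigmaMax p.β₂ ^ 2) * p.ρ ^ 2 * (p.C₀ ^ 2 / (1 - p.β₁)) with hb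
  have hsum : ∑ k ∈ Finset.range n, (f (p.extra x₁ g (k + 1)) - f (p.extra x₁ g k)) ≤
      ∑ k ∈ Finset.range n, (-(1 / 2) * p.decrease f σ₀ σ₁ x₁ g k + p.mart f σ₀ σ₁ x₁ g k +
        a * ∑ i, p.S g (k + 1) i + b * ∑ i, p.U g k i +
        p.ρ * H * ∑ i, |p.step (k + 1) - p.step k| * |p.m g k i / p.denom g k i|) :=
    Finset.sum_le_sum fun k hk => by
      have := p.descent_step hf hL h hH (Finset.mem_range.1 hk)
      rw [← ha, ← hb] at this
      linarith
  rw [Finset.sum_range_sub (fun k => f (p.extra x₁ g k)), extra_zero] at hsum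
  rw [Finset.sum_add_distrib, Finset.sum_add_distrib, Finset.sum_add_distrib,
    Finset.sum_add_distrib, ← Finset.mul_sum, ← Finset.mul_sum, ← Finset.mul_sum,
    ← Finset.mul_sum, Finset.sum_comm, Finset.sum_comm (f := fun k i => p.U g k i),
    Finset.sum_comm (f := fun k i => |p.step (k + 1) - p.step k| * _)] at hsum
  have hS : ∑ i, ∑ k ∈ Finset.range n, p.S g (k + 1) i ≤ d * A := by
    refine (Finset.sum_le_sum fun i _ => hA i).trans ?_
    simp
  have hU : ∑ i, ∑ k ∈ Finset.range n, p.U g k i ≤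
      (1 - p.β₁) / (1 - p.β₁ / p.β₂) * (d * A) := by
    refine (Finset.sum_le_sum fun i _ => p.sum_U_le g i n).trans ?_
    rw [← Finset.mul_sum]
    exact mul_le_mul_of_nonneg_left hS (by positivity)
  have hV : ∑ i, ∑ k ∈ Finset.range n,
      |p.step (k + 1) - p.step k| * |p.m g k i / p.denom g k i| ≤
      d * (2 * p.C₀ / √(1 - p.β₁)) := by
    refine (Finset.sum_le_sum fun i _ => p.sum_step_variation_le g i n).trans ?_
    simp
  have hW := p.momentumConst_nonneg (gradRadius_nonneg (σ₀ := σ₀) (σ₁ := σ₁) (H := H))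
  have hS' := mul_le_mul_of_nonneg_left hS (by positivity : 0 ≤ a)
  have hU' := mul_le_mul_of_nonneg_left hU (by positivity : 0 ≤ b)
  have hV' := mul_le_mul_of_nonneg_left hV (by positivity : 0 ≤ p.ρ * H)
  rw [totalError, ← ha, ← hb]
  linarith

lemma one_le_logArg (hL : 0 < L) (grad₁ : ℝ) (T : ℕ) :
    1 ≤ logArg L p.C₀ p.ε₀ p.β₁ p.β₂ σ₀ σ₁ grad₁ T := by
  have := p.one_sub_ratio_pos
  rw [logArg, le_add_iff_nonneg_right]
  positivity

lemma logFactor_nonneg (hL : 0 < L) (grad₁ : ℝ) (T : ℕ) :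
    0 ≤ p.logFactor L σ₀ σ₁ grad₁ T := by
  apply Real.log_nonneg
  rw [one_le_div (pow_pos p.β₂_pos T)]
  exact (pow_le_one₀ p.β₂_pos.le p.β₂_lt_one.le).trans (p.one_le_logArg hL grad₁ T)

/-- An a priori bound from the bounded length of the steps. It is polynomial in T, which is harmless
inside a logarithm. -/
lemma norm_grad_sq_le (hf : IsLSmooth f L) (hL : 0 < L) {T k : ℕ} (hk : k ≤ T) :
    ‖p.grad f x₁ g k‖ ^ 2 ≤ 2 * ‖∇ f x₁‖ ^ 2 + 2 * (L ^ 2 * (T ^ 2 * (d * p.C₀ ^ 2))) := by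
  have hC := p.C₀_pos
  have h1 := hf.norm_gradient_sub_le hL x₁ (p.iter g (k + 1) x₁)
  have h2 := p.norm_iter_sub_le (x₁ := x₁) (g := g) k
  have hkT : (k : ℝ) ≤ T := Nat.cast_le.2 hk
  have h3 : ‖∇ f (p.iter g (k + 1) x₁) - ∇ f x₁‖ ≤ L * (T * (√d * p.C₀)) := by
    refine h1.trans (mul_le_mul_of_nonneg_left (h2.trans ?_) hL.le)
    gcongr
  have h4 : ‖∇ f (p.iter g (k + 1) x₁) - ∇ f x₁‖ ^ 2 ≤ L ^ 2 * (T ^ 2 * (d * p.C₀ ^ 2)) := by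
    refine (pow_le_pow_left₀ (norm_nonneg _) h3 2).trans (le_of_eq ?_)
    rw [mul_pow, mul_pow, mul_pow, Real.sq_sqrt (Nat.cast_nonneg d)]
  have h5 := norm_le_norm_add_norm_sub' (∇ f (p.iter g (k + 1) x₁)) (∇ f x₁)
  rw [grad]
  nlinarith [sq_nonneg (‖∇ f x₁‖ - ‖∇ f (p.iter g (k + 1) x₁) - ∇ f x₁‖), norm_nonneg (∇ f x₁),
    norm_nonneg (∇ f (p.iter g (k + 1) x₁) - ∇ f x₁), norm_nonneg (∇ f (p.iter g (k + 1) x₁))]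

/-- The a priori gradient bound suffices, so the logarithm does not involve the threshold H and the
bootstrap is not circular. -/
lemma sum_S_le_logFactor (hf : IsLSmooth f L) (hL : 0 < L) {T : ℕ}
    (h : p.NoiseBound f σ₀ σ₁ x₁ g T) (hn : n ≤ T) (i : Fin d) :
    ∑ k ∈ Finset.range n, p.S g (k + 1) i ≤ p.logFactor L σ₀ σ₁ ‖∇ f x₁‖ T := by
  have h2 := p.one_sub_β₂_pos
  have hC := p.C₀_pos
  have hε := p.ε_pos
  have hr := p.one_sub_ratio_pos
  have hr1 : 1 - p.β₁ / p.β₂ ≤ 1 := by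
    have := div_nonneg p.β₁_nonneg p.β₂_pos.le
    linarith
  calc ∑ k ∈ Finset.range n, p.S g (k + 1) i
      ≤ ∑ k ∈ Finset.range T, p.S g (k + 1) i :=
        Finset.sum_le_sum_of_subset_of_nonneg (Finset.range_mono hn)
          fun k _ _ => p.S_nonneg g (k + 1) i
    _ ≤ Real.log ((1 + p.v g T i / p.c) / p.β₂ ^ T) := p.sum_S_le g i T
    _ ≤ _ := by
        have hv0 : 0 ≤ p.v g T i / p.c := div_nonneg (p.v_nonneg g T i) p.c_pos.le
        have hβ : 0 < p.β₂ ^ T := pow_pos p.β₂_pos T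
        apply Real.log_le_log (by positivity)
        refine div_le_div_of_nonneg_right ?_ hβ.le
        have hg : ∀ k ∈ Finset.range T, g (k + 1) i ^ 2 ≤ 2 * (‖σ₀‖ ^ 2 + (1 + ‖σ₁‖ ^ 2) *
            (2 * ‖∇ f x₁‖ ^ 2 + 2 * (L ^ 2 * (T ^ 2 * (d * p.C₀ ^ 2))))) := fun k hk => by
          have hk' := Finset.mem_range.1 hk
          refine (sq_le_of_noise (h k hk' i)).trans ?_
          have h5 : p.grad f x₁ g k i ^ 2 ≤ ‖p.grad f x₁ g k‖ ^ 2 := by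
            rw [← sq_abs]
            exact pow_le_pow_left₀ (abs_nonneg _) (abs_apply_le_norm _ i) 2
          have h6 := h5.trans (p.norm_grad_sq_le hf hL hk'.le)
          gcongr
        have hs := (p.v_le_sum g i T).trans
          (mul_le_mul_of_nonneg_left (Finset.sum_le_sum hg) h2.le)
        rw [Finset.sum_const, Finset.card_range, nsmul_eq_mul] at hs
        -- The factor 1/(1-β₁/β₂) in `logArg` is slack: each coordinate moves by at most C₀ without
        -- it.
        have hd : (d : ℝ) * p.C₀ ^ 2 ≤ d * p.C₀ ^ 2 / (1 - p.β₁ / p.β₂) :=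
          le_div_self (by positivity) hr hr1
        rw [logArg, add_le_add_iff_left, div_le_iff₀ p.c_pos]
        have e1 : (p.ε₀ * √(1 - p.β₂)) ^ 2 = p.ε ^ 2 := rfl
        rw [e1, c]
        have e2 : 2 / p.ε ^ 2 * ((‖σ₀‖ ^ 2 + 2 * (1 + ‖σ₁‖ ^ 2) * ‖∇ f x₁‖ ^ 2) * T +
            2 * (1 + ‖σ₁‖ ^ 2) * d * L ^ 2 * p.C₀ ^ 2 / (1 - p.β₁ / p.β₂) * (T : ℝ) ^ 3) *
            (p.ε ^ 2 * (1 - p.β₂)) = (1 - p.β₂) * (T * (2 * (‖σ₀‖ ^ 2 + (1 + ‖σ₁‖ ^ 2) *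
            (2 * ‖∇ f x₁‖ ^ 2 + 2 * (L ^ 2 * (T ^ 2 * (d * p.C₀ ^ 2 / (1 - p.β₁ / p.β₂)))))))) := by
          field_simp
          ring
        rw [e2]
        refine hs.trans ?_
        gcongr

/-- The decrease controls the squared gradient. -/
lemma norm_grad_sq_le_decrease (h : p.NoiseBound f σ₀ σ₁ x₁ g n)
    (hH : ∀ k < n, ‖p.grad f x₁ g k‖ ≤ H) {k : ℕ} (hk : k < n) :
    ‖p.grad f x₁ g k‖ ^ 2 ≤
      (gradRadius σ₀ σ₁ H + p.ε) / p.η * p.decrease f σ₀ σ₁ x₁ g k := by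
  have hη := p.η_pos
  have hR := gradRadius_nonneg (σ₀ := σ₀) (σ₁ := σ₁) (H := H)
  have hε := p.ε_pos
  rw [EuclideanSpace.norm_sq_eq, decrease, Finset.mul_sum]
  refine Finset.sum_le_sum fun i _ => ?_
  have ha : 0 < p.prox f σ₀ σ₁ x₁ g k i := p.proxy_pos
  have hγ : |p.grad f x₁ g k i| ≤ H := (abs_apply_le_norm _ i).trans (hH k hk)
  have hs := one_sub_pow_pos p.β₂_pos.le p.β₂_lt_one k
  -- Since v_k ≤ (1-β₂^k)R², the proxy carries the same bias correction √(1-β₂^(k+1)) as the step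
  -- size, and the two cancel.
  have h1 : p.prox f σ₀ σ₁ x₁ g k i ≤ √(1 - p.β₂ ^ (k + 1)) * (gradRadius σ₀ σ₁ H + p.ε) := by
    have h2 := p.v_le_gradRadius_sq h hH hk.le i
    have h3 := sq_add_noise_sq_le (σ₀ := σ₀) (σ₁ := σ₁) (i := i) hγ
    have h4 : √(p.β₂ * p.v g k i + (1 - p.β₂) *
        (p.grad f x₁ g k i ^ 2 + noise σ₀ σ₁ (p.grad f x₁ g k i) i ^ 2)) ≤
        √(1 - p.β₂ ^ (k + 1)) * gradRadius σ₀ σ₁ H := by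
      rw [← Real.sqrt_sq hR, ← Real.sqrt_mul hs.le]
      apply Real.sqrt_le_sqrt
      have h5 := mul_le_mul_of_nonneg_left h2 p.β₂_pos.le
      have h6 := mul_le_mul_of_nonneg_left h3 p.one_sub_β₂_pos.le
      rw [pow_succ p.β₂]
      linarith
    have h7 : p.eps (k + 1) = √(1 - p.β₂ ^ (k + 1)) * p.ε := mul_comm _ _
    rw [prox, proxy, h7, mul_add (√(1 - p.β₂ ^ (k + 1)))]
    linarith
  have h2 : p.η * √(1 - p.β₂ ^ (k + 1)) ≤ p.step (k + 1) :=
    le_stepSize p.β₁_nonneg p.β₁_lt_one hη.le k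
  have h3 : p.η * p.prox f σ₀ σ₁ x₁ g k i ≤
      p.step (k + 1) * (gradRadius σ₀ σ₁ H + p.ε) := by
    refine (mul_le_mul_of_nonneg_left h1 hη.le).trans ?_
    rw [← mul_assoc]
    exact mul_le_mul_of_nonneg_right h2 (by positivity)
  rw [Real.norm_eq_abs, sq_abs, div_mul_div_comm, le_div_iff₀ (by positivity)]
  have := mul_le_mul_of_nonneg_right h3 (sq_nonneg (p.grad f x₁ g k i))
  linarith

end Hyper

end Adam

/-! ### Comparison of the total error with G. -/

namespace Adam

namespace Hyper

variable {d : ℕ} (p : Hyper) {f : E d → ℝ} {σ₀ σ₁ : Fin d → ℝ} {x₁ : E d} {g : ℕ → E d}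
  {L H grad₁ Δ₁ δ : ℝ} {T : ℕ}

/-- The variance proxy of the martingale part, relative to the decrease. -/
noncomputable def noiseBudget (σ₀ σ₁ : Fin d → ℝ) (H : ℝ) : ℝ :=
  p.C₀ / (1 - p.β₁) * (d * (‖σ₀‖ + ‖σ₁‖ * H))

lemma noiseBudget_nonneg (hH : 0 ≤ H) : 0 ≤ p.noiseBudget σ₀ σ₁ H := by
  have := p.one_sub_β₁_pos
  have := p.C₀_pos
  rw [noiseBudget]
  positivity

lemma gradRadius_le (hH : 0 ≤ H) :
    gradRadius σ₀ σ₁ H ≤ √2 * ‖σ₀‖ + √2 * √(1 + ‖σ₁‖ ^ 2) * H := by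
  rw [gradRadius, Real.sqrt_mul (by norm_num), mul_assoc, ← mul_add]
  refine mul_le_mul_of_nonneg_left (Real.sqrt_le_iff.2 ⟨by positivity, ?_⟩) (Real.sqrt_nonneg _)
  have h1 := Real.sq_sqrt (by positivity : 0 ≤ 1 + ‖σ₁‖ ^ 2)
  have h2 : 0 ≤ ‖σ₀‖ * (√(1 + ‖σ₁‖ ^ 2) * H) := by positivity
  rw [add_sq, mul_pow, h1]
  linarith

lemma mul_mul_le_sq_div_add (x y c : ℝ) : c * x * y ≤ x ^ 2 / 16 + 4 * c ^ 2 * y ^ 2 := by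
  nlinarith [sq_nonneg (x / 4 - 2 * c * y)]

/-- The bound is affine in H, so that the part multiplying H can be treated by Young's inequality.
-/
lemma momentumConst_le (hH : 0 ≤ H) :
    p.momentumConst (gradRadius σ₀ σ₁ H) ≤
      4 * ‖σ₀‖ / p.β₂ + (p.ε₀ + √2 * ‖σ₀‖) / √p.β₂ +
        2 * √2 * (√(1 + ‖σ₁‖ ^ 2) * H) / p.β₂ := by
  have hβ := p.β₂_pos
  have hs : 0 < √p.β₂ := Real.sqrt_pos.2 hβ
  have h1 := gradRadius_le (σ₀ := σ₀) (σ₁ := σ₁) hH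
  have h2 : √2 ≤ 4 := Real.sqrt_le_iff.2 ⟨by norm_num, by norm_num⟩
  have hb : p.β₂ ≤ √p.β₂ := by
    apply Real.le_sqrt_of_sq_le
    nlinarith [p.β₂_lt_one]
  set Q := √(1 + ‖σ₁‖ ^ 2) * H with hQ
  have hQ0 : 0 ≤ Q := by positivity
  rw [mul_assoc] at h1
  have h3 : √2 * Q / √p.β₂ ≤ √2 * Q / p.β₂ :=
    div_le_div_of_nonneg_left (by positivity) hβ hb
  have h4 : √2 * ‖σ₀‖ / p.β₂ ≤ 4 * ‖σ₀‖ / p.β₂ := by gcongr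
  calc p.momentumConst (gradRadius σ₀ σ₁ H)
      ≤ (√2 * ‖σ₀‖ + √2 * Q) / p.β₂ + (√2 * ‖σ₀‖ + √2 * Q + p.ε₀) / √p.β₂ := by
        rw [momentumConst]; gcongr
    _ = √2 * ‖σ₀‖ / p.β₂ + (p.ε₀ + √2 * ‖σ₀‖) / √p.β₂ + √2 * Q / p.β₂ + √2 * Q / √p.β₂ := by
        ring
    _ ≤ 4 * ‖σ₀‖ / p.β₂ + (p.ε₀ + √2 * ‖σ₀‖) / √p.β₂ + √2 * Q / p.β₂ + √2 * Q / p.β₂ := by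
        gcongr
    _ = _ := by ring

/-- The total error is dominated by the bound `G` of the gradients and a fraction of `H ^ 2`. -/
lemma four_mul_totalError_le (hL : 0 < L) (hΔ : 0 ≤ Δ₁) (hH : 0 ≤ H)
    (hl : 0 ≤ Real.log (d * T / δ)) :
    4 * L * (Δ₁ + p.totalError L H (p.logFactor L σ₀ σ₁ grad₁ T) σ₀ σ₁ +
        2 * p.noiseBudget σ₀ σ₁ H * Real.log (d * T / δ)) +
      2 * L ^ 2 * (p.ρ ^ 2 * (d * p.C₀ ^ 2)) ≤
    H ^ 2 / 4 + gradBound L p.C₀ p.ε₀ p.β₁ p.β₂ σ₀ σ₁ grad₁ Δ₁ δ T := by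
  have hr := p.one_sub_β₁_pos
  have hw := p.one_sub_ratio_pos
  have hw1 : 1 - p.β₁ / p.β₂ ≤ 1 := by
    have := div_nonneg p.β₁_nonneg p.β₂_pos.le
    linarith
  have hC := p.C₀_pos
  have hβ := p.β₂_pos
  have hβ1 := p.β₁_nonneg
  have hε := p.ε₀_pos
  have hl0 : 0 ≤ p.logFactor L σ₀ σ₁ grad₁ T := p.logFactor_nonneg hL grad₁ T
  have hM := p.momentumConst_le (σ₀ := σ₀) (σ₁ := σ₁) hH
  have hS2 := Real.sq_sqrt (by positivity : 0 ≤ 1 + ‖σ₁‖ ^ 2)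
  have h2 := Real.sq_sqrt (zero_le_two : (0 : ℝ) ≤ 2)
  have hr2 := Real.sq_sqrt hr.le
  have hrp : 0 < √(1 - p.β₁) := Real.sqrt_pos.2 hr
  have hN : p.noiseBudget σ₀ σ₁ H =
    p.C₀ / (1 - p.β₁) * (d * (‖σ₀‖ + ‖σ₁‖ * H)) := rfl
  have hE : p.totalError L H (p.logFactor L σ₀ σ₁ grad₁ T) σ₀ σ₁ = (4 * (‖σ₀‖ + ‖σ₁‖ * H) *
      (p.C₀ / (1 - p.β₁)) + 2 * L * (p.C₀ ^ 2 / (1 - p.β₁) ^ 2)) *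
      (d * p.logFactor L σ₀ σ₁ grad₁ T) +
    ((p.β₁ / (1 - p.β₁)) ^ 2 * (p.C₀ / (1 - p.β₁)) * p.momentumConst (gradRadius σ₀ σ₁ H) +
      (L / 2 + 2 * L * sigmaMax p.β₂ ^ 2) * (p.β₁ / (1 - p.β₁)) ^ 2 *
        (p.C₀ ^ 2 / (1 - p.β₁))) *
      ((1 - p.β₁) / (1 - p.β₁ / p.β₂) * (d * p.logFactor L σ₀ σ₁ grad₁ T)) +
    p.β₁ / (1 - p.β₁) * H * (d * (2 * p.C₀ / √(1 - p.β₁))) := rfl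
  have hG : gradBound L p.C₀ p.ε₀ p.β₁ p.β₂ σ₀ σ₁ grad₁ Δ₁ δ T = 8 * L * Δ₁
    + 256 * L ^ 2 * p.C₀ ^ 2 * p.β₁ ^ 2 * d ^ 2 / ((1 - p.β₁) ^ 3 * (1 - p.β₁ / p.β₂))
    + 4 * L ^ 2 * p.C₀ ^ 2 * p.β₁ ^ 2 * d / ((1 - p.β₁) ^ 2 * (1 - p.β₁ / p.β₂))
    + 48 * L * p.C₀ * ‖σ₀‖ / (1 - p.β₁) * d * Real.log (d * T / δ)
    + 8 * L * p.C₀ * p.β₁ ^ 2 / ((1 - p.β₁) ^ 2 * (1 - p.β₁ / p.β₂)) *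
        (4 * ‖σ₀‖ / p.β₂ + (p.ε₀ + √2 * ‖σ₀‖) / √p.β₂ +
          L * p.C₀ / 2 * (1 + 4 * sigmaMax p.β₂ ^ 2)) * d * p.logFactor L σ₀ σ₁ grad₁ T
    + 8 * (3 * L ^ 2 * p.C₀ ^ 2 / (1 - p.β₁) ^ 2 + 8 * L * ‖σ₀‖ * p.C₀ / (1 - p.β₁)) * d *
        p.logFactor L σ₀ σ₁ grad₁ T
    + 2304 * L ^ 2 * p.C₀ ^ 2 * ‖σ₁‖ ^ 2 / (1 - p.β₁) ^ 2 * d ^ 2 * Real.log (d * T / δ) ^ 2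
    + 256 * (16 * L ^ 2 * p.C₀ ^ 2 * ‖σ₁‖ ^ 2 / (1 - p.β₁) ^ 2
      + 9 * L ^ 2 * p.C₀ ^ 2 * p.β₁ ^ 4 * (1 + ‖σ₁‖ ^ 2)
          / (p.β₂ ^ 2 * (1 - p.β₁) ^ 4 * (1 - p.β₁ / p.β₂) ^ 2)) * d ^ 2 *
        p.logFactor L σ₀ σ₁ grad₁ T ^ 2 := rfl
  rw [hG, hE, hN, ρ]
  set l := p.logFactor L σ₀ σ₁ grad₁ T
  set l' := Real.log (d * T / δ)
  set r := 1 - p.β₁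
  set w := 1 - p.β₁ / p.β₂
  set S := √(1 + ‖σ₁‖ ^ 2)
  set s₀ := ‖σ₀‖
  set s₁ := ‖σ₁‖
  set D := (d : ℝ)
  set M := p.momentumConst (gradRadius σ₀ σ₁ H)
  set q := √r
  set sm := sigmaMax p.β₂
  set b := p.β₁
  set B := p.β₂
  set C := p.C₀
  set N₁ := 4 * s₀ / B + (p.ε₀ + √2 * s₀) / √B with hN₁
  have hD : 0 ≤ D := Nat.cast_nonneg d
  have hs₀ : 0 ≤ s₀ := norm_nonneg _
  have hs₁ : 0 ≤ s₁ := norm_nonneg _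
  have hN₁0 : 0 ≤ N₁ := by positivity
  clear hN hE hG
  clear_value N₁ l l' r w S s₀ s₁ D M q sm b B C
  -- There are four contributions linear in H: affine noise, momentum correction, step size
  -- variation and martingale. Each costs H²/16, in total H²/4; their squared coefficients are the
  -- quadratic terms of G.
  have t1 := mul_mul_le_sq_div_add H (L * s₁ * (C / r) * (D * l)) 16
  have t2 := mul_mul_le_sq_div_add H (L * C * b ^ 2 * S / (B * r ^ 2 * w) * (D * l)) (8 * √2)
  have t3 := mul_mul_le_sq_div_add H (L * b * D * C / (r * q)) 8
  have t4 := mul_mul_le_sq_div_add H (L * (C / r) * D * s₁ * l') 8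
  have u2 : 4 * L * ((b / r) ^ 2 * (C / r) * M * (r / w * (D * l))) ≤
      4 * L * (b ^ 2 * C / (r ^ 2 * w)) * N₁ * (D * l) +
      8 * √2 * H * (L * C * b ^ 2 * S / (B * r ^ 2 * w) * (D * l)) := by
    calc 4 * L * ((b / r) ^ 2 * (C / r) * M * (r / w * (D * l)))
        ≤ 4 * L * ((b / r) ^ 2 * (C / r) * (N₁ + 2 * √2 * (S * H) / B) * (r / w * (D * l))) := by
          gcongr
      _ = _ := by field_simp; ring
  have e2 : 4 * (8 * √2) ^ 2 * (L * C * b ^ 2 * S / (B * r ^ 2 * w) * (D * l)) ^ 2 =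
      512 * (L ^ 2 * C ^ 2 * b ^ 4 * (1 + s₁ ^ 2) / (B ^ 2 * r ^ 4 * w ^ 2) * (D ^ 2 * l ^ 2)) := by
    rw [mul_pow 8, h2, ← hS2]; field_simp; ring
  have e3 : 4 * 8 ^ 2 * (L * b * D * C / (r * q)) ^ 2 ≤
      256 * L ^ 2 * C ^ 2 * b ^ 2 * D ^ 2 / (r ^ 3 * w) := by
    rw [div_pow, mul_pow r, hr2]
    calc 4 * 8 ^ 2 * ((L * b * D * C) ^ 2 / (r ^ 2 * r))
        = 256 * L ^ 2 * C ^ 2 * b ^ 2 * D ^ 2 / r ^ 3 := by ring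
      _ ≤ _ := div_le_div_of_nonneg_left (by positivity) (by positivity)
          (mul_le_of_le_one_right (by positivity) hw1)
  have e9 : 2 * L ^ 2 * ((b / r) ^ 2 * (D * C ^ 2)) ≤
      4 * L ^ 2 * C ^ 2 * b ^ 2 * D / (r ^ 2 * w) := by
    calc 2 * L ^ 2 * ((b / r) ^ 2 * (D * C ^ 2))
        = 2 * L ^ 2 * C ^ 2 * b ^ 2 * D / r ^ 2 := by ring
      _ ≤ 4 * L ^ 2 * C ^ 2 * b ^ 2 * D / r ^ 2 := by gcongr; norm_num
      _ ≤ _ := div_le_div_of_nonneg_left (by positivity) (by positivity)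
          (mul_le_of_le_one_right (by positivity) hw1)
  have e5 : 4 * L * ((L / 2 + 2 * L * sm ^ 2) * (b / r) ^ 2 * (C ^ 2 / r) * (r / w * (D * l))) =
      1 / 2 * (8 * L * C * b ^ 2 / (r ^ 2 * w) * (L * C / 2 * (1 + 4 * sm ^ 2)) * D * l) := by
    field_simp
    ring
  have e6 : 4 * L * (b / r * H * (D * (2 * C / q))) = 8 * H * (L * b * D * C / (r * q)) := by
    ring
  have v1 : 0 ≤ L * s₀ * C / r * D * l := by positivity
  have v2 : 0 ≤ L ^ 2 * C ^ 2 / r ^ 2 * D * l := by positivity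
  have v3 : 0 ≤ L * (b ^ 2 * C / (r ^ 2 * w)) * N₁ * (D * l) := by positivity
  have v4 : 0 ≤ 8 * L * C * b ^ 2 / (r ^ 2 * w) * (L * C / 2 * (1 + 4 * sm ^ 2)) * D * l := by
    positivity
  have v5 : 0 ≤ L * C * s₀ / r * D * l' := by positivity
  have v6 : 0 ≤ L ^ 2 * C ^ 2 * s₁ ^ 2 / r ^ 2 * D ^ 2 * l' ^ 2 := by positivity
  have v7 : 0 ≤ L ^ 2 * C ^ 2 * s₁ ^ 2 / r ^ 2 * D ^ 2 * l ^ 2 := by positivity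
  have v8 : 0 ≤ L ^ 2 * C ^ 2 * b ^ 4 * (1 + s₁ ^ 2) / (B ^ 2 * r ^ 4 * w ^ 2) *
    (D ^ 2 * l ^ 2) := by positivity
  have v9 : 0 ≤ L * Δ₁ := by positivity
  have lhs : 4 * L * (Δ₁ + ((4 * (s₀ + s₁ * H) * (C / r) + 2 * L * (C ^ 2 / r ^ 2)) * (D * l) +
      ((b / r) ^ 2 * (C / r) * M + (L / 2 + 2 * L * sm ^ 2) * (b / r) ^ 2 * (C ^ 2 / r)) *
        (r / w * (D * l)) + b / r * H * (D * (2 * C / q))) +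
      2 * (C / r * (D * (s₀ + s₁ * H))) * l') =
      4 * (L * Δ₁) + 16 * (L * s₀ * C / r * D * l) + 16 * H * (L * s₁ * (C / r) * (D * l)) +
      8 * (L ^ 2 * C ^ 2 / r ^ 2 * D * l) +
      4 * L * ((b / r) ^ 2 * (C / r) * M * (r / w * (D * l))) +
      4 * L * ((L / 2 + 2 * L * sm ^ 2) * (b / r) ^ 2 * (C ^ 2 / r) * (r / w * (D * l))) +
      4 * L * (b / r * H * (D * (2 * C / q))) +
      8 * (L * C * s₀ / r * D * l') + 8 * H * (L * (C / r) * D * s₁ * l') := by ring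
  have f1 : 4 * 16 ^ 2 * (L * s₁ * (C / r) * (D * l)) ^ 2 =
    1024 * (L ^ 2 * C ^ 2 * s₁ ^ 2 / r ^ 2 * D ^ 2 * l ^ 2) := by ring
  have f4 : 4 * 8 ^ 2 * (L * (C / r) * D * s₁ * l') ^ 2 =
    256 * (L ^ 2 * C ^ 2 * s₁ ^ 2 / r ^ 2 * D ^ 2 * l' ^ 2) := by ring
  have r4 : 48 * L * C * s₀ / r * D * l' = 48 * (L * C * s₀ / r * D * l') := by ring
  have r5 : 8 * L * C * b ^ 2 / (r ^ 2 * w) *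
      (N₁ + L * C / 2 * (1 + 4 * sm ^ 2)) * D * l =
      8 * (L * (b ^ 2 * C / (r ^ 2 * w)) * N₁ * (D * l)) +
      8 * L * C * b ^ 2 / (r ^ 2 * w) * (L * C / 2 * (1 + 4 * sm ^ 2)) * D * l := by ring
  have r6 : 8 * (3 * L ^ 2 * C ^ 2 / r ^ 2 + 8 * L * s₀ * C / r) * D * l =
      24 * (L ^ 2 * C ^ 2 / r ^ 2 * D * l) + 64 * (L * s₀ * C / r * D * l) := by ring
  have r7 : 2304 * L ^ 2 * C ^ 2 * s₁ ^ 2 / r ^ 2 * D ^ 2 * l' ^ 2 =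
      2304 * (L ^ 2 * C ^ 2 * s₁ ^ 2 / r ^ 2 * D ^ 2 * l' ^ 2) := by ring
  have r8 : 256 * (16 * L ^ 2 * C ^ 2 * s₁ ^ 2 / r ^ 2 + 9 * L ^ 2 * C ^ 2 * b ^ 4 *
      (1 + s₁ ^ 2) / (B ^ 2 * r ^ 4 * w ^ 2)) * D ^ 2 * l ^ 2 =
      4096 * (L ^ 2 * C ^ 2 * s₁ ^ 2 / r ^ 2 * D ^ 2 * l ^ 2) +
      2304 * (L ^ 2 * C ^ 2 * b ^ 4 * (1 + s₁ ^ 2) / (B ^ 2 * r ^ 4 * w ^ 2) *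
        (D ^ 2 * l ^ 2)) := by ring
  rw [lhs, r4, r5, r6, r7, r8]
  rw [f1] at t1
  rw [e2] at t2
  rw [f4] at t4
  linarith

lemma gradBound_nonneg (hL : 0 < L) (hΔ : 0 ≤ Δ₁) (hl : 0 ≤ Real.log (d * T / δ)) :
    0 ≤ gradBound L p.C₀ p.ε₀ p.β₁ p.β₂ σ₀ σ₁ grad₁ Δ₁ δ T := by
  have hr := p.one_sub_β₁_pos
  have hw := p.one_sub_ratio_pos
  have hC := p.C₀_pos
  have hβ := p.β₂_pos
  have hβ1 := p.β₁_nonneg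
  have hε := p.ε₀_pos
  have hl0 : 0 ≤ Real.log (logArg L p.C₀ p.ε₀ p.β₁ p.β₂ σ₀ σ₁ grad₁ T / p.β₂ ^ T) :=
    p.logFactor_nonneg hL grad₁ T
  rw [gradBound]
  positivity

end Hyper

end Adam

/-! ### The bootstrap on the good event. -/

namespace Adam

namespace Hyper

variable {d : ℕ} (p : Hyper) (f : E d → ℝ) (σ₀ σ₁ : Fin d → ℝ) (x₁ : E d) (g : ℕ → E d)
  (H : ℝ) (k : ℕ)

open Classical in
/-- The indicator of the event that the gradients have been bounded by `H` so far. -/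
noncomputable def gate : ℝ := if ∀ j ≤ k, ‖p.grad f x₁ g j‖ ≤ H then 1 else 0

/-- The scale of the exponential moments. -/
noncomputable def scale : ℝ := 1 / (2 * p.noiseBudget σ₀ σ₁ H)

/-- The compensated exponent of the martingale part. -/
noncomputable def exponent : ℝ :=
  p.scale σ₀ σ₁ H * p.mart f σ₀ σ₁ x₁ g k -
    p.scale σ₀ σ₁ H ^ 2 / 2 * p.noiseBudget σ₀ σ₁ H * p.decrease f σ₀ σ₁ x₁ g k

variable {f σ₀ σ₁ x₁ g H k} {L l : ℝ} {n T : ℕ}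

lemma decrease_nonneg : 0 ≤ p.decrease f σ₀ σ₁ x₁ g k :=
  Finset.sum_nonneg fun _ _ => div_nonneg (mul_nonneg (p.step_nonneg _) (sq_nonneg _))
    p.proxy_pos.le

/-- Up to the first time at which the gradient exceeds `H`, the gate is open. -/
lemma sum_gate_eq (hn : n ≤ T) (hH : ∀ k < n, ‖p.grad f x₁ g k‖ ≤ H)
    (hlast : n = T ∨ H < ‖p.grad f x₁ g n‖) :
    ∑ k ∈ Finset.range T, p.gate f x₁ g H k * p.exponent f σ₀ σ₁ x₁ g H k =
      ∑ k ∈ Finset.range n, p.exponent f σ₀ σ₁ x₁ g H k := by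
  rw [← Finset.sum_subset (Finset.range_mono hn)]
  · refine Finset.sum_congr rfl fun k hk => ?_
    rw [gate, if_pos fun j hj => hH j (hj.trans_lt (Finset.mem_range.1 hk)), one_mul]
  · intro k hk hkn
    rw [Finset.mem_range] at hk hkn
    rcases hlast with h | h
    · omega
    · rw [gate, if_neg fun h' => (h' n (by omega)).not_gt h, zero_mul]

/-- In this degenerate case `scale` is 1/0 = 0 and the exponent carries no information, so the
absence of noise has to be used directly. -/
lemma mart_eq_zero (hB : p.noiseBudget σ₀ σ₁ H = 0)
    (h : p.NoiseBound f σ₀ σ₁ x₁ g n) (hk : k < n) (hH : ‖p.grad f x₁ g k‖ ≤ H) :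
    p.mart f σ₀ σ₁ x₁ g k = 0 := by
  refine Finset.sum_eq_zero fun i _ => ?_
  have hd : (d : ℝ) ≠ 0 := Nat.cast_ne_zero.2 (Fin.pos i).ne'
  have hC : p.C₀ / (1 - p.β₁) ≠ 0 := (div_pos p.C₀_pos p.one_sub_β₁_pos).ne'
  rw [noiseBudget, mul_eq_zero_iff_left hC, mul_eq_zero_iff_left hd] at hB
  have h1 := (abs_sub_le_noise (h k hk i)).trans (noise_le ((abs_apply_le_norm _ i).trans hH))
  rw [hB] at h1
  rw [abs_nonpos_iff.1 h1, mul_zero]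

/-- Dividing the exponent by λ = 1/(2B) leaves the compensator λB/2 = 1/4 of the decrease. Since the
descent provides 1/2, a quarter remains. -/
lemma sum_mart_le (hH0 : 0 ≤ H) (h : p.NoiseBound f σ₀ σ₁ x₁ g n)
    (hH : ∀ k < n, ‖p.grad f x₁ g k‖ ≤ H)
    (hE : ∑ k ∈ Finset.range n, p.exponent f σ₀ σ₁ x₁ g H k ≤ l) :
    ∑ k ∈ Finset.range n, p.mart f σ₀ σ₁ x₁ g k ≤
      1 / 4 * ∑ k ∈ Finset.range n, p.decrease f σ₀ σ₁ x₁ g k +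
        2 * p.noiseBudget σ₀ σ₁ H * l := by
  rcases (p.noiseBudget_nonneg (σ₀ := σ₀) (σ₁ := σ₁) hH0).eq_or_lt with hB | hB
  · rw [Finset.sum_eq_zero fun k hk => p.mart_eq_zero hB.symm h (Finset.mem_range.1 hk)
      (hH k (Finset.mem_range.1 hk)), ← hB, mul_zero, zero_mul, add_zero]
    exact mul_nonneg (by norm_num) (Finset.sum_nonneg fun k _ => p.decrease_nonneg)
  · simp only [exponent] at hE
    rw [Finset.sum_sub_distrib, ← Finset.mul_sum, ← Finset.mul_sum, scale] at hE
    have h1 := mul_le_mul_of_nonneg_left hE (by positivity : 0 ≤ 2 * p.noiseBudget σ₀ σ₁ H)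
    have e : 2 * p.noiseBudget σ₀ σ₁ H * (1 / (2 * p.noiseBudget σ₀ σ₁ H) *
        ∑ k ∈ Finset.range n, p.mart f σ₀ σ₁ x₁ g k -
        (1 / (2 * p.noiseBudget σ₀ σ₁ H)) ^ 2 / 2 * p.noiseBudget σ₀ σ₁ H *
          ∑ k ∈ Finset.range n, p.decrease f σ₀ σ₁ x₁ g k) =
        ∑ k ∈ Finset.range n, p.mart f σ₀ σ₁ x₁ g k -
          1 / 4 * ∑ k ∈ Finset.range n, p.decrease f σ₀ σ₁ x₁ g k := by
      field_simp
      ring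
    linarith

/-- Descent is known at the extrapolated point, while the gradient is wanted at the iterate; the two
points differ by ρ times one bounded step. -/
lemma norm_grad_sq_le_extra (hf : IsLSmooth f L) (hL : 0 < L) {c : ℝ} (hc : ∀ x, c ≤ f x) :
    ‖p.grad f x₁ g n‖ ^ 2 ≤
      4 * L * (f (p.extra x₁ g n) - c) + 2 * L ^ 2 * (p.ρ ^ 2 * (d * p.C₀ ^ 2)) := by
  have h1 := hf.norm_gradient_sq_le hL hc (p.extra x₁ g n)
  have h2 := hf.norm_gradient_sub_le hL (p.extra x₁ g n) (p.iter g (n + 1) x₁)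
  have h3 := (p.norm_extra_sub_sq (x₁ := x₁) (g := g) n).le.trans (mul_le_mul_of_nonneg_left
    (p.norm_iter_succ_sub_sq_le (x₁ := x₁) (g := g) n) (sq_nonneg p.ρ))
  have h4 := norm_le_norm_add_norm_sub' (∇ f (p.iter g (n + 1) x₁)) (∇ f (p.extra x₁ g n))
  rw [norm_sub_rev (p.iter g (n + 1) x₁)] at h2
  have h5 := pow_le_pow_left₀ (norm_nonneg _) h2 2
  rw [mul_pow] at h5
  have h6 := mul_le_mul_of_nonneg_left h3 (sq_nonneg L)
  have h7 := pow_le_pow_left₀ (norm_nonneg _) h4 2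
  rw [grad]
  nlinarith [sq_nonneg (‖∇ f (p.extra x₁ g n)‖ -
    ‖∇ f (p.iter g (n + 1) x₁) - ∇ f (p.extra x₁ g n)‖)]

/-- On the good event, the average of the squared gradients is bounded. -/
theorem sum_norm_grad_sq_le (hf : IsLSmooth f L) (hL : 0 < L) {c : ℝ} (hc : ∀ x, c ≤ f x)
    {δ : ℝ} (hl : 0 ≤ Real.log (d * T / δ)) (h : p.NoiseBound f σ₀ σ₁ x₁ g T) (hH0 : 0 ≤ H)
    (hHG : H ^ 2 = 2 * gradBound L p.C₀ p.ε₀ p.β₁ p.β₂ σ₀ σ₁ ‖∇ f x₁‖ (f x₁ - c) δ T)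
    (hE : ∑ k ∈ Finset.range T, p.gate f x₁ g H k * p.exponent f σ₀ σ₁ x₁ g H k ≤
      Real.log (d * T / δ)) :
    ∑ k ∈ Finset.range T, ‖p.grad f x₁ g k‖ ^ 2 ≤
      (gradRadius σ₀ σ₁ H + p.ε) / p.η * (H ^ 2 / L) := by
  have hΔ : 0 ≤ f x₁ - c := sub_nonneg.2 (hc x₁)
  have hU := p.four_mul_totalError_le (σ₀ := σ₀) (σ₁ := σ₁) (H := H) (grad₁ := ‖∇ f x₁‖) hL hΔ
    hH0 hl
  have hX : 0 ≤ 2 * L ^ 2 * (p.ρ ^ 2 * (d * p.C₀ ^ 2)) := by positivity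
  -- The last condition makes n the stopping time, so that the gated sum up to T is the plain sum up
  -- to n. The bound obtained is H²/4 + G = 3H²/4.
  have energy : ∀ n ≤ T, (∀ k < n, ‖p.grad f x₁ g k‖ ≤ H) →
      (n = T ∨ H < ‖p.grad f x₁ g n‖) →
      4 * L * (f (p.extra x₁ g n) - c + 1 / 4 * ∑ k ∈ Finset.range n, p.decrease f σ₀ σ₁ x₁ g k) +
        2 * L ^ 2 * (p.ρ ^ 2 * (d * p.C₀ ^ 2)) ≤ H ^ 2 := fun n hn hH hlast => by
    rw [p.sum_gate_eq hn hH hlast] at hE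
    have hn' := h.mono p hn
    have h1 := p.sum_mart_le hH0 hn' hH hE
    have h2 := p.sum_descent hf hL hH0 hn' hH fun i => p.sum_S_le_logFactor hf hL h hn i
    have h3 : f (p.extra x₁ g n) - c +
        1 / 4 * ∑ k ∈ Finset.range n, p.decrease f σ₀ σ₁ x₁ g k ≤
        f x₁ - c + p.totalError L H (p.logFactor L σ₀ σ₁ ‖∇ f x₁‖ T) σ₀ σ₁ +
          2 * p.noiseBudget σ₀ σ₁ H * Real.log (d * T / δ) := by linarith
    have h4 := mul_le_mul_of_nonneg_left h3 (by positivity : 0 ≤ 4 * L)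
    linarith [sq_nonneg H]
  have hgood : ∀ n < T, ‖p.grad f x₁ g n‖ ≤ H := by
    intro n
    induction n using Nat.strong_induction_on with
    | _ n ih =>
      intro hn
      -- If n were the first time with a gradient above H, the energy bound at n would already force
      -- the squared gradient below H².
      by_contra! hbad
      have h1 := energy n hn.le (fun k hk => ih k hk (hk.trans hn)) (Or.inr hbad)
      have h2 := p.norm_grad_sq_le_extra (x₁ := x₁) (g := g) (n := n) hf hL hc
      have h3 : 0 ≤ ∑ k ∈ Finset.range n, p.decrease f σ₀ σ₁ x₁ g k :=
        Finset.sum_nonneg fun k _ => p.decrease_nonneg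
      have h4 := mul_nonneg hL.le h3
      have h5 := pow_lt_pow_left₀ hbad hH0 two_ne_zero
      linarith
  have h1 := energy T le_rfl hgood (Or.inl rfl)
  have h2 := mul_nonneg hL.le (sub_nonneg.2 (hc (p.extra x₁ g T)))
  have h3 : ∑ k ∈ Finset.range T, p.decrease f σ₀ σ₁ x₁ g k ≤ H ^ 2 / L := by
    rw [le_div_iff₀ hL]
    linarith
  refine (Finset.sum_le_sum fun k hk =>
    p.norm_grad_sq_le_decrease h hgood (Finset.mem_range.1 hk)).trans ?_
  rw [← Finset.mul_sum]
  exact mul_le_mul_of_nonneg_left h3 (div_nonneg (add_nonneg gradRadius_nonneg p.ε_pos.le)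
    p.η_pos.le)

end Hyper

end Adam

/-! ### Measurability, and the conditional law of the oracle's answers. -/

namespace Adam

section Measurability

variable {d : ℕ} {Ω : Type*} [MeasurableSpace Ω] {G : ℕ → Ω → E d} {k : ℕ}

lemma measurable_moment₁ {β : ℝ} (hG : ∀ j < k, Measurable (G (j + 1))) (i : Fin d) :
    Measurable fun ω => moment₁ β (fun j => G j ω) k i := by
  induction k with
  | zero => exact measurable_const
  | succ k ih =>
    have h1 := ih fun j hj => hG j (by omega)
    have h2 := hG k (by omega)
    simp only [moment₁_succ]
    fun_prop

lemma measurable_moment₂ {β : ℝ} (hG : ∀ j < k, Measurable (G (j + 1))) (i : Fin d) :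
    Measurable fun ω => moment₂ β (fun j => G j ω) k i := by
  induction k with
  | zero => exact measurable_const
  | succ k ih =>
    have h1 := ih fun j hj => hG j (by omega)
    have h2 := hG k (by omega)
    simp only [moment₂_succ]
    fun_prop

namespace Hyper

variable (p : Hyper) {f : E d → ℝ} {σ₀ σ₁ : Fin d → ℝ} {x₁ : E d} {H : ℝ}

lemma iter_succ_eq (g : ℕ → E d) (k : ℕ) :
    p.iter g (k + 1) x₁ =
      p.iter g k x₁ - WithLp.toLp 2 fun i => p.rate g k i * p.m g k i := by
  ext i
  rw [iter_succ_apply, PiLp.sub_apply]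

lemma measurable_iter (hG : ∀ j < k, Measurable (G (j + 1))) :
    Measurable fun ω => p.iter (fun j => G j ω) (k + 1) x₁ := by
  induction k with
  | zero => exact measurable_const
  | succ k ih =>
    have h1 := ih fun j hj => hG j (by omega)
    have h2 := fun i => measurable_moment₁ (β := p.β₁) hG i
    have h3 := fun i => measurable_moment₂ (β := p.β₂) hG i
    simp only [p.iter_succ_eq _ (k + 1), rate, denom, m, v]
    fun_prop

lemma measurable_grad (hf : Continuous (∇ f)) (hG : ∀ j < k, Measurable (G (j + 1))) :
    Measurable fun ω => p.grad f x₁ (fun j => G j ω) k :=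
  hf.measurable.comp (p.measurable_iter hG)

lemma measurable_prox (hf : Continuous (∇ f)) (hG : ∀ j < k, Measurable (G (j + 1)))
    (i : Fin d) : Measurable fun ω => p.prox f σ₀ σ₁ x₁ (fun j => G j ω) k i := by
  have h1 := p.measurable_grad (x₁ := x₁) hf hG
  have h3 := measurable_moment₂ (β := p.β₂) hG i
  simp only [prox, proxy, noise, v]
  fun_prop

lemma measurable_coef (hf : Continuous (∇ f)) (hG : ∀ j < k, Measurable (G (j + 1)))
    (i : Fin d) : Measurable fun ω => p.coef f σ₀ σ₁ x₁ (fun j => G j ω) k i := by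
  have h1 := p.measurable_grad (x₁ := x₁) hf hG
  have h2 := p.measurable_prox (σ₀ := σ₀) (σ₁ := σ₁) (x₁ := x₁) hf hG i
  simp only [coef]
  fun_prop

lemma measurable_decrease (hf : Continuous (∇ f)) (hG : ∀ j < k, Measurable (G (j + 1))) :
    Measurable fun ω => p.decrease f σ₀ σ₁ x₁ (fun j => G j ω) k := by
  have h1 := p.measurable_grad (x₁ := x₁) hf hG
  have h2 := fun i => p.measurable_prox (σ₀ := σ₀) (σ₁ := σ₁) (x₁ := x₁) hf hG i
  simp only [decrease]
  fun_prop

lemma measurable_mart (hf : Continuous (∇ f)) (hG : ∀ j < k + 1, Measurable (G (j + 1))) :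
    Measurable fun ω => p.mart f σ₀ σ₁ x₁ (fun j => G j ω) k := by
  have hG' : ∀ j < k, Measurable (G (j + 1)) := fun j hj => hG j (by omega)
  have h1 := p.measurable_grad (x₁ := x₁) hf hG'
  have h2 := fun i => p.measurable_coef (σ₀ := σ₀) (σ₁ := σ₁) (x₁ := x₁) hf hG' i
  have h3 := hG k (by omega)
  simp only [mart]
  fun_prop

lemma measurable_gate (hf : Continuous (∇ f)) (hG : ∀ j < k, Measurable (G (j + 1))) :
    Measurable fun ω => p.gate f x₁ (fun j => G j ω) H k := by
  refine Measurable.ite ?_ measurable_const measurable_const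
  have e : {ω | ∀ j ≤ k, ‖p.grad f x₁ (fun j => G j ω) j‖ ≤ H} =
      ⋂ j, ⋂ (_ : j ≤ k), {ω | ‖p.grad f x₁ (fun j => G j ω) j‖ ≤ H} := by
    ext ω; simp
  rw [e]
  refine MeasurableSet.iInter fun j => MeasurableSet.iInter fun hj => ?_
  exact measurableSet_le (p.measurable_grad hf fun l hl => hG l (by omega)).norm
    measurable_const

lemma measurable_sum_exponent (hf : Continuous (∇ f)) (hG : ∀ j < k, Measurable (G (j + 1))) :
    Measurable fun ω => ∑ j ∈ Finset.range k, p.gate f x₁ (fun j => G j ω) H j *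
      p.exponent f σ₀ σ₁ x₁ (fun j => G j ω) H j := by
  refine Finset.measurable_sum _ fun j hj => ?_
  have hj := Finset.mem_range.1 hj
  have h1 := p.measurable_gate (x₁ := x₁) (H := H) (k := j) hf fun l hl => hG l (by omega)
  have h2 := p.measurable_mart (σ₀ := σ₀) (σ₁ := σ₁) (x₁ := x₁) (k := j) hf
    fun l hl => hG l (by omega)
  have h3 := p.measurable_decrease (σ₀ := σ₀) (σ₁ := σ₁) (x₁ := x₁) (k := j) hf
    fun l hl => hG l (by omega)
  simp only [exponent]
  fun_prop

end Hyper

end Measurability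

section Oracle

/-- The joint law of an observable of the past and of an answer of a kernel. -/
lemma map_prodMk_eq_compProd {Ω S F : Type*} {m mΩ : MeasurableSpace Ω} [MeasurableSpace S]
    [MeasurableSpace F] (hm : m ≤ mΩ) {P : Measure Ω}
    [IsProbabilityMeasure P] {κ : Kernel F F} [IsMarkovKernel κ] {W : Ω → S}
    (hW : Measurable[m] W) {X : S → F} (hX : Measurable X) {Y : Ω → F} (hY : Measurable Y)
    (hc : ∀ A : Set F, MeasurableSet A →
      P[(Y ⁻¹' A).indicator (fun _ => (1 : ℝ)) | m] =ᵐ[P] fun ω => (κ (X (W ω))).real A) :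
    P.map (fun ω => (W ω, Y ω)) = (P.map W) ⊗ₘ (κ.comap X hX) := by
  have hW' : Measurable W := hW.mono hm le_rfl
  have : IsProbabilityMeasure (P.map W) := Measure.isProbabilityMeasure_map hW'.aemeasurable
  have : IsProbabilityMeasure (P.map fun ω => (W ω, Y ω)) :=
    Measure.isProbabilityMeasure_map (hW'.prodMk hY).aemeasurable
  -- Rectangles determine the law, and on a rectangle the claim is the defining property of the
  -- conditional expectation on the past event W⁻¹(A).
  refine Measure.ext_prod fun {A B} hA hB => ?_
  rw [Measure.map_apply (hW'.prodMk hY) (hA.prod hB), Measure.compProd_apply_prod hA hB,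
    setLIntegral_map hA (Kernel.measurable_coe _ hB) hW']
  have hAm : MeasurableSet[m] (W ⁻¹' A) := hW hA
  have hYB : MeasurableSet (Y ⁻¹' B) := hY hB
  have hi : Integrable ((Y ⁻¹' B).indicator (fun _ => (1 : ℝ))) P :=
    (integrable_const 1).indicator hYB
  have h1 := setIntegral_condExp hm hi hAm
  rw [setIntegral_congr_ae (hm _ hAm) ((hc B hB).mono fun ω h _ => h),
    integral_indicator hYB, Measure.restrict_restrict hYB, setIntegral_const, smul_eq_mul,
    mul_one] at h1
  have e : (fun ω => (W ω, Y ω)) ⁻¹' A ×ˢ B = Y ⁻¹' B ∩ W ⁻¹' A := by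
    ext ω; simp [and_comm]
  have hκ : Measurable fun ω => κ (X (W ω)) B :=
    (Kernel.measurable_coe κ hB).comp (hX.comp hW')
  rw [e, ← ofReal_measureReal, ← h1]
  simp only [Kernel.comap_apply, measureReal_def]
  rw [integral_toReal hκ.aemeasurable (Filter.Eventually.of_forall fun ω => measure_lt_top _ _),
    ENNReal.ofReal_toReal]
  refine ((setLIntegral_le_lintegral _ _).trans_lt ?_).ne
  refine (lintegral_mono fun ω => prob_le_one).trans_lt ?_
  simp

variable {d : ℕ} {κ : Kernel (E d) (E d)} {f : E d → ℝ} {σ₀ σ₁ : Fin d → ℝ}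

/-- The noise of the oracle, along any direction, is sub-Gaussian. -/
lemma lintegral_exp_noise_le [IsMarkovKernel κ] (hu : IsUnbiased κ f)
    (hn : HasAffineNoise κ f σ₀ σ₁) (x : E d) (h : Fin d → ℝ) :
    ∫⁻ y, ENNReal.ofReal (Real.exp (∑ i, h i * (y i - ∇ f x i))) ∂κ x ≤
      ENNReal.ofReal (Real.exp ((∑ i, |h i| * noise σ₀ σ₁ (∇ f x i) i) ^ 2 / 2)) := by
  set Z := ∑ i, |h i| * noise σ₀ σ₁ (∇ f x i) i with hZ
  have hZ0 : 0 ≤ Z := Finset.sum_nonneg fun i _ => mul_nonneg (abs_nonneg _) noise_nonneg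
  obtain ⟨hint, hmean⟩ := hu x
  have hi : ∀ i, Integrable (fun y : E d => y i) (κ x) := fun i =>
    (EuclideanSpace.proj (𝕜 := ℝ) i).integrable_comp hint
  have hmi : ∀ i, ∫ y : E d, y i ∂κ x = ∇ f x i := fun i => by
    have := (EuclideanSpace.proj (𝕜 := ℝ) (ι := Fin d) i).integral_comp_comm hint
    rw [hmean] at this
    exact this
  have hb : ∀ᵐ y ∂κ x, (∑ i, h i * (y i - ∇ f x i)) ∈ Set.Icc (-Z) Z := by
    filter_upwards [ae_all_iff.2 (hn x)] with y hy
    rw [Set.mem_Icc, ← abs_le]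
    refine (Finset.abs_sum_le_sum_abs _ _).trans (Finset.sum_le_sum fun i _ => ?_)
    rw [abs_mul]
    exact mul_le_mul_of_nonneg_left (abs_sub_le_noise (hy i)) (abs_nonneg _)
  have hmz : ∫ y, (∑ i, h i * (y i - ∇ f x i)) ∂κ x = 0 := by
    have hi' : ∀ i, Integrable (fun y : E d => h i * (y i - ∇ f x i)) (κ x) := fun i =>
      ((hi i).sub (integrable_const _)).const_mul _
    rw [integral_finsetSum _ fun i _ => hi' i]
    refine Finset.sum_eq_zero fun i _ => ?_
    rw [integral_const_mul, integral_sub (hi i) (integrable_const _), hmi]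
    simp
  have hmeas : AEMeasurable (fun y : E d => ∑ i, h i * (y i - ∇ f x i)) (κ x) := by fun_prop
  -- Hoeffding's lemma for a centred variable in [-Z, Z]. Coordinates of one answer may be
  -- dependent, so Z is the sum of their ranges.
  have hsub := hasSubgaussianMGF_of_mem_Icc_of_integral_eq_zero hmeas hb hmz
  have h1 := hsub.mgf_le 1
  have h2 := hsub.integrable_exp_mul 1
  simp only [one_mul] at h2
  rw [← ofReal_integral_eq_lintegral_ofReal h2
    (Filter.Eventually.of_forall fun y => (Real.exp_pos _).le)]
  apply ENNReal.ofReal_le_ofReal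
  simp only [mgf, one_mul] at h1
  refine h1.trans (le_of_eq ?_)
  congr 1
  have e : |Z + Z| / 2 = Z := by rw [abs_of_nonneg (by linarith)]; ring
  simp [e]

end Oracle

end Adam

/-! ### The exponential supermartingale. -/

namespace Adam

namespace Hyper

variable {d : ℕ} (p : Hyper) {f : E d → ℝ} {σ₀ σ₁ : Fin d → ℝ} {x₁ : E d} {H : ℝ}

/-- Cauchy–Schwarz separates Σ ηγ²/a, the decrease, from Σ ηN²/a. In the second sum a ≥ √(1-β₂)N
removes one power of N and cancels the √(1-β₂) of the step size. This self-bounding lets the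
decrease pay for the martingale. -/
lemma sq_sum_abs_coef_mul_noise_le {g : ℕ → E d} {k : ℕ} (hH : ‖p.grad f x₁ g k‖ ≤ H) :
    (∑ i, |p.coef f σ₀ σ₁ x₁ g k i| * noise σ₀ σ₁ (p.grad f x₁ g k i) i) ^ 2 ≤
      p.noiseBudget σ₀ σ₁ H * p.decrease f σ₀ σ₁ x₁ g k := by
  have ha : ∀ i, 0 < p.prox f σ₀ σ₁ x₁ g k i := fun i => p.proxy_pos
  have hη := p.step_nonneg (k + 1)
  have hs : 0 < √(1 - p.β₂) := Real.sqrt_pos.2 p.one_sub_β₂_pos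
  have hC : 0 ≤ p.C₀ / (1 - p.β₁) := div_nonneg p.C₀_pos.le p.one_sub_β₁_pos.le
  have hH0 : 0 ≤ H := (norm_nonneg _).trans hH
  have h1 := Finset.sum_sq_le_sum_mul_sum_of_sq_le_mul Finset.univ
    (r := fun i => |p.coef f σ₀ σ₁ x₁ g k i| * noise σ₀ σ₁ (p.grad f x₁ g k i) i)
    (f := fun i => p.step (k + 1) * p.grad f x₁ g k i ^ 2 / p.prox f σ₀ σ₁ x₁ g k i)
    (g := fun i => p.step (k + 1) * noise σ₀ σ₁ (p.grad f x₁ g k i) i ^ 2 /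
      p.prox f σ₀ σ₁ x₁ g k i)
    (fun i _ => div_nonneg (by positivity) (ha i).le)
    (fun i _ => div_nonneg (by positivity) (ha i).le)
    (fun i _ => by rw [mul_pow, sq_abs, coef]; exact le_of_eq (by ring))
  refine h1.trans ?_
  rw [mul_comm, decrease]
  refine mul_le_mul_of_nonneg_right ?_
    (Finset.sum_nonneg fun i _ => div_nonneg (by positivity) (ha i).le)
  have h2 : ∀ i ∈ Finset.univ, p.step (k + 1) * noise σ₀ σ₁ (p.grad f x₁ g k i) i ^ 2 /
      p.prox f σ₀ σ₁ x₁ g k i ≤ p.C₀ / (1 - p.β₁) * (‖σ₀‖ + ‖σ₁‖ * H) := fun i _ => by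
    have hN : 0 ≤ noise σ₀ σ₁ (p.grad f x₁ g k i) i := noise_nonneg
    have h3 : √(1 - p.β₂) * noise σ₀ σ₁ (p.grad f x₁ g k i) i ≤ p.prox f σ₀ σ₁ x₁ g k i :=
      p.sqrt_mul_noise_le_proxy
    have h4 := noise_le (σ₀ := σ₀) (σ₁ := σ₁) (i := i) ((abs_apply_le_norm _ i).trans hH)
    have h5 := p.step_le k
    have h6 : p.η / (1 - p.β₁) = p.C₀ / (1 - p.β₁) * √(1 - p.β₂) := by rw [η]; ring
    set N := noise σ₀ σ₁ (p.grad f x₁ g k i) i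
    rw [div_le_iff₀ (ha i)]
    calc p.step (k + 1) * N ^ 2
        ≤ p.C₀ / (1 - p.β₁) * √(1 - p.β₂) * N ^ 2 :=
          mul_le_mul_of_nonneg_right (h5.trans h6.le) (sq_nonneg _)
      _ = p.C₀ / (1 - p.β₁) * N * (√(1 - p.β₂) * N) := by ring
      _ ≤ p.C₀ / (1 - p.β₁) * (‖σ₀‖ + ‖σ₁‖ * H) * p.prox f σ₀ σ₁ x₁ g k i := by gcongr
  refine (Finset.sum_le_sum h2).trans (le_of_eq ?_)
  rw [Finset.sum_const, Finset.card_univ, Fintype.card_fin, nsmul_eq_mul, noiseBudget]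
  ring

variable (f σ₀ σ₁ x₁ H) in
/-- What a step of the exponential supermartingale depends on, apart from the new answer: the
exponent so far, the direction of the noise, and the iterate. -/
noncomputable def past (g : ℕ → E d) (k : ℕ) : ℝ × (Fin d → ℝ) × E d :=
  (∑ j ∈ Finset.range k, p.gate f x₁ g H j * p.exponent f σ₀ σ₁ x₁ g H j -
      p.gate f x₁ g H k * (p.scale σ₀ σ₁ H ^ 2 / 2 * p.noiseBudget σ₀ σ₁ H *
        p.decrease f σ₀ σ₁ x₁ g k),
    fun i => p.gate f x₁ g H k * (p.scale σ₀ σ₁ H * p.coef f σ₀ σ₁ x₁ g k i),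
    p.iter g (k + 1) x₁)

lemma measurable_past {Ω : Type*} [MeasurableSpace Ω] {G : ℕ → Ω → E d} {k : ℕ}
    (hf : Continuous (∇ f)) (hG : ∀ j < k, Measurable (G (j + 1))) :
    Measurable fun ω => p.past f σ₀ σ₁ x₁ H (fun j => G j ω) k := by
  have m1 := p.measurable_sum_exponent (σ₀ := σ₀) (σ₁ := σ₁) (x₁ := x₁) (H := H) hf hG
  have m2 := p.measurable_gate (x₁ := x₁) (H := H) hf hG
  have m3 := fun i => p.measurable_coef (σ₀ := σ₀) (σ₁ := σ₁) (x₁ := x₁) hf hG i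
  have m4 := p.measurable_decrease (σ₀ := σ₀) (σ₁ := σ₁) (x₁ := x₁) hf hG
  exact (m1.sub (m2.mul (m4.const_mul _))).prodMk
    ((measurable_pi_lambda _ fun i => m2.mul ((m3 i).const_mul _)).prodMk (p.measurable_iter hG))

variable {Ω : Type*} [mΩ : MeasurableSpace Ω] {P : Measure Ω}
  {κ : Kernel (E d) (E d)} {T k : ℕ} {ℱ : Filtration ℕ mΩ} {g : ℕ → Ω → E d}

lemma measurable_answer (hrun : IsRun P κ p.β₁ p.β₂ p.η p.ε x₁ T ℱ g) (hk : k ≤ T) :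
    ∀ j < k, Measurable[ℱ k] (g (j + 1)) := fun j hj =>
  (hrun.measurable j (hj.trans_le hk)).mono (ℱ.mono hj) le_rfl

variable [IsProbabilityMeasure P] [IsMarkovKernel κ]

/-- One step of the exponential supermartingale. -/
lemma lintegral_exp_succ_le (hf : Continuous (∇ f)) (hu : IsUnbiased κ f)
    (hn : HasAffineNoise κ f σ₀ σ₁) (hrun : IsRun P κ p.β₁ p.β₂ p.η p.ε x₁ T ℱ g) (hk : k < T) :
    ∫⁻ ω, ENNReal.ofReal (Real.exp (∑ j ∈ Finset.range (k + 1),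
        p.gate f x₁ (fun j => g j ω) H j * p.exponent f σ₀ σ₁ x₁ (fun j => g j ω) H j)) ∂P ≤
      ∫⁻ ω, ENNReal.ofReal (Real.exp (∑ j ∈ Finset.range k,
        p.gate f x₁ (fun j => g j ω) H j * p.exponent f σ₀ σ₁ x₁ (fun j => g j ω) H j)) ∂P := by
  have hm := p.measurable_answer hrun hk.le
  set A : Ω → ℝ := fun ω => ∑ j ∈ Finset.range k,
    p.gate f x₁ (fun j => g j ω) H j * p.exponent f σ₀ σ₁ x₁ (fun j => g j ω) H j with hA
  set h : Ω → Fin d → ℝ := fun ω i => p.gate f x₁ (fun j => g j ω) H k *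
    (p.scale σ₀ σ₁ H * p.coef f σ₀ σ₁ x₁ (fun j => g j ω) k i) with hh
  set c : Ω → ℝ := fun ω => p.gate f x₁ (fun j => g j ω) H k * (p.scale σ₀ σ₁ H ^ 2 / 2 *
    p.noiseBudget σ₀ σ₁ H * p.decrease f σ₀ σ₁ x₁ (fun j => g j ω) k) with hc
  have hW : Measurable[ℱ k] fun ω =>
      (A ω - c ω, h ω, p.iter (fun j => g j ω) (k + 1) x₁) :=
    @measurable_past d p f σ₀ σ₁ x₁ H Ω (ℱ k) g k hf hm
  have hX : Measurable fun s : ℝ × (Fin d → ℝ) × E d => s.2.2 := by fun_prop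
  have hY : Measurable (g (k + 1)) := (hrun.measurable k hk).mono (ℱ.le _) le_rfl
  -- The new answer is integrated first, with the past frozen.
  have hlaw := map_prodMk_eq_compProd (ℱ.le k) (P := P) (κ := κ) hW hX hY (hrun.cond_law k hk)
  have hW' := hW.mono (ℱ.le k) le_rfl
  have : IsProbabilityMeasure (P.map fun ω =>
      (A ω - c ω, h ω, p.iter (fun j => g j ω) (k + 1) x₁)) :=
    Measure.isProbabilityMeasure_map hW'.aemeasurable
  set φ : (ℝ × (Fin d → ℝ) × E d) × E d → ENNReal := fun s => ENNReal.ofReal (Real.exp s.1.1) *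
    ENNReal.ofReal (Real.exp (∑ i, s.1.2.1 i * (s.2 i - ∇ f s.1.2.2 i))) with hφ
  have hφm : Measurable φ := by
    have := hf.measurable
    fun_prop
  have e : ∀ ω, ENNReal.ofReal (Real.exp (∑ j ∈ Finset.range (k + 1),
      p.gate f x₁ (fun j => g j ω) H j * p.exponent f σ₀ σ₁ x₁ (fun j => g j ω) H j)) =
      φ ((A ω - c ω, h ω, p.iter (fun j => g j ω) (k + 1) x₁), g (k + 1) ω) := fun ω => by
    rw [hφ]
    simp only
    rw [← ENNReal.ofReal_mul (Real.exp_pos _).le, ← Real.exp_add, Finset.sum_range_succ]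
    congr 2
    have e1 : ∑ i, h ω i * (g (k + 1) ω i - ∇ f (p.iter (fun j => g j ω) (k + 1) x₁) i) =
        p.gate f x₁ (fun j => g j ω) H k * (p.scale σ₀ σ₁ H *
          p.mart f σ₀ σ₁ x₁ (fun j => g j ω) k) := by
      rw [mart, Finset.mul_sum, Finset.mul_sum]
      refine Finset.sum_congr rfl fun i _ => ?_
      rw [hh, grad]
      ring
    rw [e1, exponent]
    ring
  simp only [e]
  rw [← lintegral_map hφm (hW'.prodMk hY), hlaw, Measure.lintegral_compProd hφm,
    lintegral_map hφm.lintegral_kernel_prod_right' hW']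
  refine lintegral_mono fun ω => ?_
  simp only [hφ, Kernel.comap_apply]
  rw [lintegral_const_mul _ (by fun_prop)]
  refine (mul_le_mul_right (lintegral_exp_noise_le hu hn _ _) _).trans ?_
  rw [← ENNReal.ofReal_mul (Real.exp_pos _).le, ← Real.exp_add]
  refine ENNReal.ofReal_le_ofReal (Real.exp_le_exp.2 ?_)
  -- The compensator dominates Hoeffding's exponent when the gate is open, by the variance bound;
  -- when it is closed both vanish.
  have key : (∑ i, |h ω i| * noise σ₀ σ₁ (∇ f (p.iter (fun j => g j ω) (k + 1) x₁) i) i) ^ 2 / 2 ≤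
      c ω := by
    simp only [hh, hc, gate]
    split_ifs with hg
    · have h1 := p.sq_sum_abs_coef_mul_noise_le (σ₀ := σ₀) (σ₁ := σ₁) (hg k le_rfl)
      have h2 : ∑ i, |1 * (p.scale σ₀ σ₁ H * p.coef f σ₀ σ₁ x₁ (fun j => g j ω) k i)| *
          noise σ₀ σ₁ (∇ f (p.iter (fun j => g j ω) (k + 1) x₁) i) i =
          |p.scale σ₀ σ₁ H| * ∑ i, |p.coef f σ₀ σ₁ x₁ (fun j => g j ω) k i| *
            noise σ₀ σ₁ (p.grad f x₁ (fun j => g j ω) k i) i := by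
        rw [Finset.mul_sum]
        refine Finset.sum_congr rfl fun i _ => ?_
        rw [one_mul, abs_mul, mul_assoc, grad]
      rw [h2, mul_pow, sq_abs]
      have h3 := mul_le_mul_of_nonneg_left h1 (sq_nonneg (p.scale σ₀ σ₁ H))
      linarith
    · simp
  linarith

/-- The good event for the martingale part has probability at least `1 - δ`. -/
lemma measure_lt_sum_exponent_le (hf : Continuous (∇ f)) (hu : IsUnbiased κ f)
    (hn : HasAffineNoise κ f σ₀ σ₁) (hrun : IsRun P κ p.β₁ p.β₂ p.η p.ε x₁ T ℱ g) {δ : ℝ}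
    (hδ : 0 < δ) :
    P {ω | Real.log (1 / δ) ≤ ∑ j ∈ Finset.range T,
        p.gate f x₁ (fun j => g j ω) H j * p.exponent f σ₀ σ₁ x₁ (fun j => g j ω) H j} ≤
      ENNReal.ofReal δ := by
  have h1 : ∀ k ≤ T, ∫⁻ ω, ENNReal.ofReal (Real.exp (∑ j ∈ Finset.range k,
      p.gate f x₁ (fun j => g j ω) H j * p.exponent f σ₀ σ₁ x₁ (fun j => g j ω) H j)) ∂P ≤ 1 := by
    intro k hk
    induction k with
    | zero => simp
    | succ k ih => exact (p.lintegral_exp_succ_le hf hu hn hrun hk).trans (ih (by omega))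
  have hG : ∀ j < T, Measurable (g (j + 1)) := fun j hj =>
    (hrun.measurable j hj).mono (ℱ.le _) le_rfl
  have hm := p.measurable_sum_exponent (σ₀ := σ₀) (σ₁ := σ₁) (x₁ := x₁) (H := H) hf hG
  -- Markov's inequality at the final time only: the gate has already stopped the process.
  have h2 := mul_meas_ge_le_lintegral (μ := P) hm.exp.ennreal_ofReal (ENNReal.ofReal (1 / δ))
  have h3 := h2.trans (h1 T le_rfl)
  have h4 : {ω | Real.log (1 / δ) ≤ ∑ j ∈ Finset.range T,
        p.gate f x₁ (fun j => g j ω) H j * p.exponent f σ₀ σ₁ x₁ (fun j => g j ω) H j} ⊆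
      {ω | ENNReal.ofReal (1 / δ) ≤ ENNReal.ofReal (Real.exp (∑ j ∈ Finset.range T,
        p.gate f x₁ (fun j => g j ω) H j * p.exponent f σ₀ σ₁ x₁ (fun j => g j ω) H j))} :=
    fun ω hω => ENNReal.ofReal_le_ofReal ((Real.log_le_iff_le_exp (by positivity)).1 hω)
  refine (measure_mono h4).trans ?_
  have h5 : ENNReal.ofReal δ * ENNReal.ofReal (1 / δ) = 1 := by
    rw [← ENNReal.ofReal_mul hδ.le, mul_one_div_cancel hδ.ne', ENNReal.ofReal_one]
  calc _ = ENNReal.ofReal δ * ENNReal.ofReal (1 / δ) * _ := by rw [h5, one_mul]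
    _ ≤ ENNReal.ofReal δ * 1 := by
      rw [mul_assoc]
      exact mul_le_mul_right h3 _
    _ = _ := mul_one _

/-- The answers of the oracle obey the noise bound. -/
lemma ae_noiseBound (hf : Continuous (∇ f)) (hn : HasAffineNoise κ f σ₀ σ₁)
    (hrun : IsRun P κ p.β₁ p.β₂ p.η p.ε x₁ T ℱ g) :
    ∀ᵐ ω ∂P, p.NoiseBound f σ₀ σ₁ x₁ (fun j => g j ω) T := by
  rw [show (fun ω => p.NoiseBound f σ₀ σ₁ x₁ (fun j => g j ω) T) = fun ω => ∀ k, ∀ _ : k < T, ∀ i,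
    (g (k + 1) ω i - p.grad f x₁ (fun j => g j ω) k i) ^ 2 ≤
    σ₀ i ^ 2 + σ₁ i ^ 2 * p.grad f x₁ (fun j => g j ω) k i ^ 2 from rfl]
  refine ae_all_iff.2 fun k => ae_all_iff.2 fun hk => ae_all_iff.2 fun i => ?_
  have hm := p.measurable_answer hrun hk.le
  have hW := @measurable_iter d Ω (ℱ k) g k p x₁ hm
  have hY : Measurable (g (k + 1)) := (hrun.measurable k hk).mono (ℱ.le _) le_rfl
  have hlaw := map_prodMk_eq_compProd (ℱ.le k) (P := P) (κ := κ) hW measurable_id hY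
    (hrun.cond_law k hk)
  have hW' := hW.mono (ℱ.le k) le_rfl
  have : IsProbabilityMeasure (P.map fun ω => p.iter (fun j => g j ω) (k + 1) x₁) :=
    Measure.isProbabilityMeasure_map hW'.aemeasurable
  have hmeas : MeasurableSet {s : E d × E d |
      (s.2 i - ∇ f s.1 i) ^ 2 ≤ σ₀ i ^ 2 + σ₁ i ^ 2 * ∇ f s.1 i ^ 2} := by
    have := hf.measurable
    exact measurableSet_le (by fun_prop) (by fun_prop)
  -- The noise bound at each fixed point passes to the random iterate through the joint law.
  have h1 := Measure.ae_compProd_of_ae_ae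
    (μ := P.map fun ω => p.iter (fun j => g j ω) (k + 1) x₁) (κ := κ.comap id measurable_id)
    hmeas (Filter.Eventually.of_forall fun x => hn x i)
  rw [← hlaw] at h1
  exact ae_of_ae_map (hW'.prodMk hY).aemeasurable h1

end Hyper

end Adam

/-! ### The orders of `logArg` and `gradBound`. -/

namespace Adam

lemma sigmaMax_sq_le {β : ℝ} (h0 : 0 < β) (h1 : β ≤ 1) : sigmaMax β ^ 2 ≤ 2 / β := by
  have h2 : (1 : ℝ) ≤ 2 / β := by rw [le_div_iff₀ h0]; linarith
  have h3 : (1 + β) / β ≤ 2 / β := by gcongr; linarith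
  have h4 : sigmaMax β ≤ √(2 / β) := by
    refine max_le (Real.one_le_sqrt.2 h2) ?_
    have := Real.sqrt_le_sqrt h3
    linarith
  have h5 : 0 ≤ sigmaMax β := zero_le_one.trans (le_max_left _ _)
  calc sigmaMax β ^ 2 ≤ √(2 / β) ^ 2 := pow_le_pow_left₀ h5 h4 2
    _ = 2 / β := Real.sq_sqrt (by positivity)

/-- The constant in the order of `𝓕(T)`. -/
noncomputable def logArgConst (L : ℝ) : ℝ := 4 + 4 * L ^ 2

/-- The constant in the order of `ℓ`. -/
noncomputable def logConst (L : ℝ) : ℝ := 1 + 2 * Real.log (logArgConst L)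

/-- The constant in the order of `G`. -/
noncomputable def gradBoundConst (L : ℝ) : ℝ :=
  8 * L + 1024 * L ^ 2 + 8 * L ^ 2 + 48 * L + 8 * L * (6 + 5 * L) * logConst L +
    (24 * L ^ 2 + 64 * L) * logConst L + 2304 * L ^ 2 + 6400 * L ^ 2 * logConst L ^ 2

lemma four_le_logArgConst (L : ℝ) : 4 ≤ logArgConst L := by
  rw [logArgConst]; linarith [sq_nonneg L]

lemma one_le_logConst (L : ℝ) : 1 ≤ logConst L := by
  have := Real.log_nonneg ((by norm_num : (1 : ℝ) ≤ 4).trans (four_le_logArgConst L))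
  rw [logConst]; linarith

lemma gradBoundConst_nonneg {L : ℝ} (hL : 0 < L) : 0 ≤ gradBoundConst L := by
  have := one_le_logConst L
  rw [gradBoundConst]
  positivity

/-- The termwise comparison of the bound `G` with its order. -/
lemma gradBound_terms_le {L Δ₁ l' l Λ v u q s r B b C ε s₀ s₁ c D : ℝ} (hL : 0 < L)
    (hΔ : 0 ≤ Δ₁) (h2 : r ≤ 2) (hr : 0 ≤ r) (hl0' : 0 ≤ l') (hl' : l' ≤ Λ) (hl0 : 0 ≤ l)
    (hl : l ≤ c * Λ) (hΛ : 1 / 2 ≤ Λ) (hc : 1 ≤ c) (hv : 1 ≤ v) (hu : 1 ≤ u) (hB : 1 ≤ B)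
    (hq : q ≤ B) (hq0 : 0 ≤ q) (hs : s ^ 2 ≤ 2 * B) (hb0 : 0 ≤ b) (hb1 : b ≤ 1)
    (hC : 0 < C) (hε : 0 < ε) (hs₀ : 0 ≤ s₀) (hD : 0 ≤ D) :
    8 * L * Δ₁ + 256 * L ^ 2 * C ^ 2 * b ^ 2 * D ^ 2 * (u ^ 3 * v) +
      4 * L ^ 2 * C ^ 2 * b ^ 2 * D * (u ^ 2 * v) + 48 * L * C * s₀ * u * D * l' +
      8 * L * C * b ^ 2 * (u ^ 2 * v) *
        (4 * s₀ * B + (ε + r * s₀) * q + L * C * 2⁻¹ * (1 + 4 * s ^ 2)) * D * l +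
      8 * (3 * L ^ 2 * C ^ 2 * u ^ 2 + 8 * L * s₀ * C * u) * D * l +
      2304 * L ^ 2 * C ^ 2 * s₁ ^ 2 * u ^ 2 * D ^ 2 * l' ^ 2 +
      256 * (16 * L ^ 2 * C ^ 2 * s₁ ^ 2 * u ^ 2 +
        9 * L ^ 2 * C ^ 2 * b ^ 4 * (1 + s₁ ^ 2) * (B ^ 2 * u ^ 4 * v ^ 2)) * D ^ 2 * l ^ 2 ≤
    (8 * L + 1024 * L ^ 2 + 8 * L ^ 2 + 48 * L + 8 * L * (6 + 5 * L) * c +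
        (24 * L ^ 2 + 64 * L) * c + 2304 * L ^ 2 + 6400 * L ^ 2 * c ^ 2) *
      (Δ₁ + C * (C + ε + s₀) * (B * u ^ 2 * v) * (D * Λ) +
        C ^ 2 * (1 + s₁ ^ 2) * (B ^ 2 * u ^ 4 * v ^ 2) * (D ^ 2 * Λ ^ 2)) := by
  -- Here u, v, B, q stand for the inverses of 1-β₁, 1-β₁/β₂, β₂, √β₂; r is √2, s is `sigmaMax`, and
  -- c is `logConst`.
  have hu0 : 0 < u := by linarith
  have hv0 : 0 < v := by linarith
  have hB0 : 0 < B := by linarith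
  have hc0 : 0 < c := by linarith
  have hΛ0 : 0 < Λ := by linarith
  have hb2 : b ^ 2 ≤ 1 := pow_le_one₀ hb0 hb1
  have hb4 : b ^ 4 ≤ 1 := pow_le_one₀ hb0 hb1
  have hs1 : s₁ ^ 2 ≤ 1 + s₁ ^ 2 := by linarith
  have hs2 : 1 ≤ 1 + s₁ ^ 2 := by linarith [sq_nonneg s₁]
  have g1 : u ^ 2 * v ≤ B * u ^ 2 * v := by
    rw [mul_assoc]; exact le_mul_of_one_le_left (by positivity) hB
  have g2 : u ^ 2 ≤ B * u ^ 2 * v := (le_mul_of_one_le_right (by positivity) hv).trans g1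
  have g3 : u ≤ B * u ^ 2 * v := (le_self_pow₀ hu two_ne_zero).trans g2
  have g4 : u ^ 3 * v ≤ B ^ 2 * u ^ 4 * v ^ 2 :=
    calc u ^ 3 * v = 1 * u ^ 3 * v := by ring
      _ ≤ B ^ 2 * u ^ 4 * v ^ 2 := by
        have k1 : 1 ≤ B ^ 2 := one_le_pow₀ hB
        have k2 : u ^ 3 ≤ u ^ 4 := pow_le_pow_right₀ hu (by norm_num)
        have k3 : v ≤ v ^ 2 := le_self_pow₀ hv two_ne_zero
        gcongr
  have g5 : u ^ 2 ≤ B ^ 2 * u ^ 4 * v ^ 2 :=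
    (pow_le_pow_right₀ hu (by norm_num : 2 ≤ 3)).trans
      ((le_mul_of_one_le_right (by positivity) hv).trans g4)
  have x1 : C ≤ C + ε + s₀ := by linarith
  have x2 : s₀ ≤ C + ε + s₀ := by linarith
  -- The two terms of G with neither a logarithm nor Δ₁ are absorbed through 1 ≤ 2Λ and 1 ≤ 4Λ².
  have hΛ2 : 1 ≤ 4 * Λ ^ 2 := by nlinarith
  have hX : 0 < C + ε + s₀ := by positivity
  set X := C + ε + s₀ with hXdef
  set Q := B * u ^ 2 * v
  set Q₂ := B ^ 2 * u ^ 4 * v ^ 2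
  have hQ : 0 < Q := by positivity
  have hQ₂ : 0 < Q₂ := by positivity
  have t2 : 256 * L ^ 2 * C ^ 2 * b ^ 2 * D ^ 2 * (u ^ 3 * v) ≤
      1024 * L ^ 2 * (C ^ 2 * (1 + s₁ ^ 2) * Q₂ * (D ^ 2 * Λ ^ 2)) :=
    calc 256 * L ^ 2 * C ^ 2 * b ^ 2 * D ^ 2 * (u ^ 3 * v)
        = 256 * L ^ 2 * (C ^ 2 * b ^ 2 * (u ^ 3 * v) * (D ^ 2 * 1)) := by ring
      _ ≤ 256 * L ^ 2 * (C ^ 2 * (1 + s₁ ^ 2) * Q₂ * (D ^ 2 * (4 * Λ ^ 2))) := by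
          have := hb2.trans hs2
          gcongr
      _ = _ := by ring
  have t3 : 4 * L ^ 2 * C ^ 2 * b ^ 2 * D * (u ^ 2 * v) ≤ 8 * L ^ 2 * (C * X * Q * (D * Λ)) :=
    calc 4 * L ^ 2 * C ^ 2 * b ^ 2 * D * (u ^ 2 * v)
        = 4 * L ^ 2 * (C * C * (u ^ 2 * v) * (D * b ^ 2)) := by ring
      _ ≤ 4 * L ^ 2 * (C * X * Q * (D * (2 * Λ))) := by
          have : b ^ 2 ≤ 2 * Λ := by linarith
          gcongr
      _ = _ := by ring
  have t4 : 48 * L * C * s₀ * u * D * l' ≤ 48 * L * (C * X * Q * (D * Λ)) :=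
    calc 48 * L * C * s₀ * u * D * l' = 48 * L * (C * s₀ * u * (D * l')) := by ring
      _ ≤ _ := by gcongr
  have hbr : 4 * s₀ * B + (ε + r * s₀) * q + L * C * 2⁻¹ * (1 + 4 * s ^ 2) ≤
      (6 + 5 * L) * X * B := by
    have k1 : (ε + r * s₀) * q ≤ (ε + 2 * s₀) * B := by gcongr
    have k2 : L * C * 2⁻¹ * (1 + 4 * s ^ 2) ≤ L * C * 2⁻¹ * (9 * B) := by
      have : 1 + 4 * s ^ 2 ≤ 9 * B := by linarith
      gcongr
    have k3 : 0 ≤ L * C * B := by positivity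
    have k4 : 0 ≤ L * ε * B := by positivity
    have k5 : 0 ≤ L * s₀ * B := by positivity
    have k6 : 0 ≤ C * B := by positivity
    have k7 : 0 ≤ ε * B := by positivity
    rw [hXdef]
    linarith
  have t5 : 8 * L * C * b ^ 2 * (u ^ 2 * v) *
      (4 * s₀ * B + (ε + r * s₀) * q + L * C * 2⁻¹ * (1 + 4 * s ^ 2)) * D * l ≤
      8 * L * (6 + 5 * L) * c * (C * X * Q * (D * Λ)) :=
    calc _ ≤ 8 * L * C * 1 * (u ^ 2 * v) * ((6 + 5 * L) * X * B) * D * (c * Λ) := by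
          gcongr
      _ = _ := by ring
  have t6 : 8 * (3 * L ^ 2 * C ^ 2 * u ^ 2 + 8 * L * s₀ * C * u) * D * l ≤
      (24 * L ^ 2 + 64 * L) * c * (C * X * Q * (D * Λ)) :=
    calc 8 * (3 * L ^ 2 * C ^ 2 * u ^ 2 + 8 * L * s₀ * C * u) * D * l
        = 24 * L ^ 2 * (C * C * u ^ 2 * (D * l)) + 64 * L * (C * s₀ * u * (D * l)) := by ring
      _ ≤ 24 * L ^ 2 * (C * X * Q * (D * (c * Λ))) +
          64 * L * (C * X * Q * (D * (c * Λ))) := by gcongr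
      _ = _ := by ring
  have t7 : 2304 * L ^ 2 * C ^ 2 * s₁ ^ 2 * u ^ 2 * D ^ 2 * l' ^ 2 ≤
      2304 * L ^ 2 * (C ^ 2 * (1 + s₁ ^ 2) * Q₂ * (D ^ 2 * Λ ^ 2)) :=
    calc 2304 * L ^ 2 * C ^ 2 * s₁ ^ 2 * u ^ 2 * D ^ 2 * l' ^ 2
        = 2304 * L ^ 2 * (C ^ 2 * s₁ ^ 2 * u ^ 2 * (D ^ 2 * l' ^ 2)) := by ring
      _ ≤ _ := by gcongr
  have t8 : 256 * (16 * L ^ 2 * C ^ 2 * s₁ ^ 2 * u ^ 2 +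
      9 * L ^ 2 * C ^ 2 * b ^ 4 * (1 + s₁ ^ 2) * Q₂) * D ^ 2 * l ^ 2 ≤
      6400 * L ^ 2 * c ^ 2 * (C ^ 2 * (1 + s₁ ^ 2) * Q₂ * (D ^ 2 * Λ ^ 2)) :=
    calc _ ≤ 256 * (16 * L ^ 2 * C ^ 2 * (1 + s₁ ^ 2) * Q₂ +
          9 * L ^ 2 * C ^ 2 * 1 * (1 + s₁ ^ 2) * Q₂) * D ^ 2 * (c * Λ) ^ 2 := by gcongr
      _ = _ := by ring
  have p1 : 0 ≤ C * X * Q * (D * Λ) := by positivity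
  have p2 : 0 ≤ C ^ 2 * (1 + s₁ ^ 2) * Q₂ * (D ^ 2 * Λ ^ 2) := by positivity
  generalize C * X * Q * (D * Λ) = K₁ at *
  generalize C ^ 2 * (1 + s₁ ^ 2) * Q₂ * (D ^ 2 * Λ ^ 2) = K₂ at *
  have w1 : 0 ≤ 8 * L := by positivity
  have w2 : 0 ≤ 1024 * L ^ 2 := by positivity
  have w3 : 0 ≤ 8 * L ^ 2 := by positivity
  have w4 : 0 ≤ 48 * L := by positivity
  have w5 : 0 ≤ 8 * L * (6 + 5 * L) * c := by positivity
  have w6 : 0 ≤ (24 * L ^ 2 + 64 * L) * c := by positivity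
  have w7 : 0 ≤ 2304 * L ^ 2 := by positivity
  have w8 : 0 ≤ 6400 * L ^ 2 * c ^ 2 := by positivity
  linarith [mul_nonneg w1 p1, mul_nonneg w1 p2, mul_nonneg w2 p1, mul_nonneg w2 hΔ,
    mul_nonneg w3 p2, mul_nonneg w3 hΔ, mul_nonneg w4 p2, mul_nonneg w4 hΔ,
    mul_nonneg w5 p2, mul_nonneg w5 hΔ, mul_nonneg w6 p2, mul_nonneg w6 hΔ,
    mul_nonneg w7 p1, mul_nonneg w7 hΔ, mul_nonneg w8 p1, mul_nonneg w8 hΔ]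

namespace Hyper

variable {d : ℕ} (p : Hyper) {σ₀ σ₁ : Fin d → ℝ} {L grad₁ Δ₁ δ : ℝ} {T : ℕ}

lemma one_le_logArgOrder : 1 ≤ logArgOrder p.C₀ p.ε₀ p.β₁ p.β₂ σ₀ σ₁ grad₁ T := by
  have := p.one_sub_ratio_pos
  have := p.one_sub_β₂_pos
  rw [logArgOrder, le_add_iff_nonneg_right]
  positivity

lemma logArg_le :
    logArg L p.C₀ p.ε₀ p.β₁ p.β₂ σ₀ σ₁ grad₁ T ≤
      logArgConst L * logArgOrder p.C₀ p.ε₀ p.β₁ p.β₂ σ₀ σ₁ grad₁ T := by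
  have hw := p.one_sub_ratio_pos
  have hb := p.one_sub_β₂_pos
  have hε := p.ε₀_pos
  rw [logArg, logArgOrder, logArgConst, mul_pow, Real.sq_sqrt hb.le]
  set E := p.ε₀ ^ 2 * (1 - p.β₂)
  have hE : 0 < E := by positivity
  have h1 : 0 ≤ ‖σ₀‖ ^ 2 * T / E := by positivity
  have h2 : 0 ≤ (1 + ‖σ₁‖ ^ 2) * (grad₁ ^ 2 * T) / E := by positivity
  have h3 : 0 ≤ (1 + ‖σ₁‖ ^ 2) * (d * p.C₀ ^ 2 / (1 - p.β₁ / p.β₂) * (T : ℝ) ^ 3) / E := by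
    positivity
  have e1 : 2 / E * ((‖σ₀‖ ^ 2 + 2 * (1 + ‖σ₁‖ ^ 2) * grad₁ ^ 2) * T +
      2 * (1 + ‖σ₁‖ ^ 2) * d * L ^ 2 * p.C₀ ^ 2 / (1 - p.β₁ / p.β₂) * (T : ℝ) ^ 3) =
      2 * (‖σ₀‖ ^ 2 * T / E) + 4 * ((1 + ‖σ₁‖ ^ 2) * (grad₁ ^ 2 * T) / E) + 4 * L ^ 2 *
      ((1 + ‖σ₁‖ ^ 2) * (d * p.C₀ ^ 2 / (1 - p.β₁ / p.β₂) * (T : ℝ) ^ 3) / E) := by ring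
  have e2 : (‖σ₀‖ ^ 2 * T + (1 + ‖σ₁‖ ^ 2) * (grad₁ ^ 2 * T + d * p.C₀ ^ 2 /
      (1 - p.β₁ / p.β₂) * (T : ℝ) ^ 3)) / E = ‖σ₀‖ ^ 2 * T / E +
      (1 + ‖σ₁‖ ^ 2) * (grad₁ ^ 2 * T) / E +
      (1 + ‖σ₁‖ ^ 2) * (d * p.C₀ ^ 2 / (1 - p.β₁ / p.β₂) * (T : ℝ) ^ 3) / E := by ring
  rw [e1, e2]
  nlinarith [mul_nonneg (sq_nonneg L) h1, mul_nonneg (sq_nonneg L) h2, sq_nonneg L]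

/-- The logarithmic factor `Λ`. -/
noncomputable def logOrder (σ₀ σ₁ : Fin d → ℝ) (grad₁ δ : ℝ) (T : ℕ) : ℝ :=
  Real.log ((logArgOrder p.C₀ p.ε₀ p.β₁ p.β₂ σ₀ σ₁ grad₁ T + d * T) / (δ * p.β₂ ^ T))

lemma one_le_mul_cast (hd : 1 ≤ d) (hT : 1 ≤ T) : (1 : ℝ) ≤ d * T := by
  exact_mod_cast Nat.mul_le_mul hd hT

/-- The summands F₀(T) and dT are both at least 1, so the argument of the logarithm is at least 2,
and log 2 > 1/2. -/
lemma half_le_logOrder (hd : 1 ≤ d) (hT : 1 ≤ T) (hδ0 : 0 < δ) (hδ1 : δ < 1) :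
    1 / 2 ≤ p.logOrder σ₀ σ₁ grad₁ δ T := by
  have hβ : 0 < p.β₂ ^ T := pow_pos p.β₂_pos T
  have hβ1 : p.β₂ ^ T ≤ 1 := pow_le_one₀ p.β₂_pos.le p.β₂_lt_one.le
  have h1 := one_le_mul_cast hd hT
  have h2 := p.one_le_logArgOrder (σ₀ := σ₀) (σ₁ := σ₁) (grad₁ := grad₁) (T := T)
  have h3 : (2 : ℝ) ≤ (logArgOrder p.C₀ p.ε₀ p.β₁ p.β₂ σ₀ σ₁ grad₁ T + d * T) /
      (δ * p.β₂ ^ T) := by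
    rw [le_div_iff₀ (by positivity)]
    have : δ * p.β₂ ^ T ≤ 1 := mul_le_one₀ hδ1.le hβ.le hβ1
    linarith
  have h4 := Real.log_le_log two_pos h3
  have h5 := Real.log_two_gt_d9
  rw [logOrder]
  linarith

lemma log_le_logOrder (hd : 1 ≤ d) (hT : 1 ≤ T) (hδ0 : 0 < δ) :
    Real.log (d * T / δ) ≤ p.logOrder σ₀ σ₁ grad₁ δ T := by
  have hβ : 0 < p.β₂ ^ T := pow_pos p.β₂_pos T
  have hβ1 : p.β₂ ^ T ≤ 1 := pow_le_one₀ p.β₂_pos.le p.β₂_lt_one.le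
  have h1 := one_le_mul_cast hd hT
  have h2 := p.one_le_logArgOrder (σ₀ := σ₀) (σ₁ := σ₁) (grad₁ := grad₁) (T := T)
  have h0 : (0 : ℝ) < d * T := by linarith
  apply Real.log_le_log (by positivity)
  exact div_le_div₀ (by positivity) (by linarith) (by positivity)
    (mul_le_of_le_one_right hδ0.le hβ1)

/-- A factor K inside the logarithm adds log K, which is at most 2 log K · Λ because Λ ≥ 1/2. -/
lemma logFactor_le (hd : 1 ≤ d) (hT : 1 ≤ T) (hδ0 : 0 < δ) (hδ1 : δ < 1) (hL : 0 < L) :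
    p.logFactor L σ₀ σ₁ grad₁ T ≤ logConst L * p.logOrder σ₀ σ₁ grad₁ δ T := by
  have hβ : 0 < p.β₂ ^ T := pow_pos p.β₂_pos T
  have h1 := one_le_mul_cast hd hT
  have h2 := p.one_le_logArgOrder (σ₀ := σ₀) (σ₁ := σ₁) (grad₁ := grad₁) (T := T)
  have h3 := p.logArg_le (σ₀ := σ₀) (σ₁ := σ₁) (L := L) (grad₁ := grad₁) (T := T)
  have h4 := p.one_le_logArg (σ₀ := σ₀) (σ₁ := σ₁) hL grad₁ T
  have h5 := p.half_le_logOrder (σ₀ := σ₀) (σ₁ := σ₁) (grad₁ := grad₁) hd hT hδ0 hδ1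
  have hc := four_le_logArgConst L
  have h6 := Real.log_nonneg ((by norm_num : (1 : ℝ) ≤ 4).trans hc)
  set F := logArg L p.C₀ p.ε₀ p.β₁ p.β₂ σ₀ σ₁ grad₁ T
  set F₀ := logArgOrder p.C₀ p.ε₀ p.β₁ p.β₂ σ₀ σ₁ grad₁ T with hF₀
  have h7 : p.logFactor L σ₀ σ₁ grad₁ T ≤
      Real.log (logArgConst L * ((F₀ + d * T) / (δ * p.β₂ ^ T))) := by
    apply Real.log_le_log (by positivity)
    rw [← mul_div_assoc]
    refine div_le_div₀ (by positivity) ?_ (by positivity) (mul_le_of_le_one_left hβ.le hδ1.le)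
    refine h3.trans (mul_le_mul_of_nonneg_left ?_ (by linarith))
    linarith
  rw [Real.log_mul (by positivity) (by positivity)] at h7
  have h8 : Real.log ((F₀ + d * T) / (δ * p.β₂ ^ T)) = p.logOrder σ₀ σ₁ grad₁ δ T := rfl
  rw [h8] at h7
  rw [logConst]
  nlinarith

lemma gradBoundOrder_nonneg (hd : 1 ≤ d) (hT : 1 ≤ T) (hδ0 : 0 < δ) (hδ1 : δ < 1)
    (hΔ : 0 ≤ Δ₁) : 0 ≤ gradBoundOrder p.C₀ p.ε₀ p.β₁ p.β₂ σ₀ σ₁ grad₁ Δ₁ δ T := by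
  have h1 := p.half_le_logOrder (σ₀ := σ₀) (σ₁ := σ₁) (grad₁ := grad₁) hd hT hδ0 hδ1
  have h2 : 0 ≤ Real.log ((logArgOrder p.C₀ p.ε₀ p.β₁ p.β₂ σ₀ σ₁ grad₁ T + d * T) /
      (δ * p.β₂ ^ T)) := le_trans (by norm_num) h1
  have := p.C₀_pos
  have := p.ε₀_pos
  have := p.β₂_pos
  have := p.one_sub_β₁_pos
  have := p.one_sub_ratio_pos
  rw [gradBoundOrder]
  positivity

/-- The order of the bound `G`. -/
lemma gradBound_le (hd : 1 ≤ d) (hT : 1 ≤ T) (hδ0 : 0 < δ) (hδ1 : δ < 1) (hL : 0 < L)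
    (hΔ : 0 ≤ Δ₁) :
    gradBound L p.C₀ p.ε₀ p.β₁ p.β₂ σ₀ σ₁ grad₁ Δ₁ δ T ≤
      gradBoundConst L * gradBoundOrder p.C₀ p.ε₀ p.β₁ p.β₂ σ₀ σ₁ grad₁ Δ₁ δ T := by
  have hC := p.C₀_pos
  have hε := p.ε₀_pos
  have hβ := p.β₂_pos
  have hb0 := p.β₁_nonneg
  have hb1 := p.β₁_lt_one.le
  have hw1 : 1 - p.β₁ / p.β₂ ≤ 1 := by
    have := div_nonneg p.β₁_nonneg p.β₂_pos.le
    linarith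
  have hu : 1 ≤ (1 - p.β₁)⁻¹ := (one_le_inv₀ p.one_sub_β₁_pos).2 (by linarith)
  have hv : 1 ≤ (1 - p.β₁ / p.β₂)⁻¹ := (one_le_inv₀ p.one_sub_ratio_pos).2 hw1
  have hB : 1 ≤ p.β₂⁻¹ := (one_le_inv₀ hβ).2 p.β₂_lt_one.le
  have hsq : (√p.β₂)⁻¹ ≤ p.β₂⁻¹ := by
    apply inv_anti₀ hβ
    apply Real.le_sqrt_of_sq_le
    nlinarith [p.β₂_lt_one]
  have hsq0 : 0 ≤ (√p.β₂)⁻¹ := by positivity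
  have hsig := sigmaMax_sq_le hβ p.β₂_lt_one.le
  have hΛ := p.half_le_logOrder (σ₀ := σ₀) (σ₁ := σ₁) (grad₁ := grad₁) hd hT hδ0 hδ1
  have hl' := p.log_le_logOrder (σ₀ := σ₀) (σ₁ := σ₁) (grad₁ := grad₁) hd hT hδ0
  have hl := p.logFactor_le (σ₀ := σ₀) (σ₁ := σ₁) (grad₁ := grad₁) hd hT hδ0 hδ1 hL
  have hl0 : 0 ≤ p.logFactor L σ₀ σ₁ grad₁ T := p.logFactor_nonneg hL grad₁ T
  have hl0' : 0 ≤ Real.log (d * T / δ) := by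
    apply Real.log_nonneg
    rw [one_le_div hδ0]
    linarith [one_le_mul_cast hd hT]
  have hc := one_le_logConst L
  have h2 : √2 ≤ 2 := Real.sqrt_le_iff.2 ⟨by norm_num, by norm_num⟩
  have hG : gradBound L p.C₀ p.ε₀ p.β₁ p.β₂ σ₀ σ₁ grad₁ Δ₁ δ T = 8 * L * Δ₁
    + 256 * L ^ 2 * p.C₀ ^ 2 * p.β₁ ^ 2 * d ^ 2 / ((1 - p.β₁) ^ 3 * (1 - p.β₁ / p.β₂))
    + 4 * L ^ 2 * p.C₀ ^ 2 * p.β₁ ^ 2 * d / ((1 - p.β₁) ^ 2 * (1 - p.β₁ / p.β₂))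
    + 48 * L * p.C₀ * ‖σ₀‖ / (1 - p.β₁) * d * Real.log (d * T / δ)
    + 8 * L * p.C₀ * p.β₁ ^ 2 / ((1 - p.β₁) ^ 2 * (1 - p.β₁ / p.β₂)) *
        (4 * ‖σ₀‖ / p.β₂ + (p.ε₀ + √2 * ‖σ₀‖) / √p.β₂ +
          L * p.C₀ / 2 * (1 + 4 * sigmaMax p.β₂ ^ 2)) * d * p.logFactor L σ₀ σ₁ grad₁ T
    + 8 * (3 * L ^ 2 * p.C₀ ^ 2 / (1 - p.β₁) ^ 2 + 8 * L * ‖σ₀‖ * p.C₀ / (1 - p.β₁)) * d *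
        p.logFactor L σ₀ σ₁ grad₁ T
    + 2304 * L ^ 2 * p.C₀ ^ 2 * ‖σ₁‖ ^ 2 / (1 - p.β₁) ^ 2 * d ^ 2 * Real.log (d * T / δ) ^ 2
    + 256 * (16 * L ^ 2 * p.C₀ ^ 2 * ‖σ₁‖ ^ 2 / (1 - p.β₁) ^ 2
      + 9 * L ^ 2 * p.C₀ ^ 2 * p.β₁ ^ 4 * (1 + ‖σ₁‖ ^ 2)
          / (p.β₂ ^ 2 * (1 - p.β₁) ^ 4 * (1 - p.β₁ / p.β₂) ^ 2)) * d ^ 2 *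
        p.logFactor L σ₀ σ₁ grad₁ T ^ 2 := rfl
  have hO : gradBoundOrder p.C₀ p.ε₀ p.β₁ p.β₂ σ₀ σ₁ grad₁ Δ₁ δ T = Δ₁
    + p.C₀ * (p.C₀ + p.ε₀ + ‖σ₀‖) / (p.β₂ * (1 - p.β₁) ^ 2 * (1 - p.β₁ / p.β₂)) *
        (d * p.logOrder σ₀ σ₁ grad₁ δ T)
    + p.C₀ ^ 2 * (1 + ‖σ₁‖ ^ 2) / (p.β₂ ^ 2 * (1 - p.β₁) ^ 4 * (1 - p.β₁ / p.β₂) ^ 2) *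
        (d ^ 2 * p.logOrder σ₀ σ₁ grad₁ δ T ^ 2) := rfl
  rw [hG, hO, gradBoundConst]
  have hD : (0 : ℝ) ≤ d := Nat.cast_nonneg d
  have hs₀ : 0 ≤ ‖σ₀‖ := norm_nonneg _
  simp only [div_eq_mul_inv, mul_inv, ← inv_pow] at hsig hv hl' hl0' ⊢
  exact gradBound_terms_le hL hΔ h2 (Real.sqrt_nonneg 2) hl0' hl' hl0 hl hΛ hc hv hu hB hsq hsq0
    hsig hb0 hb1 hC hε hs₀ hD

end Hyper

end Adam

/-! ### Conclusion. -/

namespace Adam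

namespace Hyper

variable {d : ℕ} (p : Hyper) {f : E d → ℝ} {σ₀ σ₁ : Fin d → ℝ} {x₁ : E d} {L c δ : ℝ} {T : ℕ}

/-- The average of the squared gradients on the good event. -/
lemma average_le {g : ℕ → E d} (hf : IsLSmooth f L) (hL : 0 < L) (hc : ∀ x, c ≤ f x)
    (hd : 1 ≤ d) (hT : 1 ≤ T) (hδ0 : 0 < δ) (hδ1 : δ < 1) {G : ℝ}
    (hG : G = gradBound L p.C₀ p.ε₀ p.β₁ p.β₂ σ₀ σ₁ ‖∇ f x₁‖ (f x₁ - c) δ T)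
    (h : p.NoiseBound f σ₀ σ₁ x₁ g T)
    (hE : ∑ k ∈ Finset.range T,
      p.gate f x₁ g √(2 * G) k * p.exponent f σ₀ σ₁ x₁ g √(2 * G) k < Real.log (1 / δ)) :
    1 / (T : ℝ) * ∑ s ∈ Finset.Icc 1 T, ‖∇ f (p.iter g s x₁)‖ ^ 2 ≤
      4 / L * (G / (T * p.C₀) *
        (p.ε₀ + √(((∑ i, σ₀ i ^ 2) + (1 + ‖σ₁‖ ^ 2) * G) / (1 - p.β₂)))) := by
  have hdT := one_le_mul_cast hd hT
  have hT0 : (0 : ℝ) < T := by exact_mod_cast hT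
  have hl : 0 ≤ Real.log (d * T / δ) := by
    apply Real.log_nonneg
    rw [one_le_div hδ0]
    linarith
  -- A single supermartingale covers all steps and coordinates, so log(1/δ) would do; the stated ℓ'
  -- is larger.
  have hle : Real.log (1 / δ) ≤ Real.log (d * T / δ) :=
    Real.log_le_log (by positivity) (by gcongr)
  have hG0 : 0 ≤ G := hG ▸ p.gradBound_nonneg hL (sub_nonneg.2 (hc x₁)) hl
  have hH : √(2 * G) ^ 2 = 2 * G := Real.sq_sqrt (by positivity)
  have h1 := p.sum_norm_grad_sq_le hf hL hc hl h (Real.sqrt_nonneg (2 * G)) (by rw [hH, hG])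
    (hE.le.trans hle)
  have hs : ∑ s ∈ Finset.Icc 1 T, ‖∇ f (p.iter g s x₁)‖ ^ 2 =
      ∑ k ∈ Finset.range T, ‖p.grad f x₁ g k‖ ^ 2 := by
    have e : Finset.Icc 1 T = Finset.Ico (0 + 1) (T + 1) := by ext; simp
    rw [e, Finset.range_eq_Ico]
    exact (Finset.sum_Ico_add' (fun s => ‖∇ f (p.iter g s x₁)‖ ^ 2) 0 T 1).symm
  have hnorm : ‖σ₀‖ ^ 2 ≤ ∑ i, σ₀ i ^ 2 := by
    have h0 : 0 ≤ ∑ i, σ₀ i ^ 2 := Finset.sum_nonneg fun i _ => sq_nonneg _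
    have h2 : ‖σ₀‖ ≤ √(∑ i, σ₀ i ^ 2) := by
      refine (pi_norm_le_iff_of_nonneg (Real.sqrt_nonneg _)).2 fun i => ?_
      rw [Real.norm_eq_abs]
      exact Real.abs_le_sqrt
        (Finset.single_le_sum (f := fun i => σ₀ i ^ 2) (fun i _ => sq_nonneg _)
          (Finset.mem_univ i))
    calc ‖σ₀‖ ^ 2 ≤ √(∑ i, σ₀ i ^ 2) ^ 2 := pow_le_pow_left₀ (norm_nonneg _) h2 2
      _ = _ := Real.sq_sqrt h0
  have hb := p.one_sub_β₂_pos
  have hC := p.C₀_pos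
  have hε := p.ε₀_pos
  set M := (∑ i, σ₀ i ^ 2) + (1 + ‖σ₁‖ ^ 2) * G with hM
  have hM0 : 0 ≤ M := by positivity
  -- With H² = 2G the squared radius is at most 4M. This factor 2 and H²/L = 2G/L make the constant
  -- 4/L.
  have hR : gradRadius σ₀ σ₁ √(2 * G) ≤ 2 * √M := by
    rw [gradRadius, hH]
    apply Real.sqrt_le_iff.2 ⟨by positivity, ?_⟩
    rw [mul_pow, Real.sq_sqrt hM0, hM]
    nlinarith [sq_nonneg ‖σ₀‖]
  have hq : 0 < √(1 - p.β₂) := Real.sqrt_pos.2 hb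
  have h2 : (gradRadius σ₀ σ₁ √(2 * G) + p.ε) / p.η * (√(2 * G) ^ 2 / L) ≤
      (2 * √M + 2 * p.ε) / p.η * (2 * G / L) := by
    have := p.ε_pos
    have := p.η_pos
    rw [hH]
    gcongr
    linarith
  have e : 1 / (T : ℝ) * ((2 * √M + 2 * p.ε) / p.η * (2 * G / L)) =
      4 / L * (G / (T * p.C₀) * (p.ε₀ + √(M / (1 - p.β₂)))) := by
    rw [Real.sqrt_div hM0, ε, η]
    field_simp
    ring
  rw [hs, ← e]
  exact mul_le_mul_of_nonneg_left (h1.trans h2) (by positivity)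

end Hyper

end Adam

theorem theorem1 (L : ℝ) (hL : 0 < L) :
    -- the constant hidden in `O(·)` depends on the smoothness parameter `L` only
    ∃ C : ℝ, 0 < C ∧
      ∀ (d : ℕ) (f : Adam.E d → ℝ) (fstar : ℝ) (κ : Kernel (Adam.E d) (Adam.E d))
        (σ₀ σ₁ : Fin d → ℝ) (β₁ β₂ C₀ ε₀ δ : ℝ) (x₁ : Adam.E d) (T : ℕ)
        (Ω : Type*) (mΩ : MeasurableSpace Ω) (P : Measure Ω) (ℱ : Filtration ℕ mΩ)
        (g : ℕ → Ω → Adam.E d),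
        1 ≤ d → 1 ≤ T →
        Adam.IsLSmooth f L →
        (∀ x, fstar ≤ f x) →
        IsMarkovKernel κ →
        Adam.IsUnbiased κ f →
        (∀ i, 0 ≤ σ₀ i) → (∀ i, 0 ≤ σ₁ i) →
        Adam.HasAffineNoise κ f σ₀ σ₁ →
        0 ≤ β₁ → β₁ < β₂ → β₂ < 1 → 0 < C₀ → 0 < ε₀ →
        0 < δ → δ < 1 →
        IsProbabilityMeasure P →
        Adam.IsRun P κ β₁ β₂ (C₀ * √(1 - β₂)) (ε₀ * √(1 - β₂)) x₁ T ℱ g →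
        ∀ G : ℝ, G = Adam.gradBound L C₀ ε₀ β₁ β₂ σ₀ σ₁ ‖∇ f x₁‖ (f x₁ - fstar) δ T →
        -- with probability at least `1 - δ`
        1 - δ ≤ P.real {ω |
            1 / (T : ℝ) * ∑ s ∈ Finset.Icc 1 T,
              ‖∇ f (Adam.iterate β₁ β₂ (C₀ * √(1 - β₂)) (ε₀ * √(1 - β₂)) x₁
                (fun k => g k ω) s)‖ ^ 2 ≤
            C * (G / (T * C₀) *
              (ε₀ + √(((∑ i, σ₀ i ^ 2) + (1 + ‖σ₁‖ ^ 2) * G) / (1 - β₂))))} ∧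
        -- the orders of `𝓕(T)` and `G`
        Adam.logArg L C₀ ε₀ β₁ β₂ σ₀ σ₁ ‖∇ f x₁‖ T ≤
          C * Adam.logArgOrder C₀ ε₀ β₁ β₂ σ₀ σ₁ ‖∇ f x₁‖ T ∧
        G ≤ C * Adam.gradBoundOrder C₀ ε₀ β₁ β₂ σ₀ σ₁ ‖∇ f x₁‖ (f x₁ - fstar) δ T := by
  -- One summand for each of the three conclusions.
  refine ⟨4 / L + Adam.logArgConst L + Adam.gradBoundConst L, ?_, ?_⟩
  · have := Adam.four_le_logArgConst L
    have := Adam.gradBoundConst_nonneg hL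
    positivity
  intro d f fstar κ σ₀ σ₁ β₁ β₂ C₀ ε₀ δ x₁ T Ω mΩ P ℱ g hd hT hf hfs hκ hu _ _ hn hβ₁ hβ₁₂ hβ₂ hC₀
    hε₀ hδ0 hδ1 hP hrun G hG
  let p : Adam.Hyper := ⟨β₁, β₂, C₀, ε₀, hβ₁, hβ₁₂, hβ₂, hC₀, hε₀⟩
  have hL4 : 0 < 4 / L := by positivity
  have hK₂ := Adam.four_le_logArgConst L
  have hK₃ := Adam.gradBoundConst_nonneg hL
  have hΔ : 0 ≤ f x₁ - fstar := sub_nonneg.2 (hfs x₁)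
  have hG0 : 0 ≤ G := by
    rw [hG]
    refine p.gradBound_nonneg hL hΔ (Real.log_nonneg ?_)
    rw [one_le_div hδ0]
    linarith [Adam.Hyper.one_le_mul_cast hd hT]
  have hcont := hf.continuous_gradient hL
  refine ⟨?_, ?_, ?_⟩
  · have hbad := p.measure_lt_sum_exponent_le (H := √(2 * G)) hcont hu hn hrun hδ0
    have hae := p.ae_noiseBound hcont hn hrun
    set B := {ω | Real.log (1 / δ) ≤ ∑ j ∈ Finset.range T,
      p.gate f x₁ (fun j => g j ω) √(2 * G) j *
        p.exponent f σ₀ σ₁ x₁ (fun j => g j ω) √(2 * G) j} with hB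
    have hBm : MeasurableSet B := measurableSet_le measurable_const
      (p.measurable_sum_exponent hcont fun j hj => (hrun.measurable j hj).mono (ℱ.le _) le_rfl)
    have hB1 : 1 - δ ≤ P.real Bᶜ := by
      rw [probReal_compl_eq_one_sub hBm]
      have : P.real B ≤ δ := ENNReal.toReal_le_of_le_ofReal hδ0.le hbad
      linarith
    -- The noise bound holds almost surely, so the complement of B lies in the target event only up
    -- to a null set.
    refine hB1.trans (ENNReal.toReal_mono (measure_ne_top _ _) (measure_mono_ae ?_))
    filter_upwards [hae] with ω hω hωB
    have h1 := p.average_le hf hL hfs hd hT hδ0 hδ1 hG hω (not_le.1 hωB)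
    refine h1.trans (mul_le_mul_of_nonneg_right (by linarith) ?_)
    positivity
  · have h0 := p.one_le_logArgOrder (σ₀ := σ₀) (σ₁ := σ₁) (grad₁ := ‖∇ f x₁‖) (T := T)
    exact (p.logArg_le (L := L)).trans (mul_le_mul_of_nonneg_right (by linarith)
      (zero_le_one.trans h0))
  · have h1 := p.gradBound_le (σ₀ := σ₀) (σ₁ := σ₁) (grad₁ := ‖∇ f x₁‖) hd hT hδ0 hδ1 hL hΔ
    rw [hG]
    refine h1.trans (mul_le_mul_of_nonneg_right (by linarith) ?_)
    exact p.gradBoundOrder_nonneg hd hT hδ0 hδ1 hΔ
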